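/- Let $\Omega\subset\mathbb R^2$ be a bounded domain, $\mathbf L^2=[L^2(\Omega)]^2$, $\mathbf H^1_0=[H^1_0(\Omega)]^2$, $\mathbf H^2=[H^2(\Omega)]^2$, $\mathbf J_1=\{\mathbf v\in\mathbf H^1_0:\nabla\cdot\mathbf v=0\}$. Write $(\cdot,\cdot)$, $\|\cdot\|$ for the $L^2$ inner product and norm, $\|\cdot\|_m$ for the $H^m$ norm, $a(\mathbf v,\mathbf w)=(\nabla\mathbf v,\nabla\mathbf w)$ and $b(\mathbf v,\mathbf w,\boldsymbol\phi)=\frac12(\mathbf v\cdot\nabla\mathbf w,\boldsymbol\phi)-\frac12(\mathbf v\cdot\nabla\boldsymbol\phi,\mathbf w)$. Let $\mu,\gamma,\delta,C,M_0>0$ and $\beta(t)=\gamma e^{-\delta t}$. Assume that for every $\mathbf g\in\mathbf L^2$ the Stokes problem $-\Delta\mathbf v+\nabla q=\mathbf g$, $\nabla\cdot\mathbf v=0$ in $\Omega$, $\mathbf v|_{\partial\Omega}=0$ has a (weak) solution $\mathbf v\in\mathbf J_1\cap\mathbf H^2$, $q\in H^1(\Omega)$ with $\|\mathbf v\|_2+\|q\|_{H^1/\mathbb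 R}\le C\|\mathbf g\|$. Then there is a constant $K$, depending only on $\Omega,\mu,\gamma,\delta,C,M_0$, such that the following holds. Let $0<h<1$, let $\mathbf H_h\subset\mathbf H^1_0$ and $L_h\subset L^2(\Omega)$ be finite-dimensional subspaces and $\mathbf J_h=\{\mathbf v_h\in\mathbf H_h:(\chi_h,\nabla\cdot\mathbf v_h)=0\ \forall\chi_h\in L_h\}$, such that * for every $\mathbf w\in\mathbf H^1_0\cap\mathbf H^2$ there is $i_h\mathbf w\in\mathbf H_h$ with $\|\mathbf w-i_h\mathbf w\|+h\|\nabla(\mathbf w-i_h\mathbf w)\|\le Ch^2\|\mathbf w\|_2$; * for every $q\in H^1(\Omega)$ there is $j_hq\in L_h$ with $\|q-j_hq\|_{L^2/\mathbb R}\le Ch\|q\|_{H^1/\mathbb R}$; * $\|\nabla\mathbf w_h\|\le Ch^{-1}\|\mathbf w_h\|$ for every $\mathbf w_h\in\mathbf H_h$; * for every $\mathbf w\in\mathbf J_1\cap\mathbf H^2$ there is $r_h\mathbf w\in\mathbf J_h$ with $\|\mathbf w-r_h\mathbf w\|+h\|\nabla(\mathbf w-r_h\mathbf w)\|\le Ch^2\|\mathbf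 w\|_2$. Let $P_h:\mathbf L^2\to\mathbf J_h$ be the $L^2$-orthogonal projection, let $\Delta_h:\mathbf H_h\to\mathbf H_h$ be defined by $a(\mathbf v_h,\boldsymbol\phi_h)=(-\Delta_h\mathbf v_h,\boldsymbol\phi_h)$ for all $\boldsymbol\phi_h\in\mathbf H_h$, and $\tilde\Delta_h=P_h\Delta_h$. Let $\mathbf f:\mathbb R\to\mathbf L^2$ satisfy $\|\mathbf f(t)\|\le M_0$ for all $t>0$, and let $\mathbf u_0\in\mathbf J_1$ with $\|\mathbf u_0\|_1\le M_0$. Let $k>0$, $N\in\mathbb N$, $t_n=nk$, and let $\mathbf U^0=P_h\mathbf u_0$ and $\mathbf U^1,\dots,\mathbf U^N\in\mathbf J_h$ satisfy, for $1\le n\le N$ and all $\boldsymbol\phi_h\in\mathbf J_h$, $$\Big(\frac{\mathbf U^n-\mathbf U^{n-1}}{k},\boldsymbol\phi_h\Big)+\mu\,a(\mathbf U^n,\boldsymbol\phi_h)+a(\mathbf U^n_\beta,\boldsymbol\phi_h)=(\mathbf f(t_n),\boldsymbol\phi_h)-b(\mathbf U^n,\mathbf U^n,\boldsymbol\phi_h),\qquad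 \mathbf U^n_\beta=k\sum_{j=1}^n\beta(t_n-t_j)\mathbf U^j .$$ Then for all $1\le n\le N$, $$\|\nabla\mathbf U^n\|^2+\frac{e^{-\delta k}}{\gamma}\,\|\tilde\Delta_h\mathbf U^n_\beta\|^2\le K .$$ In particular the bound is independent of $n$, of $N$ and of the final time $t_N=Nk$ (and also of $h$ and $k$). -/

import Mathlib

open MeasureTheory TopologicalSpace
open scoped ContDiff

namespace Oldroyd

noncomputable section

/-- The Euclidean plane. -/
abbrev Plane : Type := EuclideanSpace ℝ (Fin 2)

/-- The real Hilbert space `L²(Ω)`. -/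
abbrev L2 (Ω : Opens Plane) : Type := Lp ℝ 2 (volume.restrict (Ω : Set Plane))

/-- The Hilbert space `𝐋² = [L²(Ω)]²`, with `(v, w) = (v₁, w₁) + (v₂, w₂)`. -/
abbrev VL2 (Ω : Opens Plane) : Type := PiLp 2 (fun _ : Fin 2 => L2 Ω)

/-- The classical partial derivative `∂φ/∂xᵢ`. -/
def classicalDeriv (i : Fin 2) (φ : Plane → ℝ) (x : Plane) : ℝ :=
  fderiv ℝ φ x (EuclideanSpace.single i 1)

/-- `φ ∈ C_c^∞(Ω)`. -/
structure IsTest (Ω : Opens Plane) (φ : Plane → ℝ) : Prop where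
  contDiff : ContDiff ℝ ∞ φ
  compactSupport : HasCompactSupport φ
  support_subset : tsupport φ ⊆ (Ω : Set Plane)

/-- `g ∈ L²(Ω)` is the weak partial derivative `∂ᵢ u` of `u ∈ L²(Ω)`. -/
def HasWeakDeriv {Ω : Opens Plane} (i : Fin 2) (u g : L2 Ω) : Prop :=
  ∀ φ : Plane → ℝ, IsTest Ω φ →
    ∫ x in (Ω : Set Plane), u x * classicalDeriv i φ x
      = -∫ x in (Ω : Set Plane), g x * φ x

open Classical in
/-- The weak partial derivative `∂ᵢ u` (set to `0` when `u` has none in `L²(Ω)`). -/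
def weakDeriv {Ω : Opens Plane} (i : Fin 2) (u : L2 Ω) : L2 Ω :=
  if h : ∃ g : L2 Ω, HasWeakDeriv i u g then h.choose else 0

/-- `u ∈ H¹(Ω)`. -/
def MemH1 {Ω : Opens Plane} (u : L2 Ω) : Prop :=
  ∀ i, ∃ g : L2 Ω, HasWeakDeriv i u g

/-- `u ∈ H²(Ω)`. -/
def MemH2 {Ω : Opens Plane} (u : L2 Ω) : Prop :=
  MemH1 u ∧ ∀ i, MemH1 (weakDeriv i u)

/-- `u ∈ H₀¹(Ω)`: `u` lies in the closure of `C_c^∞(Ω)` in `H¹(Ω)`. -/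
def MemH10 {Ω : Opens Plane} (u : L2 Ω) : Prop :=
  MemH1 u ∧ ∀ ε : ℝ, 0 < ε → ∃ φ : Plane → ℝ, IsTest Ω φ ∧
    eLpNorm (fun x => u x - φ x) 2 (volume.restrict (Ω : Set Plane)) < ENNReal.ofReal ε ∧
    ∀ i, eLpNorm (fun x => weakDeriv i u x - classicalDeriv i φ x) 2
      (volume.restrict (Ω : Set Plane)) < ENNReal.ofReal ε

/-- The divergence `∇·v`. -/
def divg {Ω : Opens Plane} (v : VL2 Ω) : L2 Ω := ∑ i, weakDeriv i (v i)

/-- `v ∈ 𝐇₀¹ = [H₀¹(Ω)]²`. -/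
def MemVH10 {Ω : Opens Plane} (v : VL2 Ω) : Prop := ∀ i, MemH10 (v i)

/-- `v ∈ 𝐇² = [H²(Ω)]²`. -/
def MemVH2 {Ω : Opens Plane} (v : VL2 Ω) : Prop := ∀ i, MemH2 (v i)

/-- `v ∈ 𝐉₁`: `v ∈ 𝐇₀¹` and `∇·v = 0`. -/
def MemJ1 {Ω : Opens Plane} (v : VL2 Ω) : Prop := MemVH10 v ∧ divg v = 0

/-- `a(v, w) = (∇v, ∇w) = ∑ᵢⱼ (∂ⱼ vᵢ, ∂ⱼ wᵢ)`. -/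
def aForm {Ω : Opens Plane} (v w : VL2 Ω) : ℝ :=
  ∑ i, ∑ j, inner ℝ (weakDeriv j (v i)) (weakDeriv j (w i))

/-- `(v·∇w, φ) = ∑ᵢⱼ ∫_Ω vᵢ (∂ᵢ wⱼ) φⱼ`. -/
def convect {Ω : Opens Plane} (v w φ : VL2 Ω) : ℝ :=
  ∑ i, ∑ j, ∫ x in (Ω : Set Plane), v i x * weakDeriv i (w j) x * φ j x

/-- `b(v, w, φ) = ½ (v·∇w, φ) - ½ (v·∇φ, w)`. -/
def bForm {Ω : Opens Plane} (v w φ : VL2 Ω) : ℝ :=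
  (1 / 2) * convect v w φ - (1 / 2) * convect v φ w

/-- The Dirichlet norm `‖∇v‖`. -/
def gradNorm {Ω : Opens Plane} (v : VL2 Ω) : ℝ :=
  Real.sqrt (∑ i, ∑ j, ‖weakDeriv j (v i)‖ ^ 2)

/-- The `H¹(Ω)` norm of a scalar function. -/
def h1Norm {Ω : Opens Plane} (q : L2 Ω) : ℝ :=
  Real.sqrt (‖q‖ ^ 2 + ∑ i, ‖weakDeriv i q‖ ^ 2)

/-- The `𝐇¹` norm `‖v‖₁` of a vector field. -/
def vh1Norm {Ω : Opens Plane} (v : VL2 Ω) : ℝ :=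
  Real.sqrt (‖v‖ ^ 2 + ∑ i, ∑ j, ‖weakDeriv j (v i)‖ ^ 2)

/-- The `𝐇²` norm `‖v‖₂` of a vector field. -/
def vh2Norm {Ω : Opens Plane} (v : VL2 Ω) : ℝ :=
  Real.sqrt (‖v‖ ^ 2 + ∑ i, ∑ j, ‖weakDeriv j (v i)‖ ^ 2
    + ∑ i, ∑ j, ∑ l, ‖weakDeriv l (weakDeriv j (v i))‖ ^ 2)

/-- The constant functions in `L²(Ω)`. -/
def constants (Ω : Opens Plane) : Set (L2 Ω) :=
  {c | ∃ r : ℝ, ∀ᵐ x ∂(volume.restrict (Ω : Set Plane)), c x = r}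

/-- The norm of `L²(Ω)/ℝ`. -/
def l2ModNorm {Ω : Opens Plane} (q : L2 Ω) : ℝ := ⨅ c : constants Ω, ‖q + (c : L2 Ω)‖

/-- The norm of `H¹(Ω)/ℝ`. -/
def h1ModNorm {Ω : Opens Plane} (q : L2 Ω) : ℝ := ⨅ c : constants Ω, h1Norm (q + (c : L2 Ω))

/-- Weak form of `-Δv + ∇q = g`, `∇·v = 0` in `Ω`, `v = 0` on `∂Ω`. -/
def IsStokesSolution {Ω : Opens Plane} (g v : VL2 Ω) (q : L2 Ω) : Prop :=
  MemJ1 v ∧ ∀ φ : VL2 Ω, MemVH10 φ → aForm v φ - inner ℝ q (divg φ) = inner ℝ g φ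

/-- Regularity of the steady Stokes problem on `Ω` with constant `C`: for every `g ∈ 𝐋²` it has a
solution `{v, q}` in `𝐇² × H¹` with `‖v‖₂ + ‖q‖_{H¹/ℝ} ≤ C ‖g‖`. -/
def StokesRegularity (Ω : Opens Plane) (C : ℝ) : Prop :=
  ∀ g : VL2 Ω, ∃ (v : VL2 Ω) (q : L2 Ω), IsStokesSolution g v q ∧ MemVH2 v ∧ MemH1 q ∧
    vh2Norm v + h1ModNorm q ≤ C * ‖g‖

/-! ### Linearity of the weak derivative -/

theorem IsTest.memLp {Ω : Opens Plane} {φ : Plane → ℝ} (h : IsTest Ω φ) :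
    MemLp φ 2 (volume.restrict (Ω : Set Plane)) :=
  (h.contDiff.continuous.memLp_of_hasCompactSupport h.compactSupport).restrict _

theorem IsTest.memLp_deriv {Ω : Opens Plane} {φ : Plane → ℝ} (h : IsTest Ω φ) (i : Fin 2) :
    MemLp (classicalDeriv i φ) 2 (volume.restrict (Ω : Set Plane)) := by
  refine (Continuous.memLp_of_hasCompactSupport ?_ ?_).restrict _
  · exact (h.contDiff.continuous_fderiv (by simp)).clm_apply continuous_const
  · exact h.compactSupport.fderiv_apply ℝ _

theorem integrable_mul_of_memLp {Ω : Opens Plane} (u : L2 Ω) {φ : Plane → ℝ}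
    (h : MemLp φ 2 (volume.restrict (Ω : Set Plane))) :
    Integrable (fun x => u x * φ x) (volume.restrict (Ω : Set Plane)) :=
  (Lp.memLp u).integrable_mul h

theorem integral_add_mul {Ω : Opens Plane} (u v : L2 Ω) {φ : Plane → ℝ}
    (h : MemLp φ 2 (volume.restrict (Ω : Set Plane))) :
    ∫ x in (Ω : Set Plane), (u + v : L2 Ω) x * φ x
      = (∫ x in (Ω : Set Plane), u x * φ x) + ∫ x in (Ω : Set Plane), v x * φ x := by
  rw [← integral_add (integrable_mul_of_memLp u h) (integrable_mul_of_memLp v h)]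
  refine integral_congr_ae ?_
  filter_upwards [Lp.coeFn_add u v] with x hx
  rw [hx, Pi.add_apply, add_mul]

theorem integral_smul_mul {Ω : Opens Plane} (r : ℝ) (u : L2 Ω) (φ : Plane → ℝ) :
    ∫ x in (Ω : Set Plane), (r • u : L2 Ω) x * φ x
      = r * ∫ x in (Ω : Set Plane), u x * φ x := by
  rw [← integral_const_mul]
  refine integral_congr_ae ?_
  filter_upwards [Lp.coeFn_smul r u] with x hx
  rw [hx, Pi.smul_apply, smul_eq_mul, mul_assoc]

theorem HasWeakDeriv.add {Ω : Opens Plane} {i : Fin 2} {u v g k : L2 Ω}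
    (hu : HasWeakDeriv i u g) (hv : HasWeakDeriv i v k) : HasWeakDeriv i (u + v) (g + k) := by
  intro φ hφ
  rw [integral_add_mul _ _ (hφ.memLp_deriv i), integral_add_mul _ _ hφ.memLp, hu φ hφ, hv φ hφ]
  ring

theorem HasWeakDeriv.smul {Ω : Opens Plane} {i : Fin 2} {u g : L2 Ω} (r : ℝ)
    (hu : HasWeakDeriv i u g) : HasWeakDeriv i (r • u) (r • g) := by
  intro φ hφ
  rw [integral_smul_mul, integral_smul_mul, hu φ hφ]
  ring

theorem HasWeakDeriv.unique {Ω : Opens Plane} {i : Fin 2} {u g k : L2 Ω}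
    (hg : HasWeakDeriv i u g) (hk : HasWeakDeriv i u k) : g = k := by
  have key : ∀ φ : Plane → ℝ, IsTest Ω φ →
      ∫ x in (Ω : Set Plane), (g + (-1 : ℝ) • k : L2 Ω) x * φ x = 0 := by
    intro φ hφ
    rw [integral_add_mul _ _ hφ.memLp, integral_smul_mul]
    have h1 := hg φ hφ
    have h2 := hk φ hφ
    linarith
  have hloc : LocallyIntegrableOn (g + (-1 : ℝ) • k : L2 Ω) (Ω : Set Plane) volume := by
    refine locallyIntegrableOn_of_locallyIntegrable_restrict ?_
    exact (Lp.memLp (g + (-1 : ℝ) • k : L2 Ω)).locallyIntegrable (by norm_num)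
  have h0 := Ω.isOpen.ae_eq_zero_of_integral_contDiff_smul_eq_zero hloc (by
    intro φ h1 h2 h3
    rw [← key φ ⟨h1, h2, h3⟩, ← setIntegral_eq_integral_of_forall_compl_eq_zero (s := (Ω : Set Plane))]
    · refine integral_congr_ae (Filter.Eventually.of_forall fun x => ?_)
      simp [mul_comm]
    · intro x hx
      have : φ x = 0 := image_eq_zero_of_notMem_tsupport fun hx' => hx (h3 hx')
      simp [this])
  have h0' : (g + (-1 : ℝ) • k : L2 Ω) = 0 := by
    rw [Lp.eq_zero_iff_ae_eq_zero]
    exact (ae_restrict_iff' Ω.isOpen.measurableSet).2 h0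
  rw [neg_one_smul, ← sub_eq_add_neg, sub_eq_zero] at h0'
  exact h0'

theorem HasWeakDeriv.eq {Ω : Opens Plane} {i : Fin 2} {u g : L2 Ω} (h : HasWeakDeriv i u g) :
    weakDeriv i u = g := by
  have hex : ∃ g : L2 Ω, HasWeakDeriv i u g := ⟨g, h⟩
  unfold weakDeriv
  rw [dif_pos hex]
  exact hex.choose_spec.unique h

theorem MemH1.hasWeakDeriv {Ω : Opens Plane} {u : L2 Ω} (h : MemH1 u) (i : Fin 2) :
    HasWeakDeriv i u (weakDeriv i u) := by
  obtain ⟨g, hg⟩ := h i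
  rw [hg.eq]
  exact hg

theorem weakDeriv_add {Ω : Opens Plane} (i : Fin 2) {u v : L2 Ω} (hu : MemH1 u) (hv : MemH1 v) :
    weakDeriv i (u + v) = weakDeriv i u + weakDeriv i v :=
  ((hu.hasWeakDeriv i).add (hv.hasWeakDeriv i)).eq

theorem weakDeriv_smul {Ω : Opens Plane} (i : Fin 2) (r : ℝ) {u : L2 Ω} (hu : MemH1 u) :
    weakDeriv i (r • u) = r • weakDeriv i u :=
  ((hu.hasWeakDeriv i).smul r).eq

theorem weakDeriv_zero {Ω : Opens Plane} (i : Fin 2) : weakDeriv i (0 : L2 Ω) = 0 := by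
  refine HasWeakDeriv.eq fun φ _ => ?_
  have h := integral_smul_mul (0 : ℝ) (0 : L2 Ω) (classicalDeriv i φ)
  have h' := integral_smul_mul (0 : ℝ) (0 : L2 Ω) φ
  rw [smul_zero, zero_mul] at h h'
  rw [h, h', neg_zero]

/-! ### Finite element spaces -/

/-- A pair of finite dimensional subspaces `𝐇_h ⊂ 𝐇₀¹` and `L_h ⊂ L²(Ω)`. -/
structure FESpaces (Ω : Opens Plane) where
  /-- the velocity space `𝐇_h` -/
  Hh : Submodule ℝ (VL2 Ω)
  /-- the pressure space `L_h` -/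
  Lh : Submodule ℝ (L2 Ω)
  finiteDim_Hh : FiniteDimensional ℝ Hh
  finiteDim_Lh : FiniteDimensional ℝ Lh
  memH10 : ∀ v ∈ Hh, MemVH10 v

namespace FESpaces

variable {Ω : Opens Plane} (X : FESpaces Ω)

instance : FiniteDimensional ℝ X.Hh := X.finiteDim_Hh

/-- `𝐉_h = {v ∈ 𝐇_h : (χ, ∇·v) = 0 for all χ ∈ L_h}`. -/
def Jh : Submodule ℝ (VL2 Ω) where
  carrier := {v | v ∈ X.Hh ∧ ∀ χ ∈ X.Lh, inner ℝ χ (divg v) = 0}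
  zero_mem' := by
    refine ⟨X.Hh.zero_mem, fun χ _ => ?_⟩
    have : divg (0 : VL2 Ω) = 0 := by simp [divg, weakDeriv_zero]
    rw [this, inner_zero_right]
  add_mem' := by
    rintro v w ⟨hv, hv'⟩ ⟨hw, hw'⟩
    refine ⟨X.Hh.add_mem hv hw, fun χ hχ => ?_⟩
    have : divg (v + w) = divg v + divg w := by
      simp only [divg, ← Finset.sum_add_distrib]
      exact Finset.sum_congr rfl fun i _ =>
        weakDeriv_add i (X.memH10 v hv i).1 (X.memH10 w hw i).1
    rw [this, inner_add_right, hv' χ hχ, hw' χ hχ, add_zero]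
  smul_mem' := by
    rintro r v ⟨hv, hv'⟩
    refine ⟨X.Hh.smul_mem r hv, fun χ hχ => ?_⟩
    have : divg (r • v) = r • divg v := by
      simp only [divg, Finset.smul_sum]
      exact Finset.sum_congr rfl fun i _ => weakDeriv_smul i r (X.memH10 v hv i).1
    rw [this, inner_smul_right, hv' χ hχ, mul_zero]

theorem Jh_le : X.Jh ≤ X.Hh := fun _ hv => hv.1

instance : FiniteDimensional ℝ X.Jh := Submodule.finiteDimensional_of_le X.Jh_le

/-- The `𝐋²`-orthogonal projection `P_h : 𝐋² → 𝐉_h`. -/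
def Ph : VL2 Ω →L[ℝ] X.Jh := X.Jh.orthogonalProjectionOnto

/-- The functional `φ ↦ a(v, φ)` on `𝐇_h`. -/
def aFunctional (v : VL2 Ω) : X.Hh →ₗ[ℝ] ℝ where
  toFun φ := aForm v φ
  map_add' φ ψ := by
    simp only [aForm, ← Finset.sum_add_distrib]
    refine Finset.sum_congr rfl fun i _ => Finset.sum_congr rfl fun j _ => ?_
    rw [← inner_add_right, ← weakDeriv_add j (X.memH10 φ φ.2 i).1 (X.memH10 ψ ψ.2 i).1]
    rfl
  map_smul' r φ := by
    simp only [aForm, Finset.smul_sum]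
    refine Finset.sum_congr rfl fun i _ => Finset.sum_congr rfl fun j _ => ?_
    rw [RingHom.id_apply, smul_eq_mul, ← inner_smul_right,
      ← weakDeriv_smul j r (X.memH10 φ φ.2 i).1]
    rfl

/-- The discrete Laplacian `Δ_h : 𝐇_h → 𝐇_h`: the Riesz representative determined by
`a(v, φ) = (-Δ_h v, φ)` for all `φ ∈ 𝐇_h`. -/
def discreteLaplacian (v : X.Hh) : X.Hh :=
  -(InnerProductSpace.toDual ℝ X.Hh).symm (X.aFunctional v).toContinuousLinearMap

theorem discreteLaplacian_spec (v φ : X.Hh) :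
    aForm (v : VL2 Ω) φ = inner ℝ (-(X.discreteLaplacian v)) φ := by
  rw [discreteLaplacian, neg_neg, InnerProductSpace.toDual_symm_apply]
  rfl

/-- The discrete Stokes operator `Δ̃_h = P_h Δ_h`, restricted to `𝐉_h`. -/
def discreteStokes (v : X.Jh) : X.Jh :=
  X.Ph (X.discreteLaplacian (Submodule.inclusion X.Jh_le v) : VL2 Ω)

/-- Approximation and inverse properties of `(𝐇_h, L_h)` with mesh parameter `h` and constant
`C`. -/
structure Approximation (h C : ℝ) : Prop where
  /-- approximation of velocities in `𝐇_h` -/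
  velocity : ∀ w : VL2 Ω, MemVH10 w → MemVH2 w → ∃ w' ∈ X.Hh,
    ‖w - w'‖ + h * gradNorm (w - w') ≤ C * h ^ 2 * vh2Norm w
  /-- approximation of pressures in `L_h` -/
  pressure : ∀ q : L2 Ω, MemH1 q → ∃ q' ∈ X.Lh, l2ModNorm (q - q') ≤ C * h * h1ModNorm q
  /-- inverse hypothesis -/
  inverse : ∀ w ∈ X.Hh, gradNorm w ≤ C * h⁻¹ * ‖w‖
  /-- approximation of solenoidal velocities in `𝐉_h` -/
  solenoidal : ∀ w : VL2 Ω, MemJ1 w → MemVH2 w → ∃ w' ∈ X.Jh,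
    ‖w - w'‖ + h * gradNorm (w - w') ≤ C * h ^ 2 * vh2Norm w

/-- `U_β^n = q_r^n(U) = k ∑_{j=1}^n β(t_n - t_j) U^j` with `t_n = n k`, `β(t) = γ e^{-δ t}`. -/
def memory (γ δ k : ℝ) (U : ℕ → X.Jh) (n : ℕ) : X.Jh :=
  k • ∑ j ∈ Finset.Icc 1 n, (γ * Real.exp (-δ * (n * k - j * k))) • U j

/-- `U⁰, …, U^N ∈ 𝐉_h` solves the backward Euler scheme with time step `k`, force `f` and initial
velocity `u₀`. -/
def IsBackwardEulerSolution (μ γ δ k : ℝ) (N : ℕ) (f : ℝ → VL2 Ω) (u₀ : VL2 Ω)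
    (U : ℕ → X.Jh) : Prop :=
  U 0 = X.Ph u₀ ∧
  ∀ n, 1 ≤ n → n ≤ N → ∀ φ : X.Jh,
    inner ℝ (k⁻¹ • ((U n : VL2 Ω) - U (n - 1))) (φ : VL2 Ω)
      + μ * aForm (U n : VL2 Ω) φ
      + aForm (X.memory γ δ k U n : VL2 Ω) φ
    = inner ℝ (f (n * k)) (φ : VL2 Ω) - bForm (U n : VL2 Ω) (U n) φ

end FESpaces

end

end Oldroyd

/-!
The time-discrete problem is treated as a dynamical system in `𝐉_h` for `Uⁿ` and the memory
`Vⁿ = U_β^n`, which satisfies `Vⁿ = e Vⁿ⁻¹ + k γ Uⁿ` with `e = e^{-δk}` (`FESpaces.memory_succ`).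
Write `S = -Δ̃_h`.

Two facts about the nonlinearity are needed, both with constants independent of `h`. The first is
Ladyzhenskaya's inequality, from the Gagliardo–Nirenberg–Sobolev inequality in the plane
(`abs_bForm_le`). The second is
`|b(u, u, φ)| ≤ c (‖u‖ ‖S u‖)^{1/2} ‖∇u‖ ‖φ‖` on `𝐉_h` (`Approximation.abs_bForm_self_le`). As the
boundary of `Ω` is arbitrary, no Sobolev inequality for `∇v` with `v ∈ 𝐇²` is at hand. Instead,
`-Δv` is tested with a truncation of `|v|² v`, which lies in `𝐇₀¹`; this bounds
`∫ |v|² |∇v|²` by `‖v‖₂ ‖v‖ ‖∇v‖²` (`eLpNorm_mul_weakDeriv_le`). The bound is transferred to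
`u ∈ 𝐉_h` by the Stokes lift of `u`, the solution `v` of the Stokes problem with right-hand side
`S u`; the errors `v - u` are of order `h` and `h²` by Galerkin orthogonality and duality
(`Approximation.exists_stokes_lift`), which is what the inverse inequality requires.

For the dynamics, testing with `Uⁿ` bounds the energy `E = ‖U‖² + (e/γ) ‖∇V‖²` uniformly, and
testing with `S Uⁿ` gives an inequality for the quantity `F = ‖∇U‖² + (e/γ) ‖S V‖²` in question,
with the critical term `‖∇U‖⁴` on the right. A discrete Gronwall argument would leave a bound that
depends on the final time, since `F` itself is not controlled by its dissipation uniformly in `h`: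
`‖S V‖²` decays only at the rate of the kernel, and the dissipation of `E` does not see it. Here
`ζ = ‖S V + (γ/μ) U‖` helps: in its equation the stiff terms `S U` cancel, it is damped at the fixed
rate `γ/μ`, and it is driven only by the force, by `U`, and by the nonlinearity, which is of size
`(‖S U‖ ‖∇U‖²)^{1/2}` (`IsStep.damping`). Then `log (1 + F)` has an inequality whose right-hand side
is linear in `‖∇U‖²`, hence controlled by the dissipation of `E`, and whose dissipation controls the
growth of `(1 + ζ)^{1/2}`. A suitable combination of `(1 + ζ)^{1/2}`, `log (1 + F)` and `E` is a
Lyapunov function (`exists_bound_of_recursion`). The logarithm requires `‖∇Uⁿ‖` to grow by at most a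
fixed factor in one step (`IsStep.growth`), which holds for `k ≤ 1`; for `k ≥ 1` one step of the
energy inequality bounds `‖∇Uⁿ‖` outright (`exists_bound_of_one_le`).
-/

namespace Oldroyd

section

open Filter Topology ENNReal

variable {Ω : Opens Plane}

/-! ### Test functions as elements of `L²(Ω)` -/

theorem IsTest.add {φ ψ : Plane → ℝ} (hφ : IsTest Ω φ) (hψ : IsTest Ω ψ) :
    IsTest Ω (fun x => φ x + ψ x) where
  contDiff := hφ.contDiff.add hψ.contDiff
  compactSupport := hφ.compactSupport.add hψ.compactSupport
  support_subset := (tsupport_add φ ψ).trans (Set.union_subset hφ.support_subset hψ.support_subset)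

theorem IsTest.mul_left {f φ : Plane → ℝ} (hf : ContDiff ℝ ∞ f) (hφ : IsTest Ω φ) :
    IsTest Ω (fun x => f x * φ x) where
  contDiff := hf.mul hφ.contDiff
  compactSupport := hφ.compactSupport.mul_left
  support_subset := (tsupport_mul_subset_right (f := f) (g := φ)).trans hφ.support_subset

theorem IsTest.const_mul {φ : Plane → ℝ} (r : ℝ) (hφ : IsTest Ω φ) :
    IsTest Ω (fun x => r * φ x) :=
  IsTest.mul_left contDiff_const hφ

theorem IsTest.differentiable {φ : Plane → ℝ} (hφ : IsTest Ω φ) : Differentiable ℝ φ :=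
  hφ.contDiff.differentiable (by simp)

theorem IsTest.continuous_classicalDeriv {φ : Plane → ℝ} (hφ : IsTest Ω φ) (i : Fin 2) :
    Continuous (classicalDeriv i φ) :=
  (hφ.contDiff.continuous_fderiv (by simp)).clm_apply continuous_const

theorem IsTest.hasCompactSupport_classicalDeriv {φ : Plane → ℝ} (hφ : IsTest Ω φ) (i : Fin 2) :
    HasCompactSupport (classicalDeriv i φ) :=
  hφ.compactSupport.fderiv_apply ℝ _

theorem IsTest.eq_zero_of_notMem {φ : Plane → ℝ} (hφ : IsTest Ω φ) {x : Plane}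
    (hx : x ∉ (Ω : Set Plane)) : φ x = 0 :=
  image_eq_zero_of_notMem_tsupport fun hx' => hx (hφ.support_subset hx')

theorem IsTest.classicalDeriv_eq_zero_of_notMem {φ : Plane → ℝ} (hφ : IsTest Ω φ) (i : Fin 2)
    {x : Plane} (hx : x ∉ (Ω : Set Plane)) : classicalDeriv i φ x = 0 := by
  have h : x ∉ tsupport φ := fun hx' => hx (hφ.support_subset hx')
  have : fderiv ℝ φ x = 0 := by
    by_contra hne
    exact h (support_fderiv_subset ℝ hne)
  simp [classicalDeriv, this]

/-- Integration by parts for two test functions, over the set `Ω`. -/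
theorem IsTest.integral_mul_classicalDeriv {φ ψ : Plane → ℝ} (hφ : IsTest Ω φ) (hψ : IsTest Ω ψ)
    (i : Fin 2) :
    ∫ x in (Ω : Set Plane), φ x * classicalDeriv i ψ x
      = -∫ x in (Ω : Set Plane), classicalDeriv i φ x * ψ x := by
  rw [setIntegral_eq_integral_of_forall_compl_eq_zero, setIntegral_eq_integral_of_forall_compl_eq_zero]
  · refine integral_mul_fderiv_eq_neg_fderiv_mul_of_integrable ?_ ?_ ?_
      (fun x _ => hφ.differentiable x) (fun x _ => hψ.differentiable x)
    · exact ((hφ.continuous_classicalDeriv i).mul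
        hψ.contDiff.continuous).integrable_of_hasCompactSupport hψ.compactSupport.mul_left
    · exact (hφ.contDiff.continuous.mul
        (hψ.continuous_classicalDeriv i)).integrable_of_hasCompactSupport
          hφ.compactSupport.mul_right
    · exact (hφ.contDiff.continuous.mul
        hψ.contDiff.continuous).integrable_of_hasCompactSupport hφ.compactSupport.mul_right
  · intro x hx
    rw [hψ.eq_zero_of_notMem hx, mul_zero]
  · intro x hx
    rw [hφ.eq_zero_of_notMem hx, zero_mul]

/-- A test function, as an element of `L²(Ω)`. -/
noncomputable def IsTest.toL2 {φ : Plane → ℝ} (hφ : IsTest Ω φ) : L2 Ω := hφ.memLp.toLp φ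

theorem IsTest.coeFn_toL2 {φ : Plane → ℝ} (hφ : IsTest Ω φ) :
    (hφ.toL2 : Plane → ℝ) =ᵐ[volume.restrict (Ω : Set Plane)] φ :=
  hφ.memLp.coeFn_toLp

theorem IsTest.hasWeakDeriv {φ : Plane → ℝ} (hφ : IsTest Ω φ) (i : Fin 2) :
    HasWeakDeriv i hφ.toL2 ((hφ.memLp_deriv i).toLp _) := by
  intro ψ hψ
  have h1 : ∫ x in (Ω : Set Plane), hφ.toL2 x * classicalDeriv i ψ x
      = ∫ x in (Ω : Set Plane), φ x * classicalDeriv i ψ x := by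
    refine integral_congr_ae ?_
    filter_upwards [hφ.coeFn_toL2] with x hx
    rw [hx]
  have h2 : ∫ x in (Ω : Set Plane), ((hφ.memLp_deriv i).toLp _ : L2 Ω) x * ψ x
      = ∫ x in (Ω : Set Plane), classicalDeriv i φ x * ψ x := by
    refine integral_congr_ae ?_
    filter_upwards [(hφ.memLp_deriv i).coeFn_toLp] with x hx
    rw [hx]
  rw [h1, h2, hφ.integral_mul_classicalDeriv hψ]

theorem IsTest.weakDeriv_toL2 {φ : Plane → ℝ} (hφ : IsTest Ω φ) (i : Fin 2) :
    weakDeriv i hφ.toL2 = (hφ.memLp_deriv i).toLp _ :=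
  (hφ.hasWeakDeriv i).eq

theorem IsTest.coeFn_weakDeriv {φ : Plane → ℝ} (hφ : IsTest Ω φ) (i : Fin 2) :
    (weakDeriv i hφ.toL2 : Plane → ℝ) =ᵐ[volume.restrict (Ω : Set Plane)] classicalDeriv i φ := by
  rw [hφ.weakDeriv_toL2]
  exact (hφ.memLp_deriv i).coeFn_toLp

theorem IsTest.memH1 {φ : Plane → ℝ} (hφ : IsTest Ω φ) : MemH1 hφ.toL2 :=
  fun i => ⟨_, hφ.hasWeakDeriv i⟩

/-! ### The spaces `H¹(Ω)` and `H₀¹(Ω)` as vector spaces -/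

theorem MemH1.add {u v : L2 Ω} (hu : MemH1 u) (hv : MemH1 v) : MemH1 (u + v) :=
  fun i => ⟨_, (hu.hasWeakDeriv i).add (hv.hasWeakDeriv i)⟩

theorem MemH1.smul {u : L2 Ω} (r : ℝ) (hu : MemH1 u) : MemH1 (r • u) :=
  fun i => ⟨_, (hu.hasWeakDeriv i).smul r⟩

theorem MemH1.neg {u : L2 Ω} (hu : MemH1 u) : MemH1 (-u) := by
  rw [← neg_one_smul ℝ u]
  exact hu.smul _

theorem weakDeriv_neg (i : Fin 2) {u : L2 Ω} (hu : MemH1 u) : weakDeriv i (-u) = -weakDeriv i u := by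
  rw [← neg_one_smul ℝ u, weakDeriv_smul i _ hu, neg_one_smul]

theorem weakDeriv_sub (i : Fin 2) {u v : L2 Ω} (hu : MemH1 u) (hv : MemH1 v) :
    weakDeriv i (u - v) = weakDeriv i u - weakDeriv i v := by
  rw [sub_eq_add_neg, weakDeriv_add i hu hv.neg, weakDeriv_neg i hv, sub_eq_add_neg]

theorem eLpNorm_sub_toLp (u : L2 Ω) {f : Plane → ℝ}
    (hf : MemLp f 2 (volume.restrict (Ω : Set Plane))) :
    eLpNorm (fun x => u x - f x) 2 (volume.restrict (Ω : Set Plane))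
      = ENNReal.ofReal ‖u - hf.toLp f‖ := by
  rw [Lp.norm_def, ENNReal.ofReal_toReal (Lp.eLpNorm_ne_top _)]
  refine eLpNorm_congr_ae ?_
  filter_upwards [Lp.coeFn_sub u (hf.toLp f), hf.coeFn_toLp] with x h1 h2
  rw [h1, Pi.sub_apply, h2]

/-- Membership in `H₀¹(Ω)` in terms of the norm of `L²(Ω)`. -/
theorem memH10_iff {u : L2 Ω} : MemH10 u ↔ MemH1 u ∧ ∀ ε : ℝ, 0 < ε →
    ∃ (φ : Plane → ℝ) (hφ : IsTest Ω φ), ‖u - hφ.toL2‖ < ε ∧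
      ∀ i, ‖weakDeriv i u - weakDeriv i hφ.toL2‖ < ε := by
  refine and_congr_right fun _ => forall₂_congr fun ε hε => exists_congr fun φ => ?_
  constructor
  · rintro ⟨hφ, h1, h2⟩
    refine ⟨hφ, ?_, fun i => ?_⟩
    · rw [eLpNorm_sub_toLp u hφ.memLp, ENNReal.ofReal_lt_ofReal_iff hε] at h1
      exact h1
    · have := h2 i
      rw [eLpNorm_sub_toLp _ (hφ.memLp_deriv i), ENNReal.ofReal_lt_ofReal_iff hε] at this
      rwa [hφ.weakDeriv_toL2]
  · rintro ⟨hφ, h1, h2⟩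
    refine ⟨hφ, ?_, fun i => ?_⟩
    · rw [eLpNorm_sub_toLp u hφ.memLp, ENNReal.ofReal_lt_ofReal_iff hε]
      exact h1
    · have := h2 i
      rw [eLpNorm_sub_toLp _ (hφ.memLp_deriv i), ENNReal.ofReal_lt_ofReal_iff hε]
      rwa [hφ.weakDeriv_toL2] at this

theorem IsTest.memH10 {φ : Plane → ℝ} (hφ : IsTest Ω φ) : MemH10 hφ.toL2 :=
  memH10_iff.2 ⟨hφ.memH1, fun ε hε => ⟨φ, hφ, by simpa using hε, fun i => by simpa using hε⟩⟩

theorem MemH10.add {u v : L2 Ω} (hu : MemH10 u) (hv : MemH10 v) : MemH10 (u + v) := by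
  refine memH10_iff.2 ⟨hu.1.add hv.1, fun ε hε => ?_⟩
  obtain ⟨φ, hφ, h1, h2⟩ := (memH10_iff.1 hu).2 (ε / 2) (half_pos hε)
  obtain ⟨ψ, hψ, h3, h4⟩ := (memH10_iff.1 hv).2 (ε / 2) (half_pos hε)
  have hadd : (hφ.add hψ).toL2 = hφ.toL2 + hψ.toL2 := rfl
  refine ⟨_, hφ.add hψ, ?_, fun i => ?_⟩
  · rw [hadd, add_sub_add_comm]
    exact (norm_add_le _ _).trans_lt (by linarith)
  · rw [hadd, weakDeriv_add i hu.1 hv.1, weakDeriv_add i hφ.memH1 hψ.memH1, add_sub_add_comm]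
    exact (norm_add_le _ _).trans_lt (by linarith [h2 i, h4 i])

theorem MemH10.smul {u : L2 Ω} (r : ℝ) (hu : MemH10 u) : MemH10 (r • u) := by
  refine memH10_iff.2 ⟨hu.1.smul r, fun ε hε => ?_⟩
  have hr : 0 < |r| + 1 := by positivity
  obtain ⟨φ, hφ, h1, h2⟩ := (memH10_iff.1 hu).2 (ε / (|r| + 1)) (by positivity)
  have hsmul : (hφ.const_mul r).toL2 = r • hφ.toL2 := rfl
  have key : ∀ a : L2 Ω, ‖a‖ < ε / (|r| + 1) → ‖r • a‖ < ε := by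
    intro a ha
    rw [lt_div_iff₀ hr] at ha
    rw [norm_smul, Real.norm_eq_abs]
    nlinarith [norm_nonneg a]
  refine ⟨_, hφ.const_mul r, ?_, fun i => ?_⟩
  · rw [hsmul, ← smul_sub]
    exact key _ h1
  · rw [hsmul, weakDeriv_smul i r hu.1, weakDeriv_smul i r hφ.memH1, ← smul_sub]
    exact key _ (h2 i)

theorem MemH10.sub {u v : L2 Ω} (hu : MemH10 u) (hv : MemH10 v) : MemH10 (u - v) := by
  rw [sub_eq_add_neg, ← neg_one_smul ℝ v]
  exact hu.add (hv.smul _)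

/-- Every element of `H₀¹(Ω)` is the limit, in `H¹(Ω)` and almost everywhere, of a sequence of test
functions. -/
theorem MemH10.exists_seq {u : L2 Ω} (hu : MemH10 u) :
    ∃ (φ : ℕ → Plane → ℝ) (hφ : ∀ n, IsTest Ω (φ n)),
      Tendsto (fun n => (hφ n).toL2) atTop (𝓝 u) ∧
      (∀ i, Tendsto (fun n => weakDeriv i (hφ n).toL2) atTop (𝓝 (weakDeriv i u))) ∧
      ∀ᵐ x ∂(volume.restrict (Ω : Set Plane)), Tendsto (fun n => φ n x) atTop (𝓝 (u x)) := by
  have h : ∀ n : ℕ, ∃ (φ : Plane → ℝ) (hφ : IsTest Ω φ), ‖u - hφ.toL2‖ < 1 / ((n : ℝ) + 1) ∧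
      ∀ i, ‖weakDeriv i u - weakDeriv i hφ.toL2‖ < 1 / ((n : ℝ) + 1) :=
    fun n => (memH10_iff.1 hu).2 _ (by positivity)
  choose φ hφ h1 h2 using h
  have hlim : ∀ (a : ℕ → L2 Ω) (b : L2 Ω), (∀ n, ‖b - a n‖ < 1 / ((n : ℝ) + 1)) →
      Tendsto a atTop (𝓝 b) := by
    intro a b hab
    rw [tendsto_iff_norm_sub_tendsto_zero]
    refine squeeze_zero (fun _ => norm_nonneg _) (fun n => ?_)
      (tendsto_one_div_add_atTop_nhds_zero_nat (𝕜 := ℝ))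
    rw [norm_sub_rev]
    exact (hab n).le
  have t1 := hlim _ _ h1
  obtain ⟨ns, hns, hae⟩ :=
    (tendstoInMeasure_of_tendsto_Lp (p := 2) t1).exists_seq_tendsto_ae
  refine ⟨fun n => φ (ns n), fun n => hφ (ns n), t1.comp hns.tendsto_atTop,
    fun i => (hlim _ _ fun n => h2 n i).comp hns.tendsto_atTop, ?_⟩
  have : ∀ᵐ x ∂(volume.restrict (Ω : Set Plane)), ∀ n, (hφ (ns n)).toL2 x = φ (ns n) x :=
    ae_all_iff.2 fun n => (hφ (ns n)).coeFn_toL2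
  filter_upwards [hae, this] with x hx hx'
  exact hx.congr hx'

/-! ### Sobolev inequalities on `H₀¹(Ω)` -/

/-- `∑ᵢ ‖∂ᵢ u‖`, which is equivalent to the Dirichlet norm of a scalar function. -/
noncomputable def gradSum (u : L2 Ω) : ℝ := ∑ i, ‖weakDeriv i u‖

theorem gradSum_nonneg (u : L2 Ω) : 0 ≤ gradSum u := Finset.sum_nonneg fun _ _ => norm_nonneg _

/-- The constant in the Gagliardo–Nirenberg–Sobolev inequality `‖f‖_{L²} ≤ c ‖∇f‖_{L¹}` in the
plane. -/
noncomputable def sobolevConst : NNReal :=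
  eLpNormLESNormFDerivOneConst (volume : Measure Plane) 2

theorem eLpNorm_two_le_eLpNorm_fderiv_one {f : Plane → ℝ} (hf : ContDiff ℝ ∞ f)
    (hf' : HasCompactSupport f) :
    eLpNorm f 2 volume ≤ sobolevConst * eLpNorm (fderiv ℝ f) 1 volume := by
  have hp : NNReal.HolderConjugate (Module.finrank ℝ Plane : NNReal) 2 := by
    rw [finrank_euclideanSpace_fin]
    rw [NNReal.holderConjugate_iff]
    norm_num
  exact eLpNorm_le_eLpNorm_fderiv_one volume (hf.of_le (by exact_mod_cast le_top)) hf' hp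

theorem norm_fderiv_le_sum (φ : Plane → ℝ) (x : Plane) :
    ‖fderiv ℝ φ x‖ ≤ ∑ i, ‖classicalDeriv i φ x‖ := by
  refine ContinuousLinearMap.opNorm_le_bound _ (Finset.sum_nonneg fun _ _ => norm_nonneg _)
    fun v => ?_
  have hv := (EuclideanSpace.basisFun (Fin 2) ℝ).sum_repr v
  calc ‖fderiv ℝ φ x v‖ = ‖∑ i, v i * classicalDeriv i φ x‖ := by
        conv_lhs => rw [← hv]
        simp [classicalDeriv]
    _ ≤ ∑ i, ‖v i * classicalDeriv i φ x‖ := norm_sum_le _ _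
    _ ≤ ∑ i, ‖classicalDeriv i φ x‖ * ‖v‖ := by
        refine Finset.sum_le_sum fun i _ => ?_
        rw [norm_mul, mul_comm]
        exact mul_le_mul_of_nonneg_left (PiLp.norm_apply_le v i) (norm_nonneg _)
    _ = (∑ i, ‖classicalDeriv i φ x‖) * ‖v‖ := by rw [Finset.sum_mul]

theorem IsTest.eLpNorm_volume {φ : Plane → ℝ} (hφ : IsTest Ω φ) :
    eLpNorm φ 2 volume = ENNReal.ofReal ‖hφ.toL2‖ := by
  rw [Lp.norm_def, ENNReal.ofReal_toReal (Lp.eLpNorm_ne_top _), eLpNorm_congr_ae hφ.coeFn_toL2,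
    eLpNorm_restrict_eq_of_support_subset]
  exact (subset_tsupport φ).trans hφ.support_subset

theorem IsTest.eLpNorm_classicalDeriv {φ : Plane → ℝ} (hφ : IsTest Ω φ) (i : Fin 2) :
    eLpNorm (classicalDeriv i φ) 2 volume = ENNReal.ofReal ‖weakDeriv i hφ.toL2‖ := by
  rw [Lp.norm_def, ENNReal.ofReal_toReal (Lp.eLpNorm_ne_top _),
    eLpNorm_congr_ae (hφ.coeFn_weakDeriv i), eLpNorm_restrict_eq_of_support_subset]
  intro x hx
  by_contra h
  exact hx (hφ.classicalDeriv_eq_zero_of_notMem i h)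

theorem IsTest.eLpNorm_fderiv_le {φ : Plane → ℝ} (hφ : IsTest Ω φ) :
    eLpNorm (fderiv ℝ φ) 2 volume ≤ ENNReal.ofReal (gradSum hφ.toL2) := by
  calc eLpNorm (fderiv ℝ φ) 2 volume
      ≤ eLpNorm (∑ i, fun x => ‖classicalDeriv i φ x‖) 2 volume :=
        eLpNorm_mono_real fun x => by simpa using norm_fderiv_le_sum φ x
    _ ≤ ∑ i, eLpNorm (fun x => ‖classicalDeriv i φ x‖) 2 volume :=
        eLpNorm_sum_le (fun i _ => (hφ.continuous_classicalDeriv i).norm.aestronglyMeasurable)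
          (by norm_num)
    _ = ENNReal.ofReal (gradSum hφ.toL2) := by
        rw [gradSum, ENNReal.ofReal_sum_of_nonneg fun _ _ => norm_nonneg _]
        exact Finset.sum_congr rfl fun i _ => by rw [eLpNorm_norm, hφ.eLpNorm_classicalDeriv]

/-- `‖∇(φᵐ⁺¹)‖_{L¹} ≤ (m + 1) ‖φᵐ‖ ‖∇φ‖`. With the Gagliardo–Nirenberg–Sobolev inequality applied to
powers of `φ` it yields the inequalities for `‖φ²‖` and `‖φ³‖`. -/
theorem eLpNorm_fderiv_pow_le {φ : Plane → ℝ} (hφ : ContDiff ℝ ∞ φ) (m : ℕ) :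
    eLpNorm (fderiv ℝ fun x => φ x ^ (m + 1)) 1 volume
      ≤ (m + 1 : ℕ) * (eLpNorm (fun x => φ x ^ m) 2 volume * eLpNorm (fderiv ℝ φ) 2 volume) := by
  have hd : (fderiv ℝ fun x => φ x ^ (m + 1))
      = ((m + 1 : ℕ) : ℝ) • ((fun x => φ x ^ m) • fderiv ℝ φ) := by
    funext x
    have := fderiv_pow (m + 1) ((hφ.differentiable (by simp)) x)
    rw [show (fun x => φ x ^ (m + 1)) = φ ^ (m + 1) from rfl, this]
    simp [smul_smul]
  have hφ2 : Continuous (fderiv ℝ φ) := hφ.continuous_fderiv (by simp)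
  rw [hd, eLpNorm_const_smul (((m + 1 : ℕ) : ℝ)) ((fun x => φ x ^ m) • fderiv ℝ φ) 1 volume]
  gcongr
  · rw [Real.enorm_natCast]
  · exact eLpNorm_smul_le_mul_eLpNorm hφ2.aestronglyMeasurable
      (hφ.continuous.pow m).aestronglyMeasurable

theorem IsTest.pow {φ : Plane → ℝ} (hφ : IsTest Ω φ) (m : ℕ) : IsTest Ω fun x => φ x ^ (m + 1) := by
  simp only [pow_succ]
  exact IsTest.mul_left (hφ.contDiff.pow m) hφ

theorem IsTest.eLpNorm_sq_le {φ : Plane → ℝ} (hφ : IsTest Ω φ) :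
    eLpNorm (fun x => φ x ^ 2) 2 volume
      ≤ ENNReal.ofReal (2 * sobolevConst * (‖hφ.toL2‖ * gradSum hφ.toL2)) := by
  have h := (eLpNorm_two_le_eLpNorm_fderiv_one (hφ.pow 1).contDiff (hφ.pow 1).compactSupport).trans
    (mul_le_mul_right (eLpNorm_fderiv_pow_le hφ.contDiff 1) _)
  refine h.trans ?_
  simp only [pow_one]
  rw [hφ.eLpNorm_volume]
  calc (sobolevConst : ℝ≥0∞) * ((1 + 1 : ℕ) * (ENNReal.ofReal ‖hφ.toL2‖ * eLpNorm (fderiv ℝ φ) 2 volume))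
      ≤ ENNReal.ofReal sobolevConst * (ENNReal.ofReal 2 * (ENNReal.ofReal ‖hφ.toL2‖ *
          ENNReal.ofReal (gradSum hφ.toL2))) := by
        rw [ENNReal.ofReal_coe_nnreal]
        gcongr
        · norm_num
        · exact hφ.eLpNorm_fderiv_le
    _ = _ := by
        rw [← ENNReal.ofReal_mul (norm_nonneg _), ← ENNReal.ofReal_mul (by norm_num),
          ← ENNReal.ofReal_mul (by positivity)]
        congr 1
        ring

theorem IsTest.eLpNorm_cube_le {φ : Plane → ℝ} (hφ : IsTest Ω φ) :
    eLpNorm (fun x => φ x ^ 3) 2 volume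
      ≤ ENNReal.ofReal (6 * (sobolevConst : ℝ) ^ 2 * (‖hφ.toL2‖ * gradSum hφ.toL2 ^ 2)) := by
  have h := (eLpNorm_two_le_eLpNorm_fderiv_one (hφ.pow 2).contDiff (hφ.pow 2).compactSupport).trans
    (mul_le_mul_right (eLpNorm_fderiv_pow_le hφ.contDiff 2) _)
  refine h.trans ?_
  have hg := gradSum_nonneg hφ.toL2
  calc (sobolevConst : ℝ≥0∞) * ((2 + 1 : ℕ) *
        (eLpNorm (fun x => φ x ^ 2) 2 volume * eLpNorm (fderiv ℝ φ) 2 volume))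
      ≤ ENNReal.ofReal sobolevConst * (ENNReal.ofReal 3 *
          (ENNReal.ofReal (2 * sobolevConst * (‖hφ.toL2‖ * gradSum hφ.toL2)) *
          ENNReal.ofReal (gradSum hφ.toL2))) := by
        rw [ENNReal.ofReal_coe_nnreal]
        gcongr
        · norm_num
        · exact hφ.eLpNorm_sq_le
        · exact hφ.eLpNorm_fderiv_le
    _ = _ := by
        rw [← ENNReal.ofReal_mul (by positivity), ← ENNReal.ofReal_mul (by norm_num),
          ← ENNReal.ofReal_mul (by positivity)]
        congr 1
        ring

theorem IsTest.norm_le_gradSum {φ : Plane → ℝ} (hφ : IsTest Ω φ)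
    (hΩ : Bornology.IsBounded (Ω : Set Plane)) :
    ‖hφ.toL2‖ ≤ sobolevConst * (volume (Ω : Set Plane) ^ (1 / 2 : ℝ)).toReal * gradSum hφ.toL2 := by
  have hvol : volume (Ω : Set Plane) ^ (1 / 2 : ℝ) ≠ ⊤ :=
    (ENNReal.rpow_lt_top_of_nonneg (by norm_num) hΩ.measure_lt_top.ne).ne
  have hg := gradSum_nonneg hφ.toL2
  have h := eLpNorm_two_le_eLpNorm_fderiv_one hφ.contDiff hφ.compactSupport
  have h1 : eLpNorm (fderiv ℝ φ) 1 volume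
      ≤ eLpNorm (fderiv ℝ φ) 2 volume * volume (Ω : Set Plane) ^ (1 / 2 : ℝ) := by
    have hsupp : Function.support (fun x => ‖fderiv ℝ φ x‖) ⊆ (Ω : Set Plane) := by
      intro x hx
      exact hφ.support_subset (support_fderiv_subset ℝ (norm_ne_zero_iff.1 hx))
    have hres : ∀ p : ℝ≥0∞, eLpNorm (fderiv ℝ φ) p volume
        = eLpNorm (fderiv ℝ φ) p (volume.restrict (Ω : Set Plane)) := fun p => by
      rw [← eLpNorm_norm, ← eLpNorm_restrict_eq_of_support_subset hsupp, eLpNorm_norm]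
    rw [hres, hres]
    have := eLpNorm_le_eLpNorm_mul_rpow_measure_univ (p := 1) (q := 2)
      (μ := volume.restrict (Ω : Set Plane)) (f := fderiv ℝ φ) (by norm_num)
      (hφ.contDiff.continuous_fderiv (by simp)).aestronglyMeasurable
    rw [Measure.restrict_apply_univ] at this
    refine this.trans (le_of_eq ?_)
    norm_num
  rw [hφ.eLpNorm_volume] at h
  rw [← ENNReal.ofReal_le_ofReal_iff (by positivity)]
  refine h.trans ?_
  rw [ENNReal.ofReal_mul (by positivity), ENNReal.ofReal_mul (by positivity),
    ENNReal.ofReal_coe_nnreal, ENNReal.ofReal_toReal hvol, mul_assoc]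
  gcongr
  rw [mul_comm]
  exact h1.trans (mul_le_mul_left hφ.eLpNorm_fderiv_le _)

theorem tendsto_gradSum {ι : Type*} {l : Filter ι} {a : ι → L2 Ω} {u : L2 Ω}
    (h : ∀ i, Tendsto (fun n => weakDeriv i (a n)) l (𝓝 (weakDeriv i u))) :
    Tendsto (fun n => gradSum (a n)) l (𝓝 (gradSum u)) :=
  tendsto_finsetSum _ fun i _ => (h i).norm

/-- The **Poincaré inequality** on a bounded domain. -/
theorem MemH10.norm_le_gradSum {u : L2 Ω} (hu : MemH10 u)
    (hΩ : Bornology.IsBounded (Ω : Set Plane)) :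
    ‖u‖ ≤ sobolevConst * (volume (Ω : Set Plane) ^ (1 / 2 : ℝ)).toReal * gradSum u := by
  obtain ⟨φ, hφ, h1, h2, -⟩ := hu.exists_seq
  exact le_of_tendsto_of_tendsto' h1.norm ((tendsto_gradSum h2).const_mul _)
    fun n => (hφ n).norm_le_gradSum hΩ

/-- **Ladyzhenskaya's inequality** `‖u²‖ ≤ c ‖u‖ ‖∇u‖`. -/
theorem MemH10.eLpNorm_sq_le {u : L2 Ω} (hu : MemH10 u) :
    eLpNorm (fun x => u x ^ 2) 2 (volume.restrict (Ω : Set Plane))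
      ≤ ENNReal.ofReal (2 * sobolevConst * (‖u‖ * gradSum u)) := by
  obtain ⟨φ, hφ, h1, h2, h3⟩ := hu.exists_seq
  refine (Lp.eLpNorm_lim_le_liminf_eLpNorm
    (fun n => ((hφ n).contDiff.continuous.pow 2).aestronglyMeasurable) (fun x => u x ^ 2) ?_).trans ?_
  · filter_upwards [h3] with x hx
    exact hx.pow 2
  · refine (liminf_le_liminf (Eventually.of_forall fun n =>
      (eLpNorm_restrict_le _ _ _ _).trans (hφ n).eLpNorm_sq_le)).trans (le_of_eq ?_)
    exact (ENNReal.tendsto_ofReal ((h1.norm.mul (tendsto_gradSum h2)).const_mul _)).liminf_eq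

/-- The inequality `‖u³‖ ≤ c ‖u‖ ‖∇u‖²`. -/
theorem MemH10.eLpNorm_cube_le {u : L2 Ω} (hu : MemH10 u) :
    eLpNorm (fun x => u x ^ 3) 2 (volume.restrict (Ω : Set Plane))
      ≤ ENNReal.ofReal (6 * (sobolevConst : ℝ) ^ 2 * (‖u‖ * gradSum u ^ 2)) := by
  obtain ⟨φ, hφ, h1, h2, h3⟩ := hu.exists_seq
  refine (Lp.eLpNorm_lim_le_liminf_eLpNorm
    (fun n => ((hφ n).contDiff.continuous.pow 3).aestronglyMeasurable) (fun x => u x ^ 3) ?_).trans ?_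
  · filter_upwards [h3] with x hx
    exact hx.pow 3
  · refine (liminf_le_liminf (Eventually.of_forall fun n =>
      (eLpNorm_restrict_le _ _ _ _).trans (hφ n).eLpNorm_cube_le)).trans (le_of_eq ?_)
    exact (ENNReal.tendsto_ofReal
      ((h1.norm.mul ((tendsto_gradSum h2).pow 2)).const_mul _)).liminf_eq

instance holderTriple_four_four_two : ENNReal.HolderTriple 4 4 2 := ⟨by
  rw [show (4 : ℝ≥0∞) = 2 * 2 by norm_num, ENNReal.mul_inv (by simp) (by simp), ← mul_two,
    mul_assoc, ENNReal.inv_mul_cancel (by simp) (by simp), mul_one]⟩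

/-- The `L⁴(Ω)` norm. -/
noncomputable def l4Norm (u : L2 Ω) : ℝ := (eLpNorm u 4 (volume.restrict (Ω : Set Plane))).toReal

theorem l4Norm_nonneg (u : L2 Ω) : 0 ≤ l4Norm u := ENNReal.toReal_nonneg

theorem eLpNorm_four_sq (u : L2 Ω) :
    eLpNorm u 4 (volume.restrict (Ω : Set Plane)) ^ 2
      = eLpNorm (fun x => u x ^ 2) 2 (volume.restrict (Ω : Set Plane)) := by
  have h := eLpNorm_norm_rpow (p := 2) (μ := volume.restrict (Ω : Set Plane)) u (q := 2) two_pos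
  rw [show (2 : ℝ≥0∞) * ENNReal.ofReal 2 = 4 by norm_num] at h
  rw [← ENNReal.rpow_two, ← h]
  refine eLpNorm_congr_norm_ae (Eventually.of_forall fun x => ?_)
  simp

theorem MemH10.memLp_four {u : L2 Ω} (hu : MemH10 u) :
    MemLp u 4 (volume.restrict (Ω : Set Plane)) := by
  refine ⟨Lp.aestronglyMeasurable u, ?_⟩
  have h : eLpNorm u 4 (volume.restrict (Ω : Set Plane)) ^ 2 < ⊤ := by
    rw [eLpNorm_four_sq]
    exact hu.eLpNorm_sq_le.trans_lt ENNReal.ofReal_lt_top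
  by_contra hne
  rw [not_lt, top_le_iff] at hne
  rw [hne] at h
  simp at h

theorem MemH10.l4Norm_sq_le {u : L2 Ω} (hu : MemH10 u) :
    l4Norm u ^ 2 ≤ 2 * sobolevConst * (‖u‖ * gradSum u) := by
  have hg := gradSum_nonneg u
  have h := hu.eLpNorm_sq_le
  rw [← eLpNorm_four_sq] at h
  rw [l4Norm, ← ENNReal.toReal_pow]
  exact ENNReal.toReal_le_of_le_ofReal (by positivity) h

/-! ### The convective form -/

theorem integral_mul_toLp (g : L2 Ω) {f : Plane → ℝ}
    (hf : MemLp f 2 (volume.restrict (Ω : Set Plane))) :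
    ∫ x in (Ω : Set Plane), g x * f x = inner ℝ g (hf.toLp f) := by
  rw [L2.inner_def]
  refine integral_congr_ae ?_
  filter_upwards [hf.coeFn_toLp] with x hx
  rw [hx]
  simp [mul_comm]

theorem inner_eq_integral (g u : L2 Ω) : inner ℝ g u = ∫ x in (Ω : Set Plane), g x * u x := by
  rw [integral_mul_toLp g (Lp.memLp u), Lp.toLp_coeFn]

theorem abs_integral_mul_le (g : L2 Ω) {f : Plane → ℝ}
    (hf : MemLp f 2 (volume.restrict (Ω : Set Plane))) :
    |∫ x in (Ω : Set Plane), g x * f x|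
      ≤ ‖g‖ * (eLpNorm f 2 (volume.restrict (Ω : Set Plane))).toReal := by
  rw [integral_mul_toLp g hf, ← Lp.norm_toLp f hf]
  exact abs_real_inner_le_norm _ _

/-- `∫_Ω u g w`. -/
noncomputable def triple (u g w : L2 Ω) : ℝ := ∫ x in (Ω : Set Plane), u x * g x * w x

theorem convect_eq_sum_triple (v w φ : VL2 Ω) :
    convect v w φ = ∑ i, ∑ j, triple (v i) (weakDeriv i (w j)) (φ j) := rfl

theorem triple_comm (u g w : L2 Ω) : triple u g w = triple w g u :=
  integral_congr_ae (Eventually.of_forall fun x => by ring)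

theorem integrable_triple {u w : L2 Ω} (g : L2 Ω)
    (hu : MemLp u 4 (volume.restrict (Ω : Set Plane)))
    (hw : MemLp w 4 (volume.restrict (Ω : Set Plane))) :
    Integrable (fun x => u x * g x * w x) (volume.restrict (Ω : Set Plane)) := by
  have h := integrable_mul_of_memLp g (hw.mul' hu (r := 2))
  refine h.congr (Eventually.of_forall fun x => ?_)
  ring

/-- Hölder's inequality with exponents `4`, `2`, `4`. -/
theorem abs_triple_le {u w : L2 Ω} (g : L2 Ω)
    (hu : MemLp u 4 (volume.restrict (Ω : Set Plane)))
    (hw : MemLp w 4 (volume.restrict (Ω : Set Plane))) :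
    |triple u g w| ≤ l4Norm u * ‖g‖ * l4Norm w := by
  have h := abs_integral_mul_le g (hw.mul' hu (r := 2))
  have h1 : triple u g w = ∫ x in (Ω : Set Plane), g x * (u x * w x) :=
    integral_congr_ae (Eventually.of_forall fun x => by ring)
  have h2 : (eLpNorm (fun x => u x * w x) 2 (volume.restrict (Ω : Set Plane))).toReal
      ≤ l4Norm u * l4Norm w := by
    rw [l4Norm, l4Norm, ← ENNReal.toReal_mul]
    refine ENNReal.toReal_mono (ENNReal.mul_ne_top hu.eLpNorm_ne_top hw.eLpNorm_ne_top) ?_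
    have h3 := eLpNorm_smul_le_mul_eLpNorm (p := 4) (q := 4) (r := 2) hw.1 hu.1
    rw [smul_eq_mul] at h3
    exact h3
  rw [h1]
  refine h.trans ((mul_le_mul_of_nonneg_left h2 (norm_nonneg _)).trans (le_of_eq ?_))
  ring

theorem triple_sub_mid {u w : L2 Ω} (g g' : L2 Ω)
    (hu : MemLp u 4 (volume.restrict (Ω : Set Plane)))
    (hw : MemLp w 4 (volume.restrict (Ω : Set Plane))) :
    triple u (g - g') w = triple u g w - triple u g' w := by
  rw [triple, triple, triple, ← integral_sub (integrable_triple g hu hw) (integrable_triple g' hu hw)]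
  refine integral_congr_ae ?_
  filter_upwards [Lp.coeFn_sub g g'] with x hx
  rw [hx, Pi.sub_apply]
  ring

theorem triple_sub_right {u w w' : L2 Ω} (g : L2 Ω)
    (hu : MemLp u 4 (volume.restrict (Ω : Set Plane)))
    (hw : MemLp w 4 (volume.restrict (Ω : Set Plane)))
    (hw' : MemLp w' 4 (volume.restrict (Ω : Set Plane))) :
    triple u g (w - w') = triple u g w - triple u g w' := by
  rw [triple, triple, triple, ← integral_sub (integrable_triple g hu hw) (integrable_triple g hu hw')]
  refine integral_congr_ae ?_
  filter_upwards [Lp.coeFn_sub w w'] with x hx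
  rw [hx, Pi.sub_apply]
  ring

theorem tendsto_triple_mid {u w : L2 Ω} (hu : MemLp u 4 (volume.restrict (Ω : Set Plane)))
    (hw : MemLp w 4 (volume.restrict (Ω : Set Plane))) {g : ℕ → L2 Ω} {g' : L2 Ω}
    (hg : Tendsto g atTop (𝓝 g')) :
    Tendsto (fun n => triple u (g n) w) atTop (𝓝 (triple u g' w)) := by
  rw [tendsto_iff_norm_sub_tendsto_zero] at hg ⊢
  refine squeeze_zero (fun _ => norm_nonneg _) (fun n => ?_)
    (by simpa using (hg.const_mul (l4Norm u)).mul_const (l4Norm w))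
  rw [← triple_sub_mid _ _ hu hw]
  exact abs_triple_le _ hu hw

theorem MemH10.tendsto_l4Norm_sub {u : L2 Ω} (hu : MemH10 u) {a : ℕ → L2 Ω}
    (ha : ∀ n, MemH10 (a n)) (h1 : Tendsto a atTop (𝓝 u))
    (h2 : ∀ i, Tendsto (fun n => weakDeriv i (a n)) atTop (𝓝 (weakDeriv i u))) :
    Tendsto (fun n => l4Norm (a n - u)) atTop (𝓝 0) := by
  have hg : Tendsto (fun n => gradSum (a n - u)) atTop (𝓝 0) := by
    have : Tendsto (fun n => ∑ i, ‖weakDeriv i (a n) - weakDeriv i u‖) atTop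
        (𝓝 (∑ _i : Fin 2, (0 : ℝ))) :=
      tendsto_finsetSum _ fun i _ => tendsto_iff_norm_sub_tendsto_zero.1 (h2 i)
    rw [Finset.sum_const_zero] at this
    refine this.congr fun n => ?_
    exact Finset.sum_congr rfl fun i _ => by rw [weakDeriv_sub i (ha n).1 hu.1]
  have hs : Tendsto (fun n => l4Norm (a n - u) ^ 2) atTop (𝓝 0) := by
    refine squeeze_zero (fun _ => sq_nonneg _) (fun n => ((ha n).sub hu).l4Norm_sq_le) ?_
    simpa using ((tendsto_iff_norm_sub_tendsto_zero.1 h1).mul hg).const_mul (2 * (sobolevConst : ℝ))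
  have := hs.sqrt
  rw [Real.sqrt_zero] at this
  exact this.congr fun n => Real.sqrt_sq (l4Norm_nonneg _)

theorem MemH10.tendsto_triple_right {u w : L2 Ω} (g : L2 Ω) (hu : MemH10 u) (hw : MemH10 w)
    {a : ℕ → L2 Ω} (ha : ∀ n, MemH10 (a n)) (h1 : Tendsto a atTop (𝓝 w))
    (h2 : ∀ i, Tendsto (fun n => weakDeriv i (a n)) atTop (𝓝 (weakDeriv i w))) :
    Tendsto (fun n => triple u g (a n)) atTop (𝓝 (triple u g w)) := by
  rw [tendsto_iff_norm_sub_tendsto_zero]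
  refine squeeze_zero (fun _ => norm_nonneg _) (fun n => ?_)
    (by simpa using (hw.tendsto_l4Norm_sub ha h1 h2).const_mul (l4Norm u * ‖g‖))
  rw [← triple_sub_right _ hu.memLp_four (ha n).memLp_four hw.memLp_four]
  exact abs_triple_le _ hu.memLp_four ((ha n).sub hw).memLp_four

theorem classicalDeriv_mul {φ ψ : Plane → ℝ} (hφ : Differentiable ℝ φ) (hψ : Differentiable ℝ ψ)
    (i : Fin 2) (x : Plane) :
    classicalDeriv i (fun y => φ y * ψ y) x
      = classicalDeriv i φ x * ψ x + φ x * classicalDeriv i ψ x := by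
  have := fderiv_fun_mul (hφ x) (hψ x)
  simp only [classicalDeriv, this]
  simp
  ring

theorem MemJ1.sum_triple_test_eq_zero {v : VL2 Ω} (hv : MemJ1 v) {φ ψ : Plane → ℝ}
    (hφ : IsTest Ω φ) (hψ : IsTest Ω ψ) :
    ∑ i, (triple (v i) (weakDeriv i hφ.toL2) hψ.toL2
      + triple (v i) (weakDeriv i hψ.toL2) hφ.toL2) = 0 := by
  have hprod : IsTest Ω (fun x => φ x * ψ x) := IsTest.mul_left hφ.contDiff hψ
  have h1 : ∀ i, triple (v i) (weakDeriv i hφ.toL2) hψ.toL2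
      + triple (v i) (weakDeriv i hψ.toL2) hφ.toL2
      = -inner ℝ (weakDeriv i (v i)) hprod.toL2 := by
    intro i
    have hdual : inner ℝ (weakDeriv i (v i)) hprod.toL2
        = ∫ x in (Ω : Set Plane), weakDeriv i (v i) x * (φ x * ψ x) :=
      (integral_mul_toLp _ hprod.memLp).symm
    rw [hdual, triple, triple, ← integral_add
      (integrable_triple _ (hv.1 i).memLp_four hψ.memH10.memLp_four)
      (integrable_triple _ (hv.1 i).memLp_four hφ.memH10.memLp_four),
      ← (hv.1 i).1.hasWeakDeriv i _ hprod]
    refine integral_congr_ae ?_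
    filter_upwards [hφ.coeFn_toL2, hψ.coeFn_toL2, hφ.coeFn_weakDeriv i, hψ.coeFn_weakDeriv i]
      with x e1 e2 e3 e4
    rw [e1, e2, e3, e4, classicalDeriv_mul hφ.differentiable hψ.differentiable]
    ring
  rw [Finset.sum_congr rfl fun i _ => h1 i, Finset.sum_neg_distrib, ← sum_inner]
  have : ∑ i, weakDeriv i (v i) = 0 := hv.2
  rw [this, inner_zero_left, neg_zero]

/-- `∫ v · ∇(a b) = 0` for solenoidal `v` and `a, b ∈ H₀¹(Ω)`, by approximation with test functions. -/
theorem MemJ1.sum_triple_eq_zero {v : VL2 Ω} (hv : MemJ1 v) {a b : L2 Ω}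
    (ha : MemH10 a) (hb : MemH10 b) :
    ∑ i, (triple (v i) (weakDeriv i a) b + triple (v i) (weakDeriv i b) a) = 0 := by
  have step : ∀ {ψ : Plane → ℝ} (hψ : IsTest Ω ψ),
      ∑ i, (triple (v i) (weakDeriv i a) hψ.toL2
        + triple (v i) (weakDeriv i hψ.toL2) a) = 0 := by
    intro ψ hψ
    obtain ⟨φ, hφ, t1, t2, -⟩ := ha.exists_seq
    refine tendsto_nhds_unique (tendsto_finsetSum _ fun i _ =>
      (tendsto_triple_mid (hv.1 i).memLp_four hψ.memH10.memLp_four (t2 i)).add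
      ((hv.1 i).tendsto_triple_right (weakDeriv i hψ.toL2) ha (fun n => (hφ n).memH10) t1 t2)) ?_
    exact tendsto_const_nhds.congr fun n => (hv.sum_triple_test_eq_zero (hφ n) hψ).symm
  obtain ⟨ψ, hψ, t1, t2, -⟩ := hb.exists_seq
  refine tendsto_nhds_unique (tendsto_finsetSum _ fun i _ =>
    ((hv.1 i).tendsto_triple_right (weakDeriv i a) hb (fun n => (hψ n).memH10) t1 t2).add
    (tendsto_triple_mid (hv.1 i).memLp_four ha.memLp_four (t2 i))) ?_
  exact tendsto_const_nhds.congr fun n => (step (hψ n)).symm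

/-- The convective form of a solenoidal field is skew-symmetric. -/
theorem MemJ1.convect_eq_neg {v w φ : VL2 Ω} (hv : MemJ1 v) (hw : MemVH10 w) (hφ : MemVH10 φ) :
    convect v w φ = -convect v φ w := by
  rw [eq_neg_iff_add_eq_zero, convect_eq_sum_triple, convect_eq_sum_triple,
    ← Finset.sum_add_distrib]
  simp only [← Finset.sum_add_distrib]
  rw [Finset.sum_comm]
  exact Finset.sum_eq_zero fun j _ => hv.sum_triple_eq_zero (hw j) (hφ j)

theorem MemVH10.sub {v w : VL2 Ω} (hv : MemVH10 v) (hw : MemVH10 w) : MemVH10 (v - w) :=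
  fun i => (hv i).sub (hw i)

theorem convect_sub_left {v v' w φ : VL2 Ω} (hv : MemVH10 v) (hv' : MemVH10 v')
    (hφ : MemVH10 φ) : convect (v - v') w φ = convect v w φ - convect v' w φ := by
  simp only [convect_eq_sum_triple, ← Finset.sum_sub_distrib]
  refine Finset.sum_congr rfl fun i _ => Finset.sum_congr rfl fun j _ => ?_
  rw [triple_comm, triple_comm (v i), triple_comm (v' i)]
  exact triple_sub_right _ (hφ j).memLp_four (hv i).memLp_four (hv' i).memLp_four

theorem convect_sub_mid {v w w' φ : VL2 Ω} (hv : MemVH10 v) (hw : MemVH10 w) (hw' : MemVH10 w')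
    (hφ : MemVH10 φ) : convect v (w - w') φ = convect v w φ - convect v w' φ := by
  simp only [convect_eq_sum_triple, ← Finset.sum_sub_distrib]
  refine Finset.sum_congr rfl fun i _ => Finset.sum_congr rfl fun j _ => ?_
  rw [PiLp.sub_apply, weakDeriv_sub i (hw j).1 (hw' j).1]
  exact triple_sub_mid _ _ (hv i).memLp_four (hφ j).memLp_four

theorem convect_sub_right {v w φ φ' : VL2 Ω} (hv : MemVH10 v) (hφ : MemVH10 φ)
    (hφ' : MemVH10 φ') : convect v w (φ - φ') = convect v w φ - convect v w φ' := by
  simp only [convect_eq_sum_triple, ← Finset.sum_sub_distrib]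
  refine Finset.sum_congr rfl fun i _ => Finset.sum_congr rfl fun j _ => ?_
  exact triple_sub_right _ (hv i).memLp_four (hφ j).memLp_four (hφ' j).memLp_four

/-! ### The Dirichlet form -/

theorem gradNorm_nonneg (v : VL2 Ω) : 0 ≤ gradNorm v := Real.sqrt_nonneg _

theorem gradNorm_sq (v : VL2 Ω) : gradNorm v ^ 2 = aForm v v := by
  rw [gradNorm, Real.sq_sqrt (Finset.sum_nonneg fun _ _ => Finset.sum_nonneg fun _ _ => sq_nonneg _)]
  simp only [aForm, real_inner_self_eq_norm_sq]

theorem norm_weakDeriv_le_gradNorm (v : VL2 Ω) (i j : Fin 2) :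
    ‖weakDeriv j (v i)‖ ≤ gradNorm v := by
  refine Real.le_sqrt_of_sq_le ?_
  exact (Finset.single_le_sum (f := fun j => ‖weakDeriv j (v i)‖ ^ 2)
    (fun _ _ => sq_nonneg _) (Finset.mem_univ j)).trans
    (Finset.single_le_sum (f := fun i => ∑ j, ‖weakDeriv j (v i)‖ ^ 2)
    (fun _ _ => Finset.sum_nonneg fun _ _ => sq_nonneg _) (Finset.mem_univ i))

theorem gradSum_le_gradNorm (v : VL2 Ω) (i : Fin 2) : gradSum (v i) ≤ 2 * gradNorm v := by
  rw [gradSum, Fin.sum_univ_two]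
  linarith [norm_weakDeriv_le_gradNorm v i 0, norm_weakDeriv_le_gradNorm v i 1]

theorem MemVH10.l4Norm_le {v : VL2 Ω} (hv : MemVH10 v) (i : Fin 2) :
    l4Norm (v i) ≤ Real.sqrt (4 * sobolevConst * (‖v‖ * gradNorm v)) := by
  refine Real.le_sqrt_of_sq_le ((hv i).l4Norm_sq_le.trans ?_)
  have h1 := gradSum_le_gradNorm v i
  have h2 : ‖v i‖ ≤ ‖v‖ := PiLp.norm_apply_le v i
  have h3 := gradSum_nonneg (v i)
  have h4 := gradNorm_nonneg v
  have : ‖v i‖ * gradSum (v i) ≤ ‖v‖ * (2 * gradNorm v) := by gcongr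
  have hc : (0 : ℝ) ≤ sobolevConst := sobolevConst.2
  nlinarith

/-- The bound of the convective form by Hölder's and Ladyzhenskaya's inequalities. -/
theorem abs_convect_le {v φ : VL2 Ω} (w : VL2 Ω) (hv : MemVH10 v) (hφ : MemVH10 φ) :
    |convect v w φ| ≤ 16 * sobolevConst * (Real.sqrt (‖v‖ * gradNorm v) * gradNorm w
      * Real.sqrt (‖φ‖ * gradNorm φ)) := by
  have hc : (0 : ℝ) ≤ sobolevConst := sobolevConst.2
  have hb : ∀ i j, |triple (v i) (weakDeriv i (w j)) (φ j)| ≤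
      Real.sqrt (4 * sobolevConst * (‖v‖ * gradNorm v)) * gradNorm w *
        Real.sqrt (4 * sobolevConst * (‖φ‖ * gradNorm φ)) := by
    intro i j
    refine (abs_triple_le _ (hv i).memLp_four (hφ j).memLp_four).trans ?_
    gcongr
    · exact l4Norm_nonneg _
    · exact mul_nonneg (Real.sqrt_nonneg _) (gradNorm_nonneg _)
    · exact hv.l4Norm_le i
    · exact norm_weakDeriv_le_gradNorm w j i
    · exact hφ.l4Norm_le j
  rw [convect_eq_sum_triple]
  calc |∑ i, ∑ j, triple (v i) (weakDeriv i (w j)) (φ j)|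
      ≤ ∑ _i : Fin 2, ∑ _j : Fin 2, Real.sqrt (4 * sobolevConst * (‖v‖ * gradNorm v)) * gradNorm w *
        Real.sqrt (4 * sobolevConst * (‖φ‖ * gradNorm φ)) := by
        refine (Finset.abs_sum_le_sum_abs _ _).trans (Finset.sum_le_sum fun i _ => ?_)
        exact (Finset.abs_sum_le_sum_abs _ _).trans (Finset.sum_le_sum fun j _ => hb i j)
    _ = _ := by
        rw [Real.sqrt_mul (by positivity), Real.sqrt_mul (by positivity : (0 : ℝ) ≤ 4 * sobolevConst)]
        simp only [Finset.sum_const, Finset.card_univ, Fintype.card_fin, nsmul_eq_mul]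
        have := Real.mul_self_sqrt (by positivity : (0 : ℝ) ≤ 4 * sobolevConst)
        push_cast
        linear_combination 4 * (Real.sqrt (‖v‖ * gradNorm v) * gradNorm w
          * Real.sqrt (‖φ‖ * gradNorm φ)) * this

theorem aForm_comm (v w : VL2 Ω) : aForm v w = aForm w v := by
  simp only [aForm, real_inner_comm]

theorem aForm_sub_left {v v' : VL2 Ω} (w : VL2 Ω) (hv : MemVH10 v) (hv' : MemVH10 v') :
    aForm (v - v') w = aForm v w - aForm v' w := by
  simp only [aForm, ← Finset.sum_sub_distrib]
  refine Finset.sum_congr rfl fun i _ => Finset.sum_congr rfl fun j _ => ?_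
  rw [PiLp.sub_apply, weakDeriv_sub j (hv i).1 (hv' i).1, inner_sub_left]

theorem aForm_sub_right {v v' : VL2 Ω} (w : VL2 Ω) (hv : MemVH10 v) (hv' : MemVH10 v') :
    aForm w (v - v') = aForm w v - aForm w v' := by
  rw [aForm_comm, aForm_sub_left w hv hv', aForm_comm v, aForm_comm v']

/-- The gradient of a vector field, as an element of a Hilbert space. -/
noncomputable def gradVec (v : VL2 Ω) : PiLp 2 (fun _ : Fin 2 × Fin 2 => L2 Ω) :=
  WithLp.toLp 2 fun p => weakDeriv p.2 (v p.1)

theorem inner_gradVec (v w : VL2 Ω) : inner ℝ (gradVec v) (gradVec w) = aForm v w := by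
  rw [PiLp.inner_apply, Fintype.sum_prod_type]
  rfl

theorem norm_gradVec (v : VL2 Ω) : ‖gradVec v‖ = gradNorm v := by
  rw [← Real.sqrt_sq (norm_nonneg (gradVec v)), ← real_inner_self_eq_norm_sq, inner_gradVec,
    ← gradNorm_sq, Real.sqrt_sq (gradNorm_nonneg v)]

theorem gradVec_sub {v w : VL2 Ω} (hv : MemVH10 v) (hw : MemVH10 w) :
    gradVec (v - w) = gradVec v - gradVec w := by
  ext1 p
  exact weakDeriv_sub p.2 (hv p.1).1 (hw p.1).1

theorem abs_aForm_le (v w : VL2 Ω) : |aForm v w| ≤ gradNorm v * gradNorm w := by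
  rw [← inner_gradVec, ← norm_gradVec, ← norm_gradVec]
  exact abs_real_inner_le_norm _ _

theorem gradNorm_sub_le {v w : VL2 Ω} (hv : MemVH10 v) (hw : MemVH10 w) :
    gradNorm (v - w) ≤ gradNorm v + gradNorm w := by
  rw [← norm_gradVec, ← norm_gradVec, ← norm_gradVec, gradVec_sub hv hw]
  exact norm_sub_le _ _

theorem gradNorm_le_add_sub {v w : VL2 Ω} (hv : MemVH10 v) (hw : MemVH10 w) :
    gradNorm v ≤ gradNorm w + gradNorm (v - w) := by
  rw [← norm_gradVec, ← norm_gradVec, ← norm_gradVec, gradVec_sub hv hw]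
  calc ‖gradVec v‖ = ‖gradVec w + (gradVec v - gradVec w)‖ := by rw [add_sub_cancel]
    _ ≤ _ := norm_add_le _ _

theorem norm_divg_le (v : VL2 Ω) : ‖divg v‖ ≤ 2 * gradNorm v := by
  rw [divg, Fin.sum_univ_two]
  refine (norm_add_le _ _).trans ?_
  linarith [norm_weakDeriv_le_gradNorm v 0 0, norm_weakDeriv_le_gradNorm v 1 1]

theorem divg_sub {v w : VL2 Ω} (hv : MemVH10 v) (hw : MemVH10 w) :
    divg (v - w) = divg v - divg w := by
  simp only [divg, ← Finset.sum_sub_distrib]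
  exact Finset.sum_congr rfl fun i _ => weakDeriv_sub i (hv i).1 (hw i).1

/-- A constant in the vector-valued Poincaré inequality. -/
noncomputable def poincareConst (Ω : Opens Plane) : ℝ :=
  4 * (sobolevConst * (volume (Ω : Set Plane) ^ (1 / 2 : ℝ)).toReal) + 1

theorem poincareConst_pos (Ω : Opens Plane) : 0 < poincareConst Ω := by
  unfold poincareConst
  positivity

theorem MemVH10.norm_le {v : VL2 Ω} (hv : MemVH10 v) (hΩ : Bornology.IsBounded (Ω : Set Plane)) :
    ‖v‖ ≤ poincareConst Ω * gradNorm v := by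
  have hb : ∀ i, ‖v i‖ ≤ sobolevConst * (volume (Ω : Set Plane) ^ (1 / 2 : ℝ)).toReal
      * (2 * gradNorm v) := fun i =>
    ((hv i).norm_le_gradSum hΩ).trans
      (mul_le_mul_of_nonneg_left (gradSum_le_gradNorm v i) (by positivity))
  have hsum : ‖v‖ ≤ ‖v 0‖ + ‖v 1‖ := by
    rw [PiLp.norm_eq_of_L2, Fin.sum_univ_two]
    refine Real.sqrt_le_iff.2 ⟨by positivity, ?_⟩
    nlinarith [norm_nonneg (v 0), norm_nonneg (v 1)]
  have := gradNorm_nonneg v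
  unfold poincareConst
  nlinarith [hb 0, hb 1]

/-! ### Mean values of divergences -/

/-- Derivatives of functions in `H₀¹(Ω)` have mean value zero. -/
theorem MemH10.inner_constants {u c : L2 Ω} (hu : MemH10 u) (hc : c ∈ constants Ω) (i : Fin 2) :
    inner ℝ c (weakDeriv i u) = 0 := by
  obtain ⟨r, hr⟩ := hc
  obtain ⟨φ, hφ, -, t2, -⟩ := hu.exists_seq
  refine tendsto_nhds_unique (tendsto_const_nhds.inner (t2 i)) (tendsto_const_nhds.congr fun n => ?_)
  rw [inner_eq_integral]
  have h1 : ∫ x in (Ω : Set Plane), c x * weakDeriv i (hφ n).toL2 x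
      = ∫ x in (Ω : Set Plane), r * classicalDeriv i (φ n) x := by
    refine integral_congr_ae ?_
    filter_upwards [hr, (hφ n).coeFn_weakDeriv i] with x e1 e2
    rw [e1, e2]
  rw [h1, setIntegral_eq_integral_of_forall_compl_eq_zero]
  · have := integral_mul_fderiv_eq_neg_fderiv_mul_of_integrable (μ := (volume : Measure Plane))
      (f := fun _ => r) (g := φ n) (v := EuclideanSpace.single i 1) (by simp)
      ((((hφ n).continuous_classicalDeriv i).integrable_of_hasCompactSupport
        ((hφ n).hasCompactSupport_classicalDeriv i)).const_mul r)
      (((hφ n).contDiff.continuous.integrable_of_hasCompactSupport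
        (hφ n).compactSupport).const_mul r)
      (fun x _ => differentiableAt_const _) (fun x _ => (hφ n).differentiable x)
    simp only [classicalDeriv]
    rw [this]
    simp
  · intro x hx
    rw [(hφ n).classicalDeriv_eq_zero_of_notMem i hx, mul_zero]

/-- Divergences of fields vanishing on the boundary have mean value zero, so that only the norm of
`L²(Ω)/ℝ` of a pressure matters. -/
theorem MemVH10.abs_inner_divg_le {v : VL2 Ω} (hv : MemVH10 v) (q : L2 Ω) :
    |inner ℝ q (divg v)| ≤ l2ModNorm q * ‖divg v‖ := by
  have hzero : (0 : L2 Ω) ∈ constants Ω := ⟨0, Lp.coeFn_zero _ _ _⟩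
  have : Nonempty (constants Ω) := ⟨⟨0, hzero⟩⟩
  have h : ∀ c : constants Ω, |inner ℝ q (divg v)| ≤ ‖q + (c : L2 Ω)‖ * ‖divg v‖ := by
    intro c
    have hc : inner ℝ (c : L2 Ω) (divg v) = 0 := by
      rw [divg, inner_sum]
      exact Finset.sum_eq_zero fun i _ => (hv i).inner_constants c.2 i
    have : inner ℝ q (divg v) = inner ℝ (q + (c : L2 Ω)) (divg v) := by
      rw [inner_add_left, hc, add_zero]
    rw [this]
    exact abs_real_inner_le_norm _ _
  rw [l2ModNorm, Real.iInf_mul_of_nonneg (norm_nonneg _)]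
  exact le_ciInf h

theorem l2ModNorm_nonneg (q : L2 Ω) : 0 ≤ l2ModNorm q := Real.iInf_nonneg fun _ => norm_nonneg _

theorem h1ModNorm_nonneg (q : L2 Ω) : 0 ≤ h1ModNorm q :=
  Real.iInf_nonneg fun _ => Real.sqrt_nonneg _

theorem vh2Norm_nonneg (v : VL2 Ω) : 0 ≤ vh2Norm v := Real.sqrt_nonneg _

/-! ### An `L²` bound for `|v| |∇v|` without regularity of the boundary -/

/-- `∑ⱼ fⱼ²`, the square of the Euclidean length of a vector field. -/
def lengthSq (f : Fin 2 → Plane → ℝ) (x : Plane) : ℝ := ∑ j, f j x ^ 2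

theorem lengthSq_nonneg (f : Fin 2 → Plane → ℝ) (x : Plane) : 0 ≤ lengthSq f x :=
  Finset.sum_nonneg fun _ _ => sq_nonneg _

theorem sq_le_lengthSq (f : Fin 2 → Plane → ℝ) (j : Fin 2) (x : Plane) :
    f j x ^ 2 ≤ lengthSq f x :=
  Finset.single_le_sum (f := fun j => f j x ^ 2) (fun _ _ => sq_nonneg _) (Finset.mem_univ j)

theorem abs_mul_le_lengthSq (f : Fin 2 → Plane → ℝ) (m j : Fin 2) (x : Plane) :
    |f m x * f j x| ≤ lengthSq f x := by
  rw [abs_mul]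
  nlinarith [sq_le_lengthSq f m x, sq_le_lengthSq f j x, sq_nonneg (|f m x| - |f j x|),
    sq_abs (f m x), sq_abs (f j x)]

/-- The bounded increasing function `s ↦ s / (1 + ε s)` on `[0, ∞)`, applied to `|f|²`; it tends to
`|f|²` as `ε → 0`. -/
noncomputable def weight (ε : ℝ) (f : Fin 2 → Plane → ℝ) (x : Plane) : ℝ :=
  lengthSq f x / (1 + ε * lengthSq f x)

/-- The coefficients `2 ρ'(|f|²) fₘ fⱼ`, where `ρ(s) = s / (1 + ε s)`, that arise from
differentiating `ρ(|f|²) fⱼ`. -/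
noncomputable def weightDeriv (ε : ℝ) (f : Fin 2 → Plane → ℝ) (m j : Fin 2) (x : Plane) : ℝ :=
  2 / (1 + ε * lengthSq f x) ^ 2 * (f m x * f j x)

theorem one_add_mul_lengthSq_pos {ε : ℝ} (hε : 0 < ε) (f : Fin 2 → Plane → ℝ) (x : Plane) :
    0 < 1 + ε * lengthSq f x := by
  have := lengthSq_nonneg f x
  positivity

theorem weight_nonneg {ε : ℝ} (hε : 0 < ε) (f : Fin 2 → Plane → ℝ) (x : Plane) :
    0 ≤ weight ε f x :=
  div_nonneg (lengthSq_nonneg f x) (one_add_mul_lengthSq_pos hε f x).le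

theorem weight_le {ε : ℝ} (hε : 0 < ε) (f : Fin 2 → Plane → ℝ) (x : Plane) :
    weight ε f x ≤ 1 / ε := by
  rw [weight, div_le_div_iff₀ (one_add_mul_lengthSq_pos hε f x) hε]
  nlinarith

theorem weight_le_lengthSq {ε : ℝ} (hε : 0 < ε) (f : Fin 2 → Plane → ℝ) (x : Plane) :
    weight ε f x ≤ lengthSq f x := by
  have := lengthSq_nonneg f x
  refine div_le_self this ?_
  nlinarith [mul_nonneg hε.le this]

theorem abs_weightDeriv_le {ε : ℝ} (hε : 0 < ε) (f : Fin 2 → Plane → ℝ) (m j : Fin 2)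
    (x : Plane) : |weightDeriv ε f m j x| ≤ 2 / ε := by
  have hpos := one_add_mul_lengthSq_pos hε f x
  have h0 := lengthSq_nonneg f x
  rw [weightDeriv, abs_mul, abs_of_pos (by positivity)]
  calc 2 / (1 + ε * lengthSq f x) ^ 2 * |f m x * f j x|
      ≤ 2 / (1 + ε * lengthSq f x) ^ 2 * lengthSq f x :=
        mul_le_mul_of_nonneg_left (abs_mul_le_lengthSq f m j x) (by positivity)
    _ ≤ 2 / ε := by
        rw [div_mul_eq_mul_div, div_le_div_iff₀ (by positivity) hε]
        nlinarith [mul_nonneg hε.le h0, sq_nonneg (ε * lengthSq f x)]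

theorem tendsto_lengthSq {f : ℕ → Fin 2 → Plane → ℝ} {g : Fin 2 → Plane → ℝ} {x : Plane}
    (h : ∀ j, Tendsto (fun n => f n j x) atTop (𝓝 (g j x))) :
    Tendsto (fun n => lengthSq (f n) x) atTop (𝓝 (lengthSq g x)) :=
  tendsto_finsetSum _ fun j _ => (h j).pow 2

theorem tendsto_weight {ε : ℝ} (hε : 0 < ε) {f : ℕ → Fin 2 → Plane → ℝ}
    {g : Fin 2 → Plane → ℝ} {x : Plane}
    (h : ∀ j, Tendsto (fun n => f n j x) atTop (𝓝 (g j x))) :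
    Tendsto (fun n => weight ε (f n) x) atTop (𝓝 (weight ε g x)) :=
  (tendsto_lengthSq h).div (((tendsto_lengthSq h).const_mul ε).const_add 1)
    (one_add_mul_lengthSq_pos hε g x).ne'

theorem tendsto_weightDeriv {ε : ℝ} (hε : 0 < ε) {f : ℕ → Fin 2 → Plane → ℝ}
    {g : Fin 2 → Plane → ℝ} {x : Plane} (m j : Fin 2)
    (h : ∀ j, Tendsto (fun n => f n j x) atTop (𝓝 (g j x))) :
    Tendsto (fun n => weightDeriv ε (f n) m j x) atTop (𝓝 (weightDeriv ε g m j x)) :=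
  ((tendsto_const_nhds (x := (2 : ℝ))).div
    ((((tendsto_lengthSq h).const_mul ε).const_add 1).pow 2)
    (pow_pos (one_add_mul_lengthSq_pos hε g x) 2).ne').mul ((h m).mul (h j))

theorem aestronglyMeasurable_lengthSq {ν : Measure Plane} {f : Fin 2 → Plane → ℝ}
    (hf : ∀ j, AEStronglyMeasurable (f j) ν) : AEStronglyMeasurable (lengthSq f) ν :=
  Finset.aestronglyMeasurable_fun_sum _ fun j _ => (hf j).pow 2

theorem aestronglyMeasurable_weight {ν : Measure Plane} {f : Fin 2 → Plane → ℝ} (ε : ℝ)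
    (hf : ∀ j, AEStronglyMeasurable (f j) ν) : AEStronglyMeasurable (weight ε f) ν :=
  ((aestronglyMeasurable_lengthSq hf).aemeasurable.div
    (((aestronglyMeasurable_lengthSq hf).aemeasurable.const_mul ε).const_add
      1)).aestronglyMeasurable

theorem aestronglyMeasurable_weightDeriv {ν : Measure Plane} {f : Fin 2 → Plane → ℝ} (ε : ℝ)
    (m j : Fin 2) (hf : ∀ j, AEStronglyMeasurable (f j) ν) :
    AEStronglyMeasurable (weightDeriv ε f m j) ν :=
  ((aemeasurable_const.div
    ((((aestronglyMeasurable_lengthSq hf).aemeasurable.const_mul ε).const_add 1).pow_const 2)).mul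
    ((hf m).mul (hf j)).aemeasurable).aestronglyMeasurable

theorem contDiff_weight {ε : ℝ} (hε : 0 < ε) {f : Fin 2 → Plane → ℝ}
    (hf : ∀ j, ContDiff ℝ ∞ (f j)) : ContDiff ℝ ∞ (weight ε f) := by
  have h : ContDiff ℝ ∞ (lengthSq f) := ContDiff.sum fun j _ => (hf j).pow 2
  exact h.div (contDiff_const.add (contDiff_const.mul h))
    fun x => (one_add_mul_lengthSq_pos hε f x).ne'

theorem classicalDeriv_weight {ε : ℝ} (hε : 0 < ε) {f : Fin 2 → Plane → ℝ}
    (hf : ∀ j, Differentiable ℝ (f j)) (l : Fin 2) (x : Plane) :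
    classicalDeriv l (weight ε f) x
      = ∑ m, 2 / (1 + ε * lengthSq f x) ^ 2 * f m x * classicalDeriv l (f m) x := by
  have hne := (one_add_mul_lengthSq_pos hε f x).ne'
  have h1 : HasFDerivAt (lengthSq f) (∑ m, (2 * f m x) • fderiv ℝ (f m) x) x := by
    have := HasFDerivAt.fun_sum (u := Finset.univ) (A := fun m y => f m y ^ 2)
      (A' := fun m => (2 * f m x) • fderiv ℝ (f m) x) (x := x) (𝕜 := ℝ) fun m _ => by
      have := ((hf m) x).hasFDerivAt.pow 2
      simpa using this
    exact this
  have h2 : HasDerivAt (fun s : ℝ => s / (1 + ε * s)) (1 / (1 + ε * lengthSq f x) ^ 2)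
      (lengthSq f x) := by
    have := (hasDerivAt_id (lengthSq f x)).div
      (((hasDerivAt_id (lengthSq f x)).const_mul ε).const_add 1) hne
    refine this.congr_deriv ?_
    simp only [id]
    congr 1
    ring
  have h3 := h2.comp_hasFDerivAt x h1
  have h4 : fderiv ℝ (weight ε f) x = _ := h3.fderiv
  rw [classicalDeriv, h4]
  simp only [classicalDeriv, Fin.sum_univ_two, smul_apply,
    add_apply, smul_eq_mul]
  ring

theorem isTest_weight_mul {ε : ℝ} (hε : 0 < ε) {f : Fin 2 → Plane → ℝ}
    (hf : ∀ j, IsTest Ω (f j)) (j : Fin 2) : IsTest Ω (fun x => weight ε f x * f j x) :=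
  IsTest.mul_left (contDiff_weight hε fun j => (hf j).contDiff) (hf j)

theorem classicalDeriv_weight_mul {ε : ℝ} (hε : 0 < ε) {f : Fin 2 → Plane → ℝ}
    (hf : ∀ j, IsTest Ω (f j)) (l j : Fin 2) (x : Plane) :
    classicalDeriv l (fun x => weight ε f x * f j x) x
      = weight ε f x * classicalDeriv l (f j) x
        + ∑ m, weightDeriv ε f m j x * classicalDeriv l (f m) x := by
  rw [classicalDeriv_mul ((contDiff_weight hε fun j => (hf j).contDiff).differentiable (by simp))
    (hf j).differentiable, classicalDeriv_weight hε fun j => (hf j).differentiable]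
  simp only [weightDeriv, Fin.sum_univ_two]
  ring

theorem MemLp.bdd_mul_of_forall_le {ν : Measure Plane} {c g : Plane → ℝ} {K : ℝ}
    (hg : MemLp g 2 ν) (hc : AEStronglyMeasurable c ν) (hK : ∀ x, |c x| ≤ K) :
    MemLp (fun x => c x * g x) 2 ν :=
  MemLp.of_le_mul (c := K) hg (hc.mul hg.1) (Eventually.of_forall fun x => by
    rw [norm_mul]
    exact mul_le_mul_of_nonneg_right (hK x) (norm_nonneg _))

/-- Passage to the limit in a product of a bounded factor converging almost everywhere and a factor
converging in `L²(Ω)`. -/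
theorem tendsto_integral_mul_bdd_mul {c : ℕ → Plane → ℝ} {c' : Plane → ℝ} {K : ℝ}
    (hc : ∀ n, AEStronglyMeasurable (c n) (volume.restrict (Ω : Set Plane)))
    (hK : ∀ n x, |c n x| ≤ K)
    (hcc : ∀ᵐ x ∂(volume.restrict (Ω : Set Plane)), Tendsto (fun n => c n x) atTop (𝓝 (c' x)))
    {g : ℕ → L2 Ω} {g' : L2 Ω} (hg : Tendsto g atTop (𝓝 g')) (f : L2 Ω) :
    Tendsto (fun n => ∫ x in (Ω : Set Plane), f x * (c n x * g n x)) atTop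
      (𝓝 (∫ x in (Ω : Set Plane), f x * (c' x * g' x))) := by
  have hsplit : ∀ n, ∫ x in (Ω : Set Plane), f x * (c n x * g n x)
      = (∫ x in (Ω : Set Plane), f x * (c n x * (g n - g' : L2 Ω) x))
        + ∫ x in (Ω : Set Plane), f x * (c n x * g' x) := by
    intro n
    rw [← integral_add
      (integrable_mul_of_memLp f (MemLp.bdd_mul_of_forall_le (Lp.memLp _) (hc n) (hK n)))
      (integrable_mul_of_memLp f (MemLp.bdd_mul_of_forall_le (Lp.memLp _) (hc n) (hK n)))]
    refine integral_congr_ae ?_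
    filter_upwards [Lp.coeFn_sub (g n) g'] with x hx
    rw [hx, Pi.sub_apply]
    ring
  have hK0 : 0 ≤ K := (abs_nonneg _).trans (hK 0 0)
  have t1 : Tendsto (fun n => ∫ x in (Ω : Set Plane), f x * (c n x * (g n - g' : L2 Ω) x))
      atTop (𝓝 0) := by
    refine squeeze_zero_norm (a := fun n => ‖f‖ * (K * ‖g n - g'‖)) (fun n => ?_)
      (by simpa using ((tendsto_iff_norm_sub_tendsto_zero.1 hg).const_mul K).const_mul ‖f‖)
    have hm := MemLp.bdd_mul_of_forall_le (Lp.memLp (g n - g')) (hc n) (hK n)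
    refine (abs_integral_mul_le f hm).trans (mul_le_mul_of_nonneg_left ?_ (norm_nonneg _))
    refine ENNReal.toReal_le_of_le_ofReal (by positivity) ?_
    have := eLpNorm_le_mul_eLpNorm_of_ae_le_mul (p := 2)
      (μ := volume.restrict (Ω : Set Plane)) (f := fun x => c n x * (g n - g' : L2 Ω) x)
      (g := (g n - g' : L2 Ω)) (c := K) (Eventually.of_forall fun x => by
        rw [norm_mul]
        exact mul_le_mul_of_nonneg_right (hK n x) (norm_nonneg _))
    rwa [ENNReal.ofReal_mul hK0, Lp.norm_def, ENNReal.ofReal_toReal (Lp.eLpNorm_ne_top _)]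
  have t2 : Tendsto (fun n => ∫ x in (Ω : Set Plane), f x * (c n x * g' x)) atTop
      (𝓝 (∫ x in (Ω : Set Plane), f x * (c' x * g' x))) := by
    refine tendsto_integral_of_dominated_convergence (fun x => K * ‖f x * g' x‖)
      (fun n => (Lp.aestronglyMeasurable f).mul ((hc n).mul (Lp.aestronglyMeasurable g')))
      ((integrable_mul_of_memLp f (Lp.memLp g')).norm.const_mul K)
      (fun n => Eventually.of_forall fun x => ?_) ?_
    · rw [show f x * (c n x * g' x) = c n x * (f x * g' x) by ring, norm_mul]
      exact mul_le_mul_of_nonneg_right (hK n x) (norm_nonneg _)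
    · filter_upwards [hcc] with x hx
      exact (hx.mul_const _).const_mul _
  simpa [hsplit] using t1.add t2

/-- The components of a vector field as functions on the plane. -/
noncomputable def components (v : VL2 Ω) (j : Fin 2) : Plane → ℝ := v j

/-- The identity obtained by testing `-∂ₗ∂ₗ vⱼ` with `ρ(|v|²) vⱼ`, `ρ(s) = s / (1 + ε s)`. -/
theorem integral_weight_identity {v : VL2 Ω} (hv : MemVH10 v) (hv2 : MemVH2 v) {ε : ℝ}
    (hε : 0 < ε) (l j : Fin 2) :
    (∫ x in (Ω : Set Plane), weakDeriv l (v j) x * (weight ε (components v) x * weakDeriv l (v j) x))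
      + ∑ m, ∫ x in (Ω : Set Plane), weakDeriv l (v j) x *
          (weightDeriv ε (components v) m j x * weakDeriv l (v m) x)
      = -∫ x in (Ω : Set Plane), weakDeriv l (weakDeriv l (v j)) x
          * (weight ε (components v) x * v j x) := by
  choose φ hφ t1 t2 t3 using fun j => (hv j).exists_seq
  have hae : ∀ᵐ x ∂(volume.restrict (Ω : Set Plane)),
      ∀ j, Tendsto (fun n => φ j n x) atTop (𝓝 (components v j x)) := ae_all_iff.2 t3
  have hmeas : ∀ n j, AEStronglyMeasurable (φ j n) (volume.restrict (Ω : Set Plane)) :=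
    fun n j => (hφ j n).contDiff.continuous.aestronglyMeasurable
  have hw : ∀ n x, |weight ε (fun j => φ j n) x| ≤ 1 / ε := fun n x => by
    rw [abs_of_nonneg (weight_nonneg hε _ x)]
    exact weight_le hε _ x
  have L1 := tendsto_integral_mul_bdd_mul (c := fun n => weight ε fun j => φ j n)
    (fun n => aestronglyMeasurable_weight ε (hmeas n)) hw
    (hae.mono fun x hx => tendsto_weight hε hx) (t2 j l) (weakDeriv l (v j))
  have L2 := fun m => tendsto_integral_mul_bdd_mul (c := fun n => weightDeriv ε (fun j => φ j n) m j)
    (fun n => aestronglyMeasurable_weightDeriv ε m j (hmeas n))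
    (fun n x => abs_weightDeriv_le hε _ m j x)
    (hae.mono fun x hx => tendsto_weightDeriv hε m j hx) (t2 m l) (weakDeriv l (v j))
  have L3 := tendsto_integral_mul_bdd_mul (c := fun n => weight ε fun j => φ j n)
    (fun n => aestronglyMeasurable_weight ε (hmeas n)) hw
    (hae.mono fun x hx => tendsto_weight hε hx) (t1 j) (weakDeriv l (weakDeriv l (v j)))
  refine tendsto_nhds_unique (L1.add (tendsto_finsetSum Finset.univ fun m _ => L2 m)) ?_
  refine L3.neg.congr fun n => ?_
  have key := ((hv2 j).2 l).hasWeakDeriv l _ (isTest_weight_mul hε (fun j => hφ j n) j)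
  have e1 : ∫ x in (Ω : Set Plane), weakDeriv l (weakDeriv l (v j)) x *
      (weight ε (fun j => φ j n) x * (hφ j n).toL2 x)
      = ∫ x in (Ω : Set Plane), weakDeriv l (weakDeriv l (v j)) x *
      (weight ε (fun j => φ j n) x * φ j n x) := by
    refine integral_congr_ae ?_
    filter_upwards [(hφ j n).coeFn_toL2] with x hx
    rw [hx]
  rw [e1, ← key, ← integral_finsetSum _ fun m _ => integrable_mul_of_memLp _
    (MemLp.bdd_mul_of_forall_le (Lp.memLp _) (aestronglyMeasurable_weightDeriv ε m j (hmeas n))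
      (fun x => abs_weightDeriv_le hε _ m j x)),
    ← integral_add (integrable_mul_of_memLp _ (MemLp.bdd_mul_of_forall_le (Lp.memLp _)
      (aestronglyMeasurable_weight ε (hmeas n)) (hw n)))
      (integrable_finsetSum _ fun m _ => integrable_mul_of_memLp _
    (MemLp.bdd_mul_of_forall_le (Lp.memLp _) (aestronglyMeasurable_weightDeriv ε m j (hmeas n))
      (fun x => abs_weightDeriv_le hε _ m j x)))]
  refine integral_congr_ae ?_
  filter_upwards [ae_all_iff.2 fun m => (hφ m n).coeFn_weakDeriv l] with x hx
  rw [classicalDeriv_weight_mul hε fun j => hφ j n]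
  simp only [hx, mul_add, Finset.mul_sum]

theorem norm_weakDeriv_weakDeriv_le_vh2Norm (v : VL2 Ω) (i j l : Fin 2) :
    ‖weakDeriv l (weakDeriv j (v i))‖ ≤ vh2Norm v := by
  refine Real.le_sqrt_of_sq_le ?_
  have h : ‖weakDeriv l (weakDeriv j (v i))‖ ^ 2
      ≤ ∑ i, ∑ j, ∑ l, ‖weakDeriv l (weakDeriv j (v i))‖ ^ 2 :=
    (Finset.single_le_sum (f := fun l => ‖weakDeriv l (weakDeriv j (v i))‖ ^ 2)
      (fun _ _ => sq_nonneg _) (Finset.mem_univ l)).trans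
    ((Finset.single_le_sum (f := fun j => ∑ l, ‖weakDeriv l (weakDeriv j (v i))‖ ^ 2)
      (fun _ _ => Finset.sum_nonneg fun _ _ => sq_nonneg _) (Finset.mem_univ j)).trans
    (Finset.single_le_sum (f := fun i => ∑ j, ∑ l, ‖weakDeriv l (weakDeriv j (v i))‖ ^ 2)
      (fun _ _ => Finset.sum_nonneg fun _ _ => Finset.sum_nonneg fun _ _ => sq_nonneg _)
      (Finset.mem_univ i)))
  have h' : 0 ≤ ∑ i, ∑ j, ‖weakDeriv j (v i)‖ ^ 2 :=
    Finset.sum_nonneg fun _ _ => Finset.sum_nonneg fun _ _ => sq_nonneg _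
  nlinarith [sq_nonneg ‖v‖]

theorem aestronglyMeasurable_components (v : VL2 Ω) (j : Fin 2) :
    AEStronglyMeasurable (components v j) (volume.restrict (Ω : Set Plane)) :=
  Lp.aestronglyMeasurable (v j)

theorem abs_weight_le {ε : ℝ} (hε : 0 < ε) (f : Fin 2 → Plane → ℝ) (x : Plane) :
    |weight ε f x| ≤ 1 / ε := by
  rw [abs_of_nonneg (weight_nonneg hε _ x)]
  exact weight_le hε _ x

theorem MemVH10.eLpNorm_weight_mul_le {v : VL2 Ω} (hv : MemVH10 v) {ε : ℝ} (hε : 0 < ε)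
    (j : Fin 2) :
    (eLpNorm (fun x => weight ε (components v) x * v j x) 2
      (volume.restrict (Ω : Set Plane))).toReal
      ≤ 96 * (sobolevConst : ℝ) ^ 2 * (‖v‖ * gradNorm v ^ 2) := by
  have hD := gradNorm_nonneg v
  have hcube : ∀ i, eLpNorm (fun x => v i x ^ 3) 2 (volume.restrict (Ω : Set Plane))
      ≤ ENNReal.ofReal (24 * (sobolevConst : ℝ) ^ 2 * (‖v‖ * gradNorm v ^ 2)) := by
    intro i
    refine (hv i).eLpNorm_cube_le.trans (ENNReal.ofReal_le_ofReal ?_)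
    have h1 := gradSum_le_gradNorm v i
    have h2 : ‖v i‖ ≤ ‖v‖ := PiLp.norm_apply_le v i
    have h3 := gradSum_nonneg (v i)
    have h4 : ‖v i‖ * gradSum (v i) ^ 2 ≤ ‖v‖ * (2 * gradNorm v) ^ 2 := by gcongr
    nlinarith [sq_nonneg (sobolevConst : ℝ)]
  have hm : ∀ i, AEStronglyMeasurable (fun x => v i x ^ 3) (volume.restrict (Ω : Set Plane)) :=
    fun i => (Lp.aestronglyMeasurable (v i)).pow 3
  refine ENNReal.toReal_le_of_le_ofReal (by positivity) ?_
  calc eLpNorm (fun x => weight ε (components v) x * v j x) 2 (volume.restrict (Ω : Set Plane))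
      ≤ eLpNorm ((2 : ℝ) • ((fun x => ‖v 0 x ^ 3‖) + fun x => ‖v 1 x ^ 3‖)) 2
          (volume.restrict (Ω : Set Plane)) := by
        refine eLpNorm_mono_real fun x => ?_
        have h1 := weight_le_lengthSq hε (components v) x
        have h2 := weight_nonneg hε (components v) x
        have h3 : lengthSq (components v) x = |v 0 x| ^ 2 + |v 1 x| ^ 2 := by
          simp [lengthSq, components]
        have ha := abs_nonneg (v 0 x)
        have hb := abs_nonneg (v 1 x)
        have hj : |v j x| * (|v 0 x| ^ 2 + |v 1 x| ^ 2) ≤ 2 * (|v 0 x| ^ 3 + |v 1 x| ^ 3) := by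
          fin_cases j
          · simp only [Fin.zero_eta]
            nlinarith [mul_nonneg (add_nonneg ha hb) (sq_nonneg (|v 0 x| - |v 1 x|)),
              pow_nonneg ha 3, pow_nonneg hb 3]
          · simp only [Fin.mk_one]
            nlinarith [mul_nonneg (add_nonneg ha hb) (sq_nonneg (|v 0 x| - |v 1 x|)),
              pow_nonneg ha 3, pow_nonneg hb 3]
        simp only [Pi.smul_apply, Pi.add_apply, smul_eq_mul, norm_mul, norm_pow, Real.norm_eq_abs]
        rw [abs_of_nonneg h2]
        rw [h3] at h1
        nlinarith [abs_nonneg (v j x)]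
    _ = ENNReal.ofReal 2 * eLpNorm ((fun x => ‖v 0 x ^ 3‖) + fun x => ‖v 1 x ^ 3‖) 2
          (volume.restrict (Ω : Set Plane)) := by
        rw [eLpNorm_const_smul, Real.enorm_eq_ofReal (by norm_num)]
    _ ≤ ENNReal.ofReal 2 * (ENNReal.ofReal (24 * (sobolevConst : ℝ) ^ 2 * (‖v‖ * gradNorm v ^ 2))
          + ENNReal.ofReal (24 * (sobolevConst : ℝ) ^ 2 * (‖v‖ * gradNorm v ^ 2))) := by
        gcongr
        refine (eLpNorm_add_le (hm 0).norm (hm 1).norm (by norm_num)).trans ?_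
        rw [eLpNorm_norm, eLpNorm_norm]
        exact add_le_add (hcube 0) (hcube 1)
    _ = _ := by
        rw [← ENNReal.ofReal_add (by positivity) (by positivity), ← ENNReal.ofReal_mul (by norm_num)]
        congr 1
        ring

/-- The terms produced by differentiating `ρ(|v|²)` add up to `2 ∑ₗ ∫ ρ'(|v|²) (v · ∂ₗ v)² ≥ 0`. -/
theorem sum_integral_weightDeriv_nonneg (v : VL2 Ω) {ε : ℝ} (hε : 0 < ε) (l : Fin 2) :
    0 ≤ ∑ j, ∑ m, ∫ x in (Ω : Set Plane), weakDeriv l (v j) x *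
          (weightDeriv ε (components v) m j x * weakDeriv l (v m) x) := by
  have hint : ∀ m j, Integrable (fun x => weakDeriv l (v j) x *
      (weightDeriv ε (components v) m j x * weakDeriv l (v m) x))
      (volume.restrict (Ω : Set Plane)) := fun m j =>
    integrable_mul_of_memLp _ (MemLp.bdd_mul_of_forall_le (Lp.memLp _)
      (aestronglyMeasurable_weightDeriv ε m j (aestronglyMeasurable_components v))
      fun x => abs_weightDeriv_le hε _ m j x)
  rw [Finset.sum_congr rfl fun j _ => (integral_finsetSum _ fun m _ => hint m j).symm,
    ← integral_finsetSum _ fun j _ => integrable_finsetSum _ fun m _ => hint m j]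
  refine integral_nonneg fun x => ?_
  have hpos := one_add_mul_lengthSq_pos hε (components v) x
  have : ∑ j, ∑ m, weakDeriv l (v j) x *
      (weightDeriv ε (components v) m j x * weakDeriv l (v m) x)
      = 2 / (1 + ε * lengthSq (components v) x) ^ 2 * (∑ j, v j x * weakDeriv l (v j) x) ^ 2 := by
    simp only [Fin.sum_univ_two, weightDeriv, components]
    ring
  rw [Pi.zero_apply, this]
  positivity

/-- The bound of `∫ ρ(|v|²) |∂ₗvⱼ|²`, uniform in the truncation parameter `ε`. -/
theorem integral_weight_le {v : VL2 Ω} (hv : MemVH10 v) (hv2 : MemVH2 v) {ε : ℝ}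
    (hε : 0 < ε) (l j : Fin 2) :
    ∫ x in (Ω : Set Plane), weakDeriv l (v j) x * (weight ε (components v) x * weakDeriv l (v j) x)
      ≤ 384 * (sobolevConst : ℝ) ^ 2 * (vh2Norm v * (‖v‖ * gradNorm v ^ 2)) := by
  set I : Fin 2 → Fin 2 → ℝ := fun l j => ∫ x in (Ω : Set Plane),
    weakDeriv l (v j) x * (weight ε (components v) x * weakDeriv l (v j) x) with hI
  have hI0 : ∀ l j, 0 ≤ I l j := fun l j => integral_nonneg fun x => by
    have := weight_nonneg hε (components v) x
    have h : weakDeriv l (v j) x * (weight ε (components v) x * weakDeriv l (v j) x)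
      = weight ε (components v) x * weakDeriv l (v j) x ^ 2 := by ring
    rw [Pi.zero_apply, h]
    positivity
  have hb : ∀ l j, I l j + ∑ m, ∫ x in (Ω : Set Plane), weakDeriv l (v j) x *
          (weightDeriv ε (components v) m j x * weakDeriv l (v m) x)
      ≤ vh2Norm v * (96 * (sobolevConst : ℝ) ^ 2 * (‖v‖ * gradNorm v ^ 2)) := by
    intro l j
    rw [hI]
    simp only
    rw [integral_weight_identity hv hv2 hε l j]
    refine (neg_le_abs _).trans ?_
    refine (abs_integral_mul_le _ (MemLp.bdd_mul_of_forall_le (Lp.memLp _)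
      (aestronglyMeasurable_weight ε (aestronglyMeasurable_components v))
      (abs_weight_le hε _))).trans ?_
    exact mul_le_mul (norm_weakDeriv_weakDeriv_le_vh2Norm v j l l)
      (hv.eLpNorm_weight_mul_le hε j) ENNReal.toReal_nonneg (vh2Norm_nonneg v)
  have hs := Finset.sum_le_sum fun l (_ : l ∈ Finset.univ) =>
    Finset.sum_le_sum fun j (_ : j ∈ Finset.univ) => hb l j
  simp only [Finset.sum_add_distrib] at hs
  have hn := Finset.sum_nonneg fun l (_ : l ∈ Finset.univ) => sum_integral_weightDeriv_nonneg v hε l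
  have hle : I l j ≤ ∑ l, ∑ j, I l j :=
    (Finset.single_le_sum (f := fun j => I l j) (fun _ _ => hI0 _ _) (Finset.mem_univ j)).trans
    (Finset.single_le_sum (f := fun l => ∑ j, I l j)
      (fun _ _ => Finset.sum_nonneg fun _ _ => hI0 _ _) (Finset.mem_univ l))
  simp only [Finset.sum_const, Finset.card_univ, Fintype.card_fin, nsmul_eq_mul,
    Nat.cast_ofNat] at hs
  change I l j ≤ _
  linarith

/-- For `v ∈ 𝐇₀¹ ∩ 𝐇²` the products `vᵢ ∂ₗvⱼ` lie in `L²(Ω)`, with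
`‖vᵢ ∂ₗvⱼ‖² ≤ c ‖v‖₂ ‖v‖ ‖∇v‖²`. -/
theorem eLpNorm_mul_weakDeriv_le {v : VL2 Ω} (hv : MemVH10 v) (hv2 : MemVH2 v) (i l j : Fin 2) :
    eLpNorm (fun x => v i x * weakDeriv l (v j) x) 2 (volume.restrict (Ω : Set Plane))
      ≤ ENNReal.ofReal (Real.sqrt
        (384 * (sobolevConst : ℝ) ^ 2 * (vh2Norm v * (‖v‖ * gradNorm v ^ 2)))) := by
  set R := 384 * (sobolevConst : ℝ) ^ 2 * (vh2Norm v * (‖v‖ * gradNorm v ^ 2)) with hR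
  have hR0 : 0 ≤ R := by
    have := vh2Norm_nonneg v
    positivity
  have hε : ∀ n : ℕ, (0 : ℝ) < 1 / ((n : ℝ) + 1) := fun n => by positivity
  have hfin : ∀ n : ℕ, ∫⁻ x in (Ω : Set Plane), ENNReal.ofReal
      (weakDeriv l (v j) x * (weight (1 / ((n : ℝ) + 1)) (components v) x * weakDeriv l (v j) x))
      ≤ ENNReal.ofReal R := by
    intro n
    rw [← ofReal_integral_eq_lintegral_ofReal]
    · exact ENNReal.ofReal_le_ofReal (integral_weight_le hv hv2 (hε n) l j)
    · exact integrable_mul_of_memLp _ (MemLp.bdd_mul_of_forall_le (Lp.memLp _)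
        (aestronglyMeasurable_weight _ (aestronglyMeasurable_components v))
        (abs_weight_le (hε n) _))
    · refine Eventually.of_forall fun x => ?_
      have := weight_nonneg (hε n) (components v) x
      have h : weakDeriv l (v j) x *
        (weight (1 / ((n : ℝ) + 1)) (components v) x * weakDeriv l (v j) x)
        = weight (1 / ((n : ℝ) + 1)) (components v) x * weakDeriv l (v j) x ^ 2 := by ring
      simp only [Pi.zero_apply]
      rw [h]
      positivity
  have hlim : ∀ x, Tendsto (fun n : ℕ => weight (1 / ((n : ℝ) + 1)) (components v) x) atTop
      (𝓝 (lengthSq (components v) x)) := by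
    intro x
    have h1 := ((tendsto_one_div_add_atTop_nhds_zero_nat (𝕜 := ℝ)).mul_const
      (lengthSq (components v) x)).const_add 1
    have h2 := (tendsto_const_nhds (x := lengthSq (components v) x)).div h1 (by simp)
    rw [zero_mul, add_zero, div_one] at h2
    exact h2
  have hfatou : ∫⁻ x in (Ω : Set Plane), ENNReal.ofReal
      (weakDeriv l (v j) x * (lengthSq (components v) x * weakDeriv l (v j) x))
      ≤ ENNReal.ofReal R := by
    have h1 : ∀ x, ENNReal.ofReal
        (weakDeriv l (v j) x * (lengthSq (components v) x * weakDeriv l (v j) x))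
        = liminf (fun n : ℕ => ENNReal.ofReal (weakDeriv l (v j) x *
          (weight (1 / ((n : ℝ) + 1)) (components v) x * weakDeriv l (v j) x))) atTop := fun x =>
      (ENNReal.tendsto_ofReal (((hlim x).mul_const _).const_mul _)).liminf_eq.symm
    rw [lintegral_congr h1]
    refine (lintegral_liminf_le' fun n => ?_).trans ?_
    · exact ((Lp.aestronglyMeasurable _).mul ((aestronglyMeasurable_weight _
        (aestronglyMeasurable_components v)).mul
          (Lp.aestronglyMeasurable _))).aemeasurable.ennreal_ofReal
    · exact liminf_le_of_frequently_le' (Frequently.of_forall hfin)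
  have hsq : eLpNorm (fun x => v i x * weakDeriv l (v j) x) 2
      (volume.restrict (Ω : Set Plane)) ^ 2 ≤ ENNReal.ofReal R := by
    have h2 := eLpNorm_nnreal_pow_eq_lintegral (p := 2) (μ := volume.restrict (Ω : Set Plane))
      (f := fun x => v i x * weakDeriv l (v j) x) two_ne_zero
    simp only [NNReal.coe_ofNat, ENNReal.rpow_two, ENNReal.coe_ofNat] at h2
    rw [h2]
    refine (lintegral_mono fun x => ?_).trans hfatou
    rw [Real.enorm_eq_ofReal_abs, ← ENNReal.ofReal_pow (abs_nonneg _), sq_abs]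
    refine ENNReal.ofReal_le_ofReal ?_
    have h3 := sq_le_lengthSq (components v) i x
    simp only [components] at h3
    nlinarith [sq_nonneg (weakDeriv l (v j) x)]
  rw [← ENNReal.pow_le_pow_left_iff two_ne_zero, ← ENNReal.ofReal_pow (Real.sqrt_nonneg _),
    Real.sq_sqrt hR0]
  exact hsq

/-- `|(v·∇v, φ)| ≤ c (‖v‖₂ ‖v‖)^{1/2} ‖∇v‖ ‖φ‖` for `v ∈ 𝐇₀¹ ∩ 𝐇²`. -/
theorem abs_convect_self_le {v : VL2 Ω} (hv : MemVH10 v) (hv2 : MemVH2 v) (φ : VL2 Ω) :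
    |convect v v φ| ≤ 80 * sobolevConst * (Real.sqrt (vh2Norm v * ‖v‖) * gradNorm v * ‖φ‖) := by
  set R := 384 * (sobolevConst : ℝ) ^ 2 * (vh2Norm v * (‖v‖ * gradNorm v ^ 2)) with hR
  have hh := vh2Norm_nonneg v
  have hD := gradNorm_nonneg v
  have hRle : Real.sqrt R ≤ 20 * sobolevConst * (Real.sqrt (vh2Norm v * ‖v‖) * gradNorm v) := by
    refine Real.sqrt_le_iff.2 ⟨by positivity, ?_⟩
    have : (20 * (sobolevConst : ℝ) * (Real.sqrt (vh2Norm v * ‖v‖) * gradNorm v)) ^ 2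
        = 400 * (sobolevConst : ℝ) ^ 2 * (vh2Norm v * (‖v‖ * gradNorm v ^ 2)) := by
      rw [mul_pow, mul_pow, mul_pow, Real.sq_sqrt (by positivity)]
      ring
    rw [this, hR]
    gcongr
    norm_num
  have hb : ∀ i j, |∫ x in (Ω : Set Plane), v i x * weakDeriv i (v j) x * φ j x|
      ≤ 20 * sobolevConst * (Real.sqrt (vh2Norm v * ‖v‖) * gradNorm v) * ‖φ‖ := by
    intro i j
    have h1 := eLpNorm_mul_weakDeriv_le hv hv2 i i j
    have hm : MemLp (fun x => v i x * weakDeriv i (v j) x) 2 (volume.restrict (Ω : Set Plane)) :=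
      ⟨(Lp.aestronglyMeasurable _).mul (Lp.aestronglyMeasurable _),
        h1.trans_lt ENNReal.ofReal_lt_top⟩
    have h2 := abs_integral_mul_le (φ j) hm
    have h3 : ∫ x in (Ω : Set Plane), v i x * weakDeriv i (v j) x * φ j x
        = ∫ x in (Ω : Set Plane), φ j x * (v i x * weakDeriv i (v j) x) :=
      integral_congr_ae (Eventually.of_forall fun x => mul_comm _ _)
    rw [h3]
    refine h2.trans ?_
    rw [mul_comm]
    gcongr
    · exact (ENNReal.toReal_le_of_le_ofReal (Real.sqrt_nonneg _) h1).trans hRle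
    · exact PiLp.norm_apply_le φ j
  calc |convect v v φ|
      ≤ ∑ _i : Fin 2, ∑ _j : Fin 2,
          20 * sobolevConst * (Real.sqrt (vh2Norm v * ‖v‖) * gradNorm v) * ‖φ‖ := by
        refine (Finset.abs_sum_le_sum_abs _ _).trans (Finset.sum_le_sum fun i _ => ?_)
        exact (Finset.abs_sum_le_sum_abs _ _).trans (Finset.sum_le_sum fun j _ => hb i j)
    _ = _ := by
        simp only [Finset.sum_const, Finset.card_univ, Fintype.card_fin, nsmul_eq_mul]
        push_cast
        ring

end

section

variable {Ω : Opens Plane}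

namespace FESpaces

/-! ### The discrete Stokes operator -/

variable (X : FESpaces Ω)

theorem memVH10 (u : X.Jh) : MemVH10 (u : VL2 Ω) := X.memH10 _ (X.Jh_le u.2)

theorem inner_divg_eq_zero (u : X.Jh) {χ : L2 Ω} (hχ : χ ∈ X.Lh) :
    inner ℝ χ (divg (u : VL2 Ω)) = 0 := u.2.2 χ hχ

theorem inner_discreteStokes (u φ : X.Jh) :
    inner ℝ (-X.discreteStokes u) φ = aForm (u : VL2 Ω) φ := by
  have h1 := X.discreteLaplacian_spec (Submodule.inclusion X.Jh_le u)
    (Submodule.inclusion X.Jh_le φ)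
  have h2 : inner ℝ (X.discreteStokes u) φ
      = inner ℝ (X.discreteLaplacian (Submodule.inclusion X.Jh_le u) : VL2 Ω) (φ : VL2 Ω) :=
    Submodule.inner_orthogonalProjectionOnto_eq_of_mem_right φ _
  rw [inner_neg_left, h2]
  rw [inner_neg_left] at h1
  exact h1.symm

/-- The operator `-Δ̃_h`, as a linear map. -/
noncomputable def stokesOp : X.Jh →ₗ[ℝ] X.Jh where
  toFun u := -X.discreteStokes u
  map_add' u v := by
    refine ext_inner_right ℝ fun φ => ?_
    rw [inner_add_left, inner_discreteStokes, inner_discreteStokes, inner_discreteStokes,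
      ← sub_eq_iff_eq_add, ← aForm_sub_left _ (X.memVH10 (u + v)) (X.memVH10 v)]
    simp
  map_smul' r u := by
    refine ext_inner_right ℝ fun φ => ?_
    rw [RingHom.id_apply, inner_smul_left, inner_discreteStokes, inner_discreteStokes]
    rw [aForm_comm, aForm_comm (u : VL2 Ω)]
    simp only [aForm, Finset.mul_sum]
    refine Finset.sum_congr rfl fun i _ => Finset.sum_congr rfl fun j _ => ?_
    rw [Submodule.coe_smul, PiLp.smul_apply, weakDeriv_smul j r (X.memVH10 u i).1,
      inner_smul_right]
    rfl

theorem inner_stokesOp (u φ : X.Jh) : inner ℝ (X.stokesOp u) φ = aForm (u : VL2 Ω) φ :=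
  X.inner_discreteStokes u φ

theorem inner_stokesOp_coe (u φ : X.Jh) :
    inner ℝ (X.stokesOp u : VL2 Ω) (φ : VL2 Ω) = aForm (u : VL2 Ω) φ :=
  X.inner_stokesOp u φ

theorem inner_stokesOp_self (u : X.Jh) :
    inner ℝ (X.stokesOp u) u = gradNorm (u : VL2 Ω) ^ 2 := by
  rw [inner_stokesOp, gradNorm_sq]

/-- The discrete Stokes operator is injective by the Poincaré inequality, hence surjective. -/
theorem stokesOp_surjective (hΩ : Bornology.IsBounded (Ω : Set Plane)) :
    Function.Surjective X.stokesOp := by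
  rw [← LinearMap.injective_iff_surjective, injective_iff_map_eq_zero]
  intro u hu
  have h1 := X.inner_stokesOp_self u
  rw [hu, inner_zero_left] at h1
  have h2 : gradNorm (u : VL2 Ω) = 0 := by
    rw [eq_comm, sq_eq_zero_iff] at h1
    exact h1
  have h3 := (X.memVH10 u).norm_le hΩ
  rw [h2, mul_zero] at h3
  exact Subtype.ext (norm_le_zero_iff.1 h3)

/-- The Ritz projection into `𝐉_h` exists. -/
theorem exists_ritz (hΩ : Bornology.IsBounded (Ω : Set Plane)) (u₀ : VL2 Ω) :
    ∃ w : X.Jh, ∀ φ : X.Jh, aForm (w : VL2 Ω) φ = aForm u₀ φ := by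
  set r : X.Hh := (InnerProductSpace.toDual ℝ X.Hh).symm (X.aFunctional u₀).toContinuousLinearMap
    with hr
  obtain ⟨w, hw⟩ := X.stokesOp_surjective hΩ (X.Ph r)
  refine ⟨w, fun φ => ?_⟩
  have h2 : inner ℝ (X.Ph r) φ = inner ℝ (r : VL2 Ω) (φ : VL2 Ω) :=
    Submodule.inner_orthogonalProjectionOnto_eq_of_mem_right φ _
  have h3 : inner ℝ r (Submodule.inclusion X.Jh_le φ)
      = X.aFunctional u₀ (Submodule.inclusion X.Jh_le φ) := by
    rw [hr, InnerProductSpace.toDual_symm_apply]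
    rfl
  rw [← inner_stokesOp, hw, h2]
  exact h3

variable {X}

/-! ### Error estimates for the Stokes problem -/

variable {h C : ℝ}

/-- The pressure contributes only its best approximation error when the divergence is discretely
zero. The field `d` in the bound is allowed to differ from `e`: a solenoidal field may be subtracted. -/
theorem Approximation.abs_inner_divg_le (hX : X.Approximation h C) {G : ℝ}
    (hh : 0 < h) (hC : 0 < C) {q : L2 Ω} (hq : MemH1 q) (hqG : h1ModNorm q ≤ C * G)
    {e : VL2 Ω} (he : MemVH10 e) (hdiv : ∀ χ ∈ X.Lh, inner ℝ χ (divg e) = 0) {d : VL2 Ω}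
    (hd : ‖divg e‖ ≤ 2 * gradNorm d) :
    |inner ℝ q (divg e)| ≤ 2 * C ^ 2 * h * G * gradNorm d := by
  obtain ⟨q', hq', hqq⟩ := hX.pressure q hq
  have h1 : inner ℝ q (divg e) = inner ℝ (q - q') (divg e) := by
    rw [inner_sub_left, hdiv q' hq', sub_zero]
  rw [h1]
  have hd0 := gradNorm_nonneg d
  calc |inner ℝ (q - q') (divg e)| ≤ l2ModNorm (q - q') * ‖divg e‖ := he.abs_inner_divg_le _
    _ ≤ (C * h * (C * G)) * (2 * gradNorm d) := by
        have h2 : l2ModNorm (q - q') ≤ C * h * (C * G) := hqq.trans (by gcongr)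
        exact mul_le_mul h2 hd (norm_nonneg _) ((l2ModNorm_nonneg _).trans h2)
    _ = _ := by ring

/-- The **Aubin–Nitsche duality argument**: the `L²` norm of an error `e` whose divergence is
discretely zero, in terms of its Dirichlet norm and of its defect of Galerkin orthogonality. -/
theorem Approximation.norm_le_of_duality (hX : X.Approximation h C) (hh : 0 < h) (hC : 0 < C)
    (hS : StokesRegularity Ω C) {e : VL2 Ω} (he : MemVH10 e)
    (hdiv : ∀ χ ∈ X.Lh, inner ℝ χ (divg e) = 0) {B : ℝ} (hB : 0 ≤ B)
    (horth : ∀ ψ : VL2 Ω, MemJ1 ψ → ∀ r : X.Jh, |aForm e (r : VL2 Ω)| ≤ B * gradNorm (ψ - (r : VL2 Ω))) :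
    ‖e‖ ≤ 3 * C ^ 2 * h * gradNorm e + B * C ^ 2 * h := by
  obtain ⟨ψ, p, ⟨hψ, hweak⟩, hψ2, hp, hreg⟩ := hS e
  obtain ⟨r, hr, hrψ⟩ := hX.solenoidal ψ hψ hψ2
  have hp0 := h1ModNorm_nonneg p
  have hψ0 := vh2Norm_nonneg ψ
  have he0 := gradNorm_nonneg e
  have hrV : MemVH10 r := X.memH10 r hr.1
  have hgr : gradNorm (ψ - r) ≤ C ^ 2 * h * ‖e‖ := by
    have h1 : h * gradNorm (ψ - r) ≤ h * (C ^ 2 * h * ‖e‖) := by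
      calc h * gradNorm (ψ - r) ≤ C * h ^ 2 * vh2Norm ψ := by linarith [norm_nonneg (ψ - r)]
        _ ≤ C * h ^ 2 * (C * ‖e‖) := by gcongr; linarith
        _ = _ := by ring
    exact le_of_mul_le_mul_left h1 hh
  have hpe : |inner ℝ p (divg e)| ≤ 2 * C ^ 2 * h * ‖e‖ * gradNorm e :=
    hX.abs_inner_divg_le hh hC hp (by linarith) he hdiv (norm_divg_le e)
  have h2 : ‖e‖ ^ 2 = aForm e (ψ - r) + aForm e r - inner ℝ p (divg e) := by
    rw [← real_inner_self_eq_norm_sq, ← hweak e he, aForm_sub_right _ hψ.1 hrV, aForm_comm ψ]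
    ring
  have h3 : |aForm e (ψ - r)| ≤ gradNorm e * (C ^ 2 * h * ‖e‖) :=
    (abs_aForm_le _ _).trans (mul_le_mul_of_nonneg_left hgr he0)
  have h4 : |aForm e r| ≤ B * (C ^ 2 * h * ‖e‖) :=
    (horth ψ hψ ⟨r, hr⟩).trans (mul_le_mul_of_nonneg_left hgr hB)
  have h5 : ‖e‖ * ‖e‖ ≤ (3 * C ^ 2 * h * gradNorm e + B * C ^ 2 * h) * ‖e‖ := by
    have := le_abs_self (aForm e (ψ - r))
    have := le_abs_self (aForm e r)
    have := neg_abs_le (inner ℝ p (divg e))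
    nlinarith
  rcases (norm_nonneg e).eq_or_lt with h0 | h0
  · rw [← h0]
    positivity
  · exact le_of_mul_le_mul_right h5 h0

/-- The error of a Galerkin approximation of the Stokes problem in the Dirichlet norm. -/
theorem Approximation.gradNorm_sub_le (hX : X.Approximation h C) (hh : 0 < h) (hC : 0 < C)
    {v : VL2 Ω} (hv : MemJ1 v) (hv2 : MemVH2 v) {q : L2 Ω} (hq : MemH1 q) {G : ℝ}
    (hvG : vh2Norm v ≤ C * G) (hqG : h1ModNorm q ≤ C * G) (hG : 0 ≤ G) (u : X.Jh)
    (horth : ∀ φ : X.Jh, aForm (v - (u : VL2 Ω)) φ = inner ℝ q (divg (φ : VL2 Ω))) :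
    gradNorm (v - (u : VL2 Ω)) ≤ 4 * C ^ 2 * h * G := by
  have hu : MemVH10 (u : VL2 Ω) := X.memVH10 u
  have hE0 := gradNorm_nonneg (v - (u : VL2 Ω))
  obtain ⟨r, hr, hrv⟩ := hX.solenoidal v hv hv2
  lift r to X.Jh using hr
  have hrV : MemVH10 (r : VL2 Ω) := X.memVH10 r
  set x := C ^ 2 * h * G with hx
  have hx0 : 0 ≤ x := by positivity
  have hgr : gradNorm (v - (r : VL2 Ω)) ≤ x := by
    refine le_of_mul_le_mul_left ?_ hh
    calc h * gradNorm (v - (r : VL2 Ω)) ≤ C * h ^ 2 * vh2Norm v := by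
          linarith [norm_nonneg (v - (r : VL2 Ω))]
      _ ≤ C * h ^ 2 * (C * G) := by gcongr
      _ = _ := by rw [hx]; ring
  have h2 : gradNorm (v - (u : VL2 Ω)) ^ 2 = aForm (v - (u : VL2 Ω)) (v - (r : VL2 Ω))
      + aForm (v - (u : VL2 Ω)) ((r - u : X.Jh) : VL2 Ω) := by
    rw [Submodule.coe_sub, gradNorm_sq, aForm_sub_right _ hv.1 hrV, aForm_sub_right _ hrV hu,
      aForm_sub_right (v - (u : VL2 Ω)) hv.1 hu]
    ring
  have h3 : |aForm (v - (u : VL2 Ω)) (v - (r : VL2 Ω))| ≤ gradNorm (v - (u : VL2 Ω)) * x :=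
    (abs_aForm_le _ _).trans (mul_le_mul_of_nonneg_left hgr hE0)
  have h6 : gradNorm ((r - u : X.Jh) : VL2 Ω) ≤ x + gradNorm (v - (u : VL2 Ω)) := by
    have h7 := Oldroyd.gradNorm_sub_le (hv.1.sub hu) (hv.1.sub hrV)
    rw [sub_sub_sub_cancel_left] at h7
    rw [Submodule.coe_sub]
    linarith
  have h4 : |aForm (v - (u : VL2 Ω)) ((r - u : X.Jh) : VL2 Ω)|
      ≤ 2 * x * (x + gradNorm (v - (u : VL2 Ω))) := by
    rw [horth (r - u)]
    refine (hX.abs_inner_divg_le hh hC hq hqG (X.memVH10 (r - u))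
      (fun χ hχ => X.inner_divg_eq_zero (r - u) hχ) (norm_divg_le _)).trans ?_
    calc 2 * C ^ 2 * h * G * gradNorm ((r - u : X.Jh) : VL2 Ω)
        = 2 * x * gradNorm ((r - u : X.Jh) : VL2 Ω) := by rw [hx]; ring
      _ ≤ _ := by gcongr
  have h9 := le_abs_self (aForm (v - (u : VL2 Ω)) (v - (r : VL2 Ω)))
  have h10 := le_abs_self (aForm (v - (u : VL2 Ω)) ((r - u : X.Jh) : VL2 Ω))
  have h11 : gradNorm (v - (u : VL2 Ω)) ≤ 4 * x := by
    by_contra hcon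
    push Not at hcon
    nlinarith
  linarith

/-- Every `u ∈ 𝐉_h` is close to the solution `v ∈ 𝐉₁ ∩ 𝐇²` of the Stokes problem with right-hand
side `-Δ̃_h u`, of which it is the Galerkin approximation. -/
theorem Approximation.exists_stokes_lift (hX : X.Approximation h C) (hh : 0 < h) (hC : 0 < C)
    (hS : StokesRegularity Ω C) (u : X.Jh) :
    ∃ v : VL2 Ω, MemJ1 v ∧ MemVH2 v ∧ vh2Norm v ≤ C * ‖X.stokesOp u‖ ∧
      gradNorm (v - (u : VL2 Ω)) ≤ 4 * C ^ 2 * h * ‖X.stokesOp u‖ ∧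
      ‖v - (u : VL2 Ω)‖ ≤ 14 * C ^ 4 * h ^ 2 * ‖X.stokesOp u‖ := by
  obtain ⟨v, q, ⟨hv, hweak⟩, hv2, hq, hreg⟩ := hS (X.stokesOp u : VL2 Ω)
  have hnorm : ‖(X.stokesOp u : VL2 Ω)‖ = ‖X.stokesOp u‖ := rfl
  rw [hnorm] at hreg
  set G := ‖X.stokesOp u‖ with hG
  have hG0 : 0 ≤ G := norm_nonneg _
  have hvG : vh2Norm v ≤ C * G := by linarith [h1ModNorm_nonneg q]
  have hqG : h1ModNorm q ≤ C * G := by linarith [vh2Norm_nonneg v]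
  have hu : MemVH10 (u : VL2 Ω) := X.memVH10 u
  have horth : ∀ φ : X.Jh, aForm (v - (u : VL2 Ω)) φ = inner ℝ q (divg (φ : VL2 Ω)) := by
    intro φ
    have h1 := hweak φ (X.memVH10 φ)
    rw [X.inner_stokesOp_coe] at h1
    rw [aForm_sub_left _ hv.1 hu]
    linarith
  have hE := hX.gradNorm_sub_le hh hC hv hv2 hq hvG hqG hG0 u horth
  refine ⟨v, hv, hv2, hvG, hE, ?_⟩
  have hdiv : ∀ χ ∈ X.Lh, inner ℝ χ (divg (v - (u : VL2 Ω))) = 0 := by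
    intro χ hχ
    rw [divg_sub hv.1 hu, hv.2, inner_sub_right, inner_zero_right, X.inner_divg_eq_zero u hχ,
      sub_zero]
  have horth' : ∀ ψ : VL2 Ω, MemJ1 ψ → ∀ r : X.Jh, |aForm (v - (u : VL2 Ω)) (r : VL2 Ω)|
      ≤ 2 * C ^ 2 * h * G * gradNorm (ψ - (r : VL2 Ω)) := by
    intro ψ hψ r
    rw [horth r]
    refine hX.abs_inner_divg_le hh hC hq hqG (X.memVH10 r)
      (fun χ hχ => X.inner_divg_eq_zero r hχ) ?_
    have : divg (r : VL2 Ω) = -divg (ψ - (r : VL2 Ω)) := by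
      rw [divg_sub hψ.1 (X.memVH10 r), hψ.2, zero_sub, neg_neg]
    rw [this, norm_neg]
    exact norm_divg_le _
  have hdual := hX.norm_le_of_duality hh hC hS (hv.1.sub hu) hdiv (by positivity) horth'
  have : 3 * C ^ 2 * h * gradNorm (v - (u : VL2 Ω)) ≤ 3 * C ^ 2 * h * (4 * C ^ 2 * h * G) := by
    gcongr
  calc ‖v - (u : VL2 Ω)‖
      ≤ 3 * C ^ 2 * h * gradNorm (v - (u : VL2 Ω)) + 2 * C ^ 2 * h * G * C ^ 2 * h := hdual
    _ ≤ 3 * C ^ 2 * h * (4 * C ^ 2 * h * G) + 2 * C ^ 2 * h * G * C ^ 2 * h := by linarith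
    _ = _ := by ring

/-- The inverse inequality. -/
theorem Approximation.mul_gradNorm_le (hX : X.Approximation h C) (hh : 0 < h) (u : X.Jh) :
    h * gradNorm (u : VL2 Ω) ≤ C * ‖u‖ := by
  have h1 := hX.inverse u (X.Jh_le u.2)
  calc h * gradNorm (u : VL2 Ω) ≤ h * (C * h⁻¹ * ‖(u : VL2 Ω)‖) := by gcongr
    _ = C * ‖(u : VL2 Ω)‖ := by field_simp
    _ = _ := rfl

/-- The inverse inequality for `Δ̃_h`, from duality and the inverse inequality for `∇`. -/
theorem Approximation.mul_norm_stokesOp_le (hX : X.Approximation h C) (hh : 0 < h) (hC : 0 < C)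
    (u : X.Jh) :
    h * ‖X.stokesOp u‖ ≤ C * gradNorm (u : VL2 Ω) := by
  have h1 : ‖X.stokesOp u‖ ^ 2 ≤ gradNorm (u : VL2 Ω) * gradNorm (X.stokesOp u : VL2 Ω) := by
    rw [← real_inner_self_eq_norm_sq, inner_stokesOp]
    exact (le_abs_self _).trans (abs_aForm_le _ _)
  have h2 := hX.mul_gradNorm_le hh (X.stokesOp u)
  have h3 := gradNorm_nonneg (u : VL2 Ω)
  rcases (norm_nonneg (X.stokesOp u)).eq_or_lt with h0 | h0
  · rw [← h0, mul_zero]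
    positivity
  · refine le_of_mul_le_mul_right ?_ h0
    calc h * ‖X.stokesOp u‖ * ‖X.stokesOp u‖ = h * ‖X.stokesOp u‖ ^ 2 := by ring
      _ ≤ h * (gradNorm (u : VL2 Ω) * gradNorm (X.stokesOp u : VL2 Ω)) := by gcongr
      _ = gradNorm (u : VL2 Ω) * (h * gradNorm (X.stokesOp u : VL2 Ω)) := by ring
      _ ≤ gradNorm (u : VL2 Ω) * (C * ‖X.stokesOp u‖) := by gcongr
      _ = _ := by ring

/-- The `L²` projection `P_h` is stable in the Dirichlet norm on `𝐉₁`. -/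
theorem Approximation.gradNorm_Ph_le (hX : X.Approximation h C) (hh : 0 < h) (hC : 0 < C)
    (hS : StokesRegularity Ω C) (hΩ : Bornology.IsBounded (Ω : Set Plane)) {u₀ : VL2 Ω}
    (hu₀ : MemJ1 u₀) :
    gradNorm (X.Ph u₀ : VL2 Ω) ≤ (1 + 6 * C ^ 3) * gradNorm u₀ := by
  obtain ⟨w, hw⟩ := X.exists_ritz hΩ u₀
  have hwV := X.memVH10 w
  have hu0 := gradNorm_nonneg u₀
  have hw0 := gradNorm_nonneg (w : VL2 Ω)
  have hwle : gradNorm (w : VL2 Ω) ≤ gradNorm u₀ := by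
    have h1 : gradNorm (w : VL2 Ω) ^ 2 ≤ gradNorm u₀ * gradNorm (w : VL2 Ω) := by
      rw [gradNorm_sq, hw w]
      exact (le_abs_self _).trans (abs_aForm_le _ _)
    nlinarith
  have horth : ∀ r : X.Jh, aForm (u₀ - (w : VL2 Ω)) (r : VL2 Ω) = 0 := fun r => by
    rw [aForm_sub_left _ hu₀.1 hwV, hw r, sub_self]
  have hdiv : ∀ χ ∈ X.Lh, inner ℝ χ (divg (u₀ - (w : VL2 Ω))) = 0 := by
    intro χ hχ
    rw [divg_sub hu₀.1 hwV, hu₀.2, inner_sub_right, inner_zero_right, X.inner_divg_eq_zero w hχ, sub_zero]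
  have hdual := hX.norm_le_of_duality hh hC hS (hu₀.1.sub hwV) hdiv le_rfl (fun ψ _ r => by
    rw [horth r, abs_zero, zero_mul])
  have hdist : gradNorm (u₀ - (w : VL2 Ω)) ≤ 2 * gradNorm u₀ := by
    linarith [Oldroyd.gradNorm_sub_le hu₀.1 hwV]
  have hPw : X.Ph (w : VL2 Ω) = w := Submodule.orthogonalProjectionOnto_mem_subspace_eq_self w
  have hproj : ‖X.Ph u₀ - w‖ ≤ 6 * C ^ 2 * h * gradNorm u₀ := by
    have h1 : X.Ph u₀ - w = X.Ph (u₀ - (w : VL2 Ω)) := by rw [map_sub, hPw]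
    rw [h1]
    refine (Submodule.norm_orthogonalProjectionOnto_apply_le _ _).trans (hdual.trans ?_)
    have : 3 * C ^ 2 * h * gradNorm (u₀ - (w : VL2 Ω)) ≤ 3 * C ^ 2 * h * (2 * gradNorm u₀) := by gcongr
    linarith
  have hinv : gradNorm ((X.Ph u₀ - w : X.Jh) : VL2 Ω) ≤ 6 * C ^ 3 * gradNorm u₀ := by
    have h1 := hX.mul_gradNorm_le hh (X.Ph u₀ - w)
    refine le_of_mul_le_mul_left ?_ hh
    calc h * gradNorm ((X.Ph u₀ - w : X.Jh) : VL2 Ω) ≤ C * ‖X.Ph u₀ - w‖ := h1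
      _ ≤ C * (6 * C ^ 2 * h * gradNorm u₀) := by gcongr
      _ = _ := by ring
  have h1 := gradNorm_le_add_sub (X.memVH10 (X.Ph u₀)) hwV
  have h2 : gradNorm ((X.Ph u₀ : VL2 Ω) - (w : VL2 Ω)) = gradNorm ((X.Ph u₀ - w : X.Jh) : VL2 Ω) := rfl
  linarith

/-! ### The convective term on `𝐉_h` -/

theorem bForm_eq_convect {v w φ : VL2 Ω} (hv : MemJ1 v) (hw : MemVH10 w) (hφ : MemVH10 φ) :
    bForm v w φ = convect v w φ := by
  rw [bForm, hv.convect_eq_neg hφ hw]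
  ring

theorem bForm_self (v w : VL2 Ω) : bForm v w w = 0 := by
  rw [bForm]
  ring

theorem bForm_sub_left {v v' w φ : VL2 Ω} (hv : MemVH10 v) (hv' : MemVH10 v') (hw : MemVH10 w)
    (hφ : MemVH10 φ) : bForm (v - v') w φ = bForm v w φ - bForm v' w φ := by
  rw [bForm, bForm, bForm, convect_sub_left hv hv' hφ, convect_sub_left hv hv' hw]
  ring

theorem bForm_sub_mid {v w w' φ : VL2 Ω} (hv : MemVH10 v) (hw : MemVH10 w) (hw' : MemVH10 w')
    (hφ : MemVH10 φ) : bForm v (w - w') φ = bForm v w φ - bForm v w' φ := by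
  rw [bForm, bForm, bForm, convect_sub_mid hv hw hw' hφ, convect_sub_right hv hw hw']
  ring

theorem abs_bForm_le {v w φ : VL2 Ω} (hv : MemVH10 v) (hw : MemVH10 w) (hφ : MemVH10 φ) :
    |bForm v w φ| ≤ 8 * sobolevConst * (Real.sqrt (‖v‖ * gradNorm v) *
      (gradNorm w * Real.sqrt (‖φ‖ * gradNorm φ) + gradNorm φ * Real.sqrt (‖w‖ * gradNorm w))) := by
  have h1 := abs_convect_le w hv hφ
  have h2 := abs_convect_le φ hv hw
  rw [bForm]
  refine (abs_sub _ _).trans ?_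
  rw [abs_mul, abs_mul, abs_of_pos (by norm_num : (0 : ℝ) < 1 / 2)]
  linarith

/-- The constant in the bound of the convective term on `𝐉_h`. -/
noncomputable def convectConst (C : ℝ) : ℝ :=
  sobolevConst * (80 * (Real.sqrt (C * (1 + 14 * C ^ 6)) * (1 + 4 * C ^ 3))
    + 16 * Real.sqrt (16 * C ^ 6 * ((1 + 14 * C ^ 6) * (1 + 4 * C ^ 3)))
    + 16 * Real.sqrt (56 * C ^ 9))

theorem convectConst_nonneg (hC : 0 < C) : 0 ≤ convectConst C := by
  unfold convectConst
  have : (0 : ℝ) ≤ sobolevConst := sobolevConst.2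
  positivity

theorem le_sqrt_mul_of_sq_le {a K L G y P : ℝ} (hy : 0 ≤ y) (hP : 0 ≤ P)
    (hK : 0 ≤ K) (hLG : 0 ≤ L * G)
    (h : a ^ 2 ≤ K * (L * G * y ^ 2 * P ^ 2)) :
    a ≤ Real.sqrt K * (Real.sqrt (L * G) * y * P) := by
  refine le_of_sq_le_sq ?_ (by positivity)
  rw [mul_pow, mul_pow, mul_pow, Real.sq_sqrt hK, Real.sq_sqrt hLG]
  exact h

/-- On `𝐉_h` the convective term is bounded by the `L²` norm of its last argument:
`|b(u, u, φ)| ≤ c (‖u‖ ‖Δ̃_h u‖)^{1/2} ‖∇u‖ ‖φ‖`. -/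
theorem Approximation.abs_bForm_self_le (hX : X.Approximation h C) (hh : 0 < h) (hC : 0 < C)
    (hS : StokesRegularity Ω C) (u φ : X.Jh) :
    |bForm (u : VL2 Ω) u φ| ≤ convectConst C *
      (Real.sqrt (‖u‖ * ‖X.stokesOp u‖) * gradNorm (u : VL2 Ω) * ‖φ‖) := by
  obtain ⟨v, hv, hv2, hvG, hE, he⟩ := hX.exists_stokes_lift hh hC hS u
  have hu : MemVH10 (u : VL2 Ω) := X.memVH10 u
  have hφ : MemVH10 (φ : VL2 Ω) := X.memVH10 φ
  have i1 := hX.mul_norm_stokesOp_le hh hC u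
  have i2 := hX.mul_gradNorm_le hh u
  have i3 := hX.mul_gradNorm_le hh φ
  have hev : MemVH10 (v - (u : VL2 Ω)) := hv.1.sub hu
  have hgv := gradNorm_le_add_sub hv.1 hu
  have hnv : ‖v‖ ≤ ‖u‖ + ‖v - (u : VL2 Ω)‖ := by
    have := norm_add_le (u : VL2 Ω) (v - (u : VL2 Ω))
    rwa [add_sub_cancel] at this
  -- `v` is the Stokes lift of `u`. The first term is handled by the `L²` bound of `v·∇v`; in the
  -- others the powers of `h` in the errors `v - u` absorb, through the inverse inequalities, the
  -- derivatives of `φ`.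
  have hsplit : bForm (u : VL2 Ω) u φ = convect v v φ - convect v (v - (u : VL2 Ω)) φ
      - bForm (v - (u : VL2 Ω)) u φ := by
    rw [bForm_sub_left hv.1 hu hu hφ, bForm_eq_convect hv hu hφ, convect_sub_mid hv.1 hv.1 hu hφ]
    ring
  have T1 := abs_convect_self_le hv.1 hv2 (φ : VL2 Ω)
  have T2 := abs_convect_le (v - (u : VL2 Ω)) hv.1 hφ
  have T3 := abs_bForm_le hev hu hφ
  have c1 : ‖(φ : VL2 Ω)‖ = ‖φ‖ := rfl
  have c2 : ‖(u : VL2 Ω)‖ = ‖u‖ := rfl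
  rw [c1] at T1 T2 T3
  rw [c2] at T3
  have hL := norm_nonneg u
  have hP := norm_nonneg φ
  have hG := norm_nonneg (X.stokesOp u)
  have hy := gradNorm_nonneg (u : VL2 Ω)
  have hz := gradNorm_nonneg (φ : VL2 Ω)
  have hE0 := gradNorm_nonneg (v - (u : VL2 Ω))
  have he0 := norm_nonneg (v - (u : VL2 Ω))
  have hv0 := vh2Norm_nonneg v
  have hn0 := norm_nonneg v
  have hg0 := gradNorm_nonneg v
  have hc0 : (0 : ℝ) ≤ sobolevConst := sobolevConst.2
  rw [hsplit]
  generalize ‖u‖ = L at *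
  generalize ‖φ‖ = P at *
  generalize ‖X.stokesOp u‖ = G at *
  generalize gradNorm (u : VL2 Ω) = y at *
  generalize gradNorm (φ : VL2 Ω) = z at *
  generalize gradNorm (v - (u : VL2 Ω)) = E at *
  generalize ‖v - (u : VL2 Ω)‖ = e at *
  generalize vh2Norm v = V at *
  generalize ‖v‖ = n at *
  generalize gradNorm v = g at *
  have hLG : 0 ≤ L * G := mul_nonneg hL hG
  have hhG : h * (h * G) ≤ C ^ 2 * L := by
    calc h * (h * G) ≤ h * (C * y) := by gcongr
      _ = C * (h * y) := by ring
      _ ≤ C * (C * L) := by gcongr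
      _ = _ := by ring
  have hg : g ≤ (1 + 4 * C ^ 3) * y := by
    have : 4 * C ^ 2 * h * G ≤ 4 * C ^ 3 * y := by
      calc 4 * C ^ 2 * h * G = 4 * C ^ 2 * (h * G) := by ring
        _ ≤ 4 * C ^ 2 * (C * y) := by gcongr
        _ = _ := by ring
    linarith
  have hn : n ≤ (1 + 14 * C ^ 6) * L := by
    have : 14 * C ^ 4 * h ^ 2 * G ≤ 14 * C ^ 6 * L := by
      calc 14 * C ^ 4 * h ^ 2 * G = 14 * C ^ 4 * (h * (h * G)) := by ring
        _ ≤ 14 * C ^ 4 * (C ^ 2 * L) := by gcongr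
        _ = _ := by ring
    linarith
  have B1 : Real.sqrt (V * n) * g * P
      ≤ Real.sqrt (C * (1 + 14 * C ^ 6)) * (1 + 4 * C ^ 3) * (Real.sqrt (L * G) * y * P) := by
    have h1 : Real.sqrt (V * n) ≤ Real.sqrt (C * (1 + 14 * C ^ 6)) * Real.sqrt (L * G) := by
      rw [← Real.sqrt_mul (by positivity)]
      refine Real.sqrt_le_sqrt ?_
      calc V * n ≤ (C * G) * ((1 + 14 * C ^ 6) * L) := by gcongr
        _ = _ := by ring
    calc Real.sqrt (V * n) * g * P
        ≤ (Real.sqrt (C * (1 + 14 * C ^ 6)) * Real.sqrt (L * G)) * ((1 + 4 * C ^ 3) * y) * P := by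
          gcongr
      _ = _ := by ring
  have B2 : Real.sqrt (n * g) * E * Real.sqrt (P * z)
      ≤ Real.sqrt (16 * C ^ 6 * ((1 + 14 * C ^ 6) * (1 + 4 * C ^ 3)))
        * (Real.sqrt (L * G) * y * P) := by
    refine le_sqrt_mul_of_sq_le hy hP (by positivity) hLG ?_
    rw [mul_pow, mul_pow, Real.sq_sqrt (by positivity), Real.sq_sqrt (by positivity)]
    calc n * g * E ^ 2 * (P * z)
        ≤ ((1 + 14 * C ^ 6) * L) * ((1 + 4 * C ^ 3) * y) * (4 * C ^ 2 * h * G) ^ 2 * (P * z) := by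
          gcongr
      _ = 16 * C ^ 4 * ((1 + 14 * C ^ 6) * (1 + 4 * C ^ 3)) * L * y * P * G * (h * G) * (h * z) := by
          ring
      _ ≤ 16 * C ^ 4 * ((1 + 14 * C ^ 6) * (1 + 4 * C ^ 3)) * L * y * P * G * (C * y) * (C * P) := by
          gcongr
      _ = _ := by ring
  have hprod : e * E ≤ (14 * C ^ 4 * h ^ 2 * G) * (4 * C ^ 2 * h * G) := by gcongr
  have B3 : Real.sqrt (e * E) * (y * Real.sqrt (P * z))
      ≤ Real.sqrt (56 * C ^ 9) * (Real.sqrt (L * G) * y * P) := by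
    refine le_sqrt_mul_of_sq_le hy hP (by positivity) hLG ?_
    rw [mul_pow, mul_pow, Real.sq_sqrt (by positivity), Real.sq_sqrt (by positivity)]
    calc e * E * (y ^ 2 * (P * z))
        ≤ (14 * C ^ 4 * h ^ 2 * G) * (4 * C ^ 2 * h * G) * (y ^ 2 * (P * z)) := by gcongr
      _ = 56 * C ^ 6 * y ^ 2 * P * G * (h * (h * G)) * (h * z) := by ring
      _ ≤ 56 * C ^ 6 * y ^ 2 * P * G * (C ^ 2 * L) * (C * P) := by gcongr
      _ = _ := by ring
  have B4 : Real.sqrt (e * E) * (z * Real.sqrt (L * y))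
      ≤ Real.sqrt (56 * C ^ 9) * (Real.sqrt (L * G) * y * P) := by
    refine le_sqrt_mul_of_sq_le hy hP (by positivity) hLG ?_
    rw [mul_pow, mul_pow, Real.sq_sqrt (by positivity), Real.sq_sqrt (by positivity)]
    calc e * E * (z ^ 2 * (L * y))
        ≤ (14 * C ^ 4 * h ^ 2 * G) * (4 * C ^ 2 * h * G) * (z ^ 2 * (L * y)) := by gcongr
      _ = 56 * C ^ 6 * L * y * G * (h * G) * (h * z) ^ 2 := by ring
      _ ≤ 56 * C ^ 6 * L * y * G * (C * y) * (C * P) ^ 2 := by gcongr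
      _ = _ := by ring
  refine (abs_sub _ _).trans ((add_le_add (abs_sub _ _) le_rfl).trans ?_)
  refine (add_le_add (add_le_add T1 T2) T3).trans ?_
  unfold convectConst
  have M1 := mul_le_mul_of_nonneg_left B1 hc0
  have M2 := mul_le_mul_of_nonneg_left B2 hc0
  have M3 := mul_le_mul_of_nonneg_left B3 hc0
  have M4 := mul_le_mul_of_nonneg_left B4 hc0
  linarith

end FESpaces

end

section

open Real

/-! ### Uniform bounds for recursive inequalities -/

/-- An implicit Euler step for `dx/dt = A - c x` keeps below the larger of the initial value and the
equilibrium. -/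
theorem le_max_of_add_mul_le {x x' c k A : ℝ} (hc : 0 < c) (hk : 0 < k)
    (h : x + k * (c * x) ≤ x' + k * A) : x ≤ max x' (A / c) := by
  by_contra hcon
  push Not at hcon
  have h1 : x' < x := (le_max_left _ _).trans_lt hcon
  have h2 : A / c < x := (le_max_right _ _).trans_lt hcon
  rw [div_lt_iff₀ hc] at h2
  nlinarith

/-- A form of Young's inequality. -/
theorem mul_pow_three_le {η a s : ℝ} (hη : 0 < η) (ha : 0 ≤ a) (hs : 0 ≤ s) :
    a * s ^ 3 ≤ η * s ^ 4 + a ^ 4 / η ^ 3 := by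
  rcases le_total a (η * s) with h | h
  · have : a * s ^ 3 ≤ η * s * s ^ 3 := by gcongr
    have h' : 0 ≤ a ^ 4 / η ^ 3 := by positivity
    nlinarith
  · have h1 : (η * s) ^ 3 ≤ a ^ 3 := by gcongr
    have h2 : a * s ^ 3 ≤ a ^ 4 / η ^ 3 := by
      rw [le_div_iff₀ (by positivity)]
      calc a * s ^ 3 * η ^ 3 = a * (η * s) ^ 3 := by ring
        _ ≤ a * a ^ 3 := by gcongr
        _ = _ := by ring
    have : 0 ≤ η * s ^ 4 := by positivity
    linarith

/-- One step of the inequality for `log (1 + F)`. The division by `1 + F'` turns the critical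
quartic term into one that is integrable in time. -/
theorem log_step {k μ a b c₁ c₂ F F' y y' X : ℝ} (hk : 0 < k) (ha : 0 ≤ a) (hb : 0 ≤ b)
    (hc₁ : 0 ≤ c₁) (hc₂ : 0 ≤ c₂) (hF : 0 ≤ F) (hF' : 0 ≤ F') (hy : 0 ≤ y)
    (h1 : F + k * (μ * X ^ 2) ≤ F' + k * (a + b * y ^ 2)) (h2 : y ≤ c₁ * y' + c₂)
    (h3 : y' ≤ F') :
    log (1 + F) + k * (μ * (X ^ 2 / (1 + F')))
      ≤ log (1 + F') + k * (a + b * (c₁ + c₂) * y) := by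
  have hpos : 0 < 1 + F' := by linarith
  have hlog : log (1 + F) ≤ log (1 + F') + (F - F') / (1 + F') := by
    have h := log_le_sub_one_of_pos (div_pos (by linarith : 0 < 1 + F) hpos)
    rw [log_div (by linarith) hpos.ne'] at h
    have h' : (1 + F) / (1 + F') - 1 = (F - F') / (1 + F') := by
      field_simp
      ring
    linarith
  have hy2 : y ^ 2 ≤ (c₁ + c₂) * y * (1 + F') := by
    have h4 : y ≤ (c₁ + c₂) * (1 + F') := by nlinarith
    nlinarith
  have hdiv : (F - F') / (1 + F') + k * (μ * (X ^ 2 / (1 + F')))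
      ≤ k * (a + b * (c₁ + c₂) * y) := by
    have h5 : (F - F') / (1 + F') + k * (μ * (X ^ 2 / (1 + F')))
        = (F - F' + k * (μ * X ^ 2)) / (1 + F') := by
      field_simp
    rw [h5, div_le_iff₀ hpos]
    have h6 : b * y ^ 2 ≤ b * ((c₁ + c₂) * y * (1 + F')) := by gcongr
    have h7 : a ≤ a * (1 + F') := by nlinarith
    calc F - F' + k * (μ * X ^ 2) ≤ k * (a + b * y ^ 2) := by linarith
      _ ≤ k * (a * (1 + F') + b * ((c₁ + c₂) * y * (1 + F'))) := by gcongr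
      _ = _ := by ring
  linarith

/-- One step of the inequality for the square root of the memory variable: the nonlinearity grows
only like `ζ^{1/2}`, so that its contribution to `(1 + ζ)^{1/2}` is integrable in time. -/
theorem sqrt_step {k κ A a b Kf ζ ζ' D y y' F' X : ℝ} (hk : 0 < k) (hk1 : k ≤ 1) (hκ : 0 < κ)
    (ha : 0 ≤ a) (hb : 0 ≤ b) (hKf : 0 ≤ Kf) (hζ : 0 ≤ ζ) (hζ' : 0 ≤ ζ') (hy : 0 ≤ y)
    (hy' : 0 ≤ y') (hX : 0 ≤ X) (hD : D = X ^ 2 / (1 + F')) (hF' : 0 ≤ F')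
    (hA : A = κ + a + b * (1 + Kf))
    (h4 : 1 + F' ≤ y' + Kf * (1 + ζ') ^ 2)
    (h5 : (1 + k * κ) * ζ ≤ ζ' + k * (a + b * (sqrt X * sqrt y))) :
    √(1 + ζ) + k * (min 1 (κ / 3) * √(1 + ζ))
      ≤ √(1 + ζ') + k * (A * (D + y + y' + 1)) := by
  set P := √(1 + ζ) with hP
  set P' := √(1 + ζ') with hP'
  have hP2 : P ^ 2 = 1 + ζ := sq_sqrt (by linarith)
  have hP2' : P' ^ 2 = 1 + ζ' := sq_sqrt (by linarith)
  have hP0 : 0 ≤ P := sqrt_nonneg _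
  have hP1' : 1 ≤ P' := by
    rw [hP']
    exact one_le_sqrt.2 (by linarith)
  have hD0 : 0 ≤ D := by
    rw [hD]
    positivity
  set r := D + y + y' + 1 with hr
  have hr1 : 1 ≤ r := by linarith
  have hXD : X ^ 2 = D * (1 + F') := by
    rw [hD]
    field_simp
  have hnl : sqrt X * sqrt y ≤ (1 + Kf) * r * P' := by
    refine le_of_sq_le_sq ?_ (by positivity)
    refine le_of_sq_le_sq ?_ (by positivity)
    have e1 : ((sqrt X * sqrt y) ^ 2) ^ 2 = X ^ 2 * y ^ 2 := by
      rw [mul_pow, sq_sqrt hX, sq_sqrt hy, mul_pow]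
    rw [e1, hXD]
    have hDr : D ≤ r := by linarith
    have hyr : y ≤ r := by linarith
    have hyr' : y' ≤ r := by linarith
    have hP4 : 1 ≤ P' ^ 4 := one_le_pow₀ hP1'
    have hK1 : (1 + Kf) ≤ (1 + Kf) ^ 4 := by
      have : (1 : ℝ) ≤ 1 + Kf := by linarith
      calc (1 + Kf) = (1 + Kf) ^ 1 := (pow_one _).symm
        _ ≤ _ := pow_le_pow_right₀ this (by norm_num)
    have hbr : y' + Kf * (1 + ζ') ^ 2 ≤ r * ((1 + Kf) * P' ^ 4) := by
      rw [← hP2', ← pow_mul]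
      norm_num
      have e2 : y' ≤ r * P' ^ 4 := by nlinarith
      have e3 : Kf * P' ^ 4 ≤ r * (Kf * P' ^ 4) := by
        have : 0 ≤ Kf * P' ^ 4 := by positivity
        nlinarith
      linarith
    calc D * (1 + F') * y ^ 2 ≤ r * (r * ((1 + Kf) * P' ^ 4)) * r ^ 2 := by
          gcongr
          exact h4.trans hbr
      _ = (1 + Kf) * (r ^ 4 * P' ^ 4) := by ring
      _ ≤ (1 + Kf) ^ 4 * (r ^ 4 * P' ^ 4) := by gcongr
      _ = _ := by ring
  have hrP : 1 ≤ r * P' := one_le_mul_of_one_le_of_one_le hr1 hP1'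
  have hstep : (1 + k * κ) * P ^ 2 ≤ P' ^ 2 + k * (A * (r * P')) := by
    rw [hP2, hP2', hA]
    have e1 : a ≤ a * (r * P') := le_mul_of_one_le_right ha hrP
    have e2 : κ ≤ κ * (r * P') := le_mul_of_one_le_right hκ.le hrP
    have e3 : b * (sqrt X * sqrt y) ≤ b * ((1 + Kf) * r * P') := by gcongr
    have e4 : k * (a + b * (sqrt X * sqrt y)) + k * κ
        ≤ k * ((κ + a + b * (1 + Kf)) * (r * P')) := by
      rw [← mul_add]
      gcongr
      linarith
    linarith
  have hA0 : 0 ≤ A := by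
    rw [hA]
    positivity
  have hmin : (1 + k * min 1 (κ / 3)) ^ 2 ≤ 1 + k * κ := by
    have m1 : min 1 (κ / 3) ≤ 1 := min_le_left _ _
    have m2 : min 1 (κ / 3) ≤ κ / 3 := min_le_right _ _
    have m0 : 0 ≤ min 1 (κ / 3) := le_min zero_le_one (by positivity)
    have m3 : k * min 1 (κ / 3) ≤ 1 := mul_le_one₀ hk1 m0 m1
    have m4 : k * min 1 (κ / 3) ≤ k * (κ / 3) := by gcongr
    have m5 : 0 ≤ k * min 1 (κ / 3) := mul_nonneg hk.le m0
    generalize k * min 1 (κ / 3) = s at *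
    have m6 : s * s ≤ s := mul_le_of_le_one_left m5 m3
    linarith only [m5, m4, m6]
  have hfin : (1 + k * min 1 (κ / 3)) * P ≤ P' + k * (A * r) := by
    have hArk : 0 ≤ k * (A * r) := by positivity
    refine le_of_sq_le_sq ?_ (by positivity)
    calc ((1 + k * min 1 (κ / 3)) * P) ^ 2 = (1 + k * min 1 (κ / 3)) ^ 2 * P ^ 2 := by ring
      _ ≤ (1 + k * κ) * P ^ 2 := by gcongr
      _ ≤ P' ^ 2 + k * (A * (r * P')) := hstep
      _ ≤ (P' + k * (A * r)) ^ 2 := by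
        have q1 : 0 ≤ k * (A * r) * P' := by positivity
        have q2 := sq_nonneg (k * (A * r))
        linarith only [q1, q2]
  linarith

theorem log_le_of_le {F y Kf ζ : ℝ} (hF : 0 ≤ F) (hy : 0 ≤ y) (hKf : 0 ≤ Kf) (hζ : 0 ≤ ζ)
    (h4 : 1 + F ≤ y + Kf * (1 + ζ) ^ 2) : log (1 + F) ≤ y + Kf + 4 * √(1 + ζ) := by
  set P := √(1 + ζ) with hP
  have hP2 : P ^ 2 = 1 + ζ := sq_sqrt (by linarith)
  have hP1 : 1 ≤ P := by
    rw [hP]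
    exact one_le_sqrt.2 (by linarith)
  have hP4 : 1 ≤ P ^ 4 := one_le_pow₀ hP1
  have h : 1 + F ≤ (1 + y) * (1 + Kf) * P ^ 4 := by
    rw [← hP2, ← pow_mul] at h4
    norm_num at h4
    have e1 : y ≤ y * P ^ 4 := by nlinarith
    have e2 : 0 ≤ y * Kf * P ^ 4 := by positivity
    nlinarith
  have hl := log_le_log (by linarith) h
  rw [log_mul (by positivity) (by positivity), log_mul (by positivity) (by positivity),
    log_pow] at hl
  have l1 := log_le_sub_one_of_pos (by linarith : 0 < 1 + y)
  have l2 := log_le_sub_one_of_pos (by linarith : 0 < 1 + Kf)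
  have l3 := log_le_sub_one_of_pos (by linarith : 0 < P)
  push_cast at hl
  linarith

/-- A uniform bound for `F` from the coupled recursive inequalities satisfied by the energy `E`, the
Dirichlet norm `y`, the memory variable `ζ` and the higher energy `F`. The combination
`(1 + ζ)^{1/2} + B log (1 + F) + A (E + μ k y / 2)` is a Lyapunov function. -/
theorem exists_bound_of_recursion {μ κ a b c₁ c₂ a' b' Kf C₀ R M : ℝ} (hμ : 0 < μ) (hκ : 0 < κ)
    (ha : 0 ≤ a) (hb : 0 ≤ b) (hc₁ : 0 ≤ c₁) (hc₂ : 0 ≤ c₂) (ha' : 0 ≤ a') (hb' : 0 ≤ b')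
    (hKf : 0 ≤ Kf) (hR : 0 ≤ R) (hM : 0 ≤ M) :
    ∃ K : ℝ, ∀ (k : ℝ), 0 < k → k ≤ 1 → ∀ (N : ℕ) (y X F ζ E : ℕ → ℝ),
      (∀ n, 0 ≤ y n) → (∀ n, 0 ≤ X n) → (∀ n, 0 ≤ F n) → (∀ n, 0 ≤ ζ n) → (∀ n, 0 ≤ E n) →
      y 0 ≤ M → F 0 ≤ M → ζ 0 ≤ M →
      (∀ n ≤ N, E n ≤ R) → (∀ n, y n ≤ F n) → (∀ n ≤ N, 1 + F n ≤ y n + Kf * (1 + ζ n) ^ 2) →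
      (∀ n < N, F (n + 1) + k * (μ * X (n + 1) ^ 2) ≤ F n + k * (a + b * y (n + 1) ^ 2)) →
      (∀ n < N, y (n + 1) ≤ c₁ * y n + c₂) →
      (∀ n < N, (1 + k * κ) * ζ (n + 1)
        ≤ ζ n + k * (a' + b' * (√(X (n + 1)) * √(y (n + 1))))) →
      (∀ n < N, E (n + 1) + k * (μ * y (n + 1)) ≤ E n + k * C₀) →
      ∀ n ≤ N, F n ≤ K := by
  set A := κ + a' + b' * (1 + Kf) with hA
  have hA0 : 0 < A := by positivity
  set B := A / μ with hB
  have hB0 : 0 < B := by positivity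
  have hBμ : B * μ = A := by
    rw [hB]
    field_simp
  set b'' := b * (c₁ + c₂) with hb''
  have hb''0 : 0 ≤ b'' := by positivity
  set A₃ := 2 * (A + B * b'' + 1) / μ with hA₃
  have hA₃0 : 0 < A₃ := by positivity
  have hA₃μ : A₃ * μ = 2 * (A + B * b'' + 1) := by
    rw [hA₃]
    field_simp
  set c := min 1 (κ / 3) with hc
  have hc0 : 0 < c := lt_min one_pos (by positivity)
  have hc1 : c ≤ 1 := min_le_left _ _
  set K₃ := 1 + 4 * B + B * (1 + Kf) + A₃ * R + A₃ * μ with hK₃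
  have hK₃0 : 0 < K₃ := by positivity
  set C₁ := A + B * a + A₃ * C₀ with hC₁
  set W₀ := max (√(1 + M) + B * log (1 + M) + A₃ * (R + μ * M)) ((C₁ + c) / (c / K₃)) with hW₀
  refine ⟨exp (W₀ / B), ?_⟩
  intro k hk hk1 N y X F ζ E hy hX hF hζ hE y0 F0 ζ0 hER hyF h4 h1 h2 h5 h6
  -- the summand `μ k y / 2` shares the dissipation of `E` between consecutive steps, since the
  -- inequality for `ζ` needs both `y n` and `y (n + 1)`
  set W : ℕ → ℝ := fun n => √(1 + ζ n) + B * log (1 + F n) + A₃ * (E n + k * (μ / 2 * y n)) with hW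
  have hbound : ∀ n ≤ N, W n ≤ W₀ := by
    intro n
    induction n with
    | zero =>
      intro _
      refine le_trans ?_ (le_max_left _ _)
      have e1 : √(1 + ζ 0) ≤ √(1 + M) := sqrt_le_sqrt (by linarith)
      have e2 : log (1 + F 0) ≤ log (1 + M) := log_le_log (by linarith [hF 0]) (by linarith)
      have e3 : E 0 + k * (μ / 2 * y 0) ≤ R + μ * M := by
        have i1 : k * (μ / 2 * y 0) ≤ 1 * (μ / 2 * M) := by
          have := hy 0
          gcongr
        have : 0 ≤ μ * M := by positivity
        linarith [hER 0 (Nat.zero_le _)]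
      simp only [hW]
      gcongr
    | succ n ih =>
      intro hn
      have hn' : n < N := hn
      have s1 := log_step hk ha hb hc₁ hc₂ (hF (n + 1)) (hF n) (hy (n + 1)) (h1 n hn') (h2 n hn')
        (hyF n)
      have s2 := sqrt_step hk hk1 hκ ha' hb' hKf (hζ (n + 1)) (hζ n) (hy (n + 1)) (hy n)
        (hX (n + 1)) rfl (hF n) hA (h4 n hn'.le) (h5 n hn')
      have s3 := h6 n hn'
      set D := X (n + 1) ^ 2 / (1 + F n) with hD
      have s4 : W (n + 1) + k * (c * √(1 + ζ (n + 1)) + y (n + 1)) ≤ W n + k * C₁ := by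
        have t1 := mul_le_mul_of_nonneg_left s1 hB0.le
        have t3 := mul_le_mul_of_nonneg_left s3 hA₃0.le
        have e1 : B * (k * (μ * D)) = k * (A * D) := by
          rw [← hBμ]
          ring
        have e2 : A₃ * (k * (μ * y (n + 1))) = A₃ * (k * (μ / 2 * y (n + 1)))
            + k * ((A + B * b'' + 1) * y (n + 1)) := by
          linear_combination (k * y (n + 1) / 2) * hA₃μ
        have e3 : A₃ * (k * (μ / 2 * y n)) = k * ((A + B * b'' + 1) * y n) := by
          linear_combination (k * y n / 2) * hA₃μ
        have e4 : 0 ≤ k * ((B * b'' + 1) * y n) := by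
          have := hy n
          positivity
        rw [← hb''] at t1
        rw [← hc] at s2
        simp only [hW, hC₁]
        linarith
      have s5 : W (n + 1) ≤ K₃ * (√(1 + ζ (n + 1)) + y (n + 1) + 1) := by
        have l1 := log_le_of_le (hF (n + 1)) (hy (n + 1)) hKf (hζ (n + 1)) (h4 (n + 1) hn)
        have l2 := hER (n + 1) hn
        have hp := sqrt_nonneg (1 + ζ (n + 1))
        have hyn := hy (n + 1)
        have l3 : k * (μ / 2 * y (n + 1)) ≤ μ * y (n + 1) := by
          have : k * (μ / 2 * y (n + 1)) ≤ 1 * (μ / 2 * y (n + 1)) := by gcongr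
          have : 0 ≤ μ * y (n + 1) := by positivity
          linarith
        calc W (n + 1) ≤ √(1 + ζ (n + 1)) + B * (y (n + 1) + Kf + 4 * √(1 + ζ (n + 1)))
              + A₃ * (R + μ * y (n + 1)) := by
              simp only [hW]
              gcongr
          _ ≤ _ := by
              rw [hK₃]
              have q1 : 0 ≤ B * Kf * (√(1 + ζ (n + 1)) + y (n + 1)) := by positivity
              have q2 : 0 ≤ A₃ * R * (√(1 + ζ (n + 1)) + y (n + 1)) := by positivity
              have q3 : 0 ≤ A₃ * μ * (√(1 + ζ (n + 1)) + 1) := by positivity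
              have q4 : 0 ≤ B * (√(1 + ζ (n + 1)) + 1) := by positivity
              have q5 : 0 ≤ 4 * B * (y (n + 1) + 1) := by positivity
              linarith
      have s6 : W (n + 1) + k * (c / K₃ * W (n + 1)) ≤ W n + k * (C₁ + c) := by
        have t1 : c / K₃ * W (n + 1) ≤ c * (√(1 + ζ (n + 1)) + y (n + 1) + 1) := by
          rw [div_mul_eq_mul_div, div_le_iff₀ hK₃0]
          calc c * W (n + 1) ≤ c * (K₃ * (√(1 + ζ (n + 1)) + y (n + 1) + 1)) := by gcongr
            _ = _ := by ring
        have t2 : c * y (n + 1) ≤ y (n + 1) := mul_le_of_le_one_left (hy (n + 1)) hc1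
        have t3 : k * (c / K₃ * W (n + 1)) ≤ k * (c * √(1 + ζ (n + 1)) + y (n + 1) + c) := by
          gcongr
          linarith
        linarith
      refine (le_max_of_add_mul_le (div_pos hc0 hK₃0) hk s6).trans ?_
      exact max_le (ih hn'.le) (le_max_right _ _)
  intro n hn
  have hWn := hbound n hn
  have e1 : B * log (1 + F n) ≤ W₀ := by
    refine le_trans ?_ hWn
    have i1 := sqrt_nonneg (1 + ζ n)
    have i2 : 0 ≤ A₃ * (E n + k * (μ / 2 * y n)) := by
      have := hE n
      have := hy n
      positivity
    simp only [hW]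
    linarith
  have e2 : log (1 + F n) ≤ W₀ / B := by
    rw [le_div_iff₀ hB0]
    linarith
  have e3 := (log_le_iff_le_exp (by linarith [hF n] : 0 < 1 + F n)).1 e2
  linarith

end

/-! ### The time-discrete dynamics -/

/-- The structure of the discrete problem that the a priori bounds rely on: `S` is the discrete
Stokes operator with energy norm `g`, and `b` the trilinear form. All constants are collected in
the Poincaré constant `lam` and in `c`. -/
structure IsConvective {J : Type} [NormedAddCommGroup J] [InnerProductSpace ℝ J]
    (S : J →ₗ[ℝ] J) (g : J → ℝ) (b : J → J → J → ℝ) (lam c : ℝ) : Prop where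
  nonneg : ∀ u, 0 ≤ g u
  inner_self : ∀ u, inner ℝ (S u) u = g u ^ 2
  abs_inner_le : ∀ u v, |inner ℝ (S u) v| ≤ g u * g v
  sub_le : ∀ u v, g (u - v) ≤ g u + g v
  norm_le : ∀ u, ‖u‖ ≤ lam * g u
  form_self : ∀ u w, b u w w = 0
  form_sub : ∀ u w w' φ, b u (w - w') φ = b u w φ - b u w' φ
  abs_form_le : ∀ u w φ,
    |b u w φ| ≤ c * (√(‖u‖ * g u) * (g w * √(‖φ‖ * g φ) + g φ * √(‖w‖ * g w)))
  abs_form_self_le : ∀ u φ, |b u u φ| ≤ c * (√(‖u‖ * ‖S u‖) * g u * ‖φ‖)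

/-- One step `(U', V') ↦ (U, V)` of the backward Euler scheme with time step `k` and force `f`,
where `V` is the memory term, updated by `V = e V' + k γ U`. -/
structure IsStep {J : Type} [NormedAddCommGroup J] [InnerProductSpace ℝ J]
    (S : J →ₗ[ℝ] J) (b : J → J → J → ℝ) (μ γ e k M₀ : ℝ) (f U' V' U V : J) : Prop where
  memory : V = e • V' + (k * γ) • U
  force : ‖f‖ ≤ M₀
  eqn : ∀ φ, inner ℝ (U - U') φ + k * (μ * inner ℝ (S U) φ + inner ℝ (S V) φ)
    = k * (inner ℝ f φ - b U U φ)

section Step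

variable {J : Type} [NormedAddCommGroup J] [InnerProductSpace ℝ J] {S : J →ₗ[ℝ] J} {g : J → ℝ}
  {b : J → J → J → ℝ} {lam c μ γ δ e k M₀ R : ℝ} {f U' V' U V : J}

/-- The update of the memory term expresses the stiff term `S U` by the memory. -/
theorem IsStep.smul_map (h : IsStep S b μ γ e k M₀ f U' V' U V) :
    (k * γ) • S U = S V - e • S V' := by
  rw [h.memory, map_add, map_smul, map_smul]
  abel

theorem two_mul_le_sq_add (a d : ℝ) : 2 * (a * d) ≤ a ^ 2 + d ^ 2 := by
  have := two_mul_le_add_sq a d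
  linarith

/-- Energy estimate, obtained by testing with `U`. -/
theorem IsStep.energy (hS : IsConvective S g b lam c) (h : IsStep S b μ γ e k M₀ f U' V' U V)
    (hμ : 0 < μ) (hγ : 0 < γ) (he : 0 ≤ e) (hk : 0 < k) :
    ‖U‖ ^ 2 + e / γ * g V ^ 2 + k * (μ * g U ^ 2) + 2 * (1 - e) / γ * g V ^ 2
      ≤ ‖U'‖ ^ 2 + e / γ * g V' ^ 2 + k * (M₀ ^ 2 * lam ^ 2 / μ) := by
  have h1 := h.eqn U
  rw [hS.form_self, hS.inner_self, inner_sub_left, real_inner_self_eq_norm_sq] at h1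
  have h2 : inner ℝ U' U ≤ ‖U'‖ * ‖U‖ := real_inner_le_norm _ _
  have h2' := two_mul_le_sq_add ‖U'‖ ‖U‖
  have h3 : inner ℝ f U ≤ M₀ * (lam * g U) :=
    (real_inner_le_norm _ _).trans (mul_le_mul h.force (hS.norm_le U) (norm_nonneg _)
      ((norm_nonneg _).trans h.force))
  have h4 : 2 * (M₀ * (lam * g U)) ≤ μ * g U ^ 2 + M₀ ^ 2 * lam ^ 2 / μ := by
    have e1 : μ * g U ^ 2 + M₀ ^ 2 * lam ^ 2 / μ - 2 * (M₀ * (lam * g U))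
        = (μ * g U - M₀ * lam) ^ 2 / μ := by
      field_simp
      ring
    have e2 : 0 ≤ (μ * g U - M₀ * lam) ^ 2 / μ := by positivity
    linarith
  have h5 : k * γ * inner ℝ (S V) U = g V ^ 2 - e * inner ℝ (S V) V' := by
    have e1 : (k * γ) • U = V - e • V' := by
      rw [h.memory]
      abel
    rw [← real_inner_smul_right, e1, inner_sub_right, real_inner_smul_right, hS.inner_self]
  have h6 : inner ℝ (S V) V' ≤ g V * g V' := (le_abs_self _).trans (hS.abs_inner_le _ _)
  have h6' := two_mul_le_sq_add (g V) (g V')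
  have h7 : 2 * (k * inner ℝ (S V) U)
      ≥ e / γ * g V ^ 2 - e / γ * g V' ^ 2 + 2 * (1 - e) / γ * g V ^ 2 := by
    have e1 : k * inner ℝ (S V) U = (g V ^ 2 - e * inner ℝ (S V) V') / γ := by
      rw [eq_div_iff hγ.ne', ← h5]
      ring
    have e2 : e / γ * g V ^ 2 - e / γ * g V' ^ 2 + 2 * (1 - e) / γ * g V ^ 2
        = (2 * g V ^ 2 - e * (g V ^ 2 + g V' ^ 2)) / γ := by ring
    have e3 : e * (2 * inner ℝ (S V) V') ≤ e * (g V ^ 2 + g V' ^ 2) := by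
      refine mul_le_mul_of_nonneg_left ?_ he
      linarith
    rw [e1, e2, ge_iff_le, ← mul_div_assoc]
    refine div_le_div_of_nonneg_right ?_ hγ.le
    linarith
  have h8 : k * (2 * inner ℝ f U) ≤ k * (μ * g U ^ 2 + M₀ ^ 2 * lam ^ 2 / μ) :=
    mul_le_mul_of_nonneg_left (by linarith) hk.le
  linarith

/-- Higher order energy estimate, obtained by testing with `S U`. -/
theorem IsStep.higher_energy (hS : IsConvective S g b lam c)
    (h : IsStep S b μ γ e k M₀ f U' V' U V) (hμ : 0 < μ) (hγ : 0 < γ) (he : 0 ≤ e) (hk : 0 < k)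
    (hc : 0 ≤ c) (hR : ‖U‖ ≤ R) :
    g U ^ 2 + e / γ * ‖S V‖ ^ 2 + k * (μ * ‖S U‖ ^ 2) + 2 * (1 - e) / γ * ‖S V‖ ^ 2
      ≤ g U' ^ 2 + e / γ * ‖S V'‖ ^ 2
        + k * (2 * M₀ ^ 2 / μ + 128 * c ^ 4 * R ^ 2 / μ ^ 3 * (g U ^ 2) ^ 2) := by
  have hR0 : 0 ≤ R := (norm_nonneg _).trans hR
  have h1 := h.eqn (S U)
  rw [inner_sub_left, real_inner_comm, hS.inner_self, real_inner_self_eq_norm_sq,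
    real_inner_comm] at h1
  have h2 : inner ℝ (S U) U' ≤ g U * g U' := (le_abs_self _).trans (hS.abs_inner_le _ _)
  have h2' := two_mul_le_sq_add (g U) (g U')
  have h3 : inner ℝ f (S U) ≤ M₀ * ‖S U‖ :=
    (real_inner_le_norm _ _).trans (mul_le_mul_of_nonneg_right h.force (norm_nonneg _))
  have h4 : 2 * (M₀ * ‖S U‖) ≤ μ / 2 * ‖S U‖ ^ 2 + 2 * M₀ ^ 2 / μ := by
    have e1 : μ / 2 * ‖S U‖ ^ 2 + 2 * M₀ ^ 2 / μ - 2 * (M₀ * ‖S U‖)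
        = (μ * ‖S U‖ - 2 * M₀) ^ 2 / (2 * μ) := by
      field_simp
      ring
    have e2 : 0 ≤ (μ * ‖S U‖ - 2 * M₀) ^ 2 / (2 * μ) := by positivity
    linarith
  have h5 : -b U U (S U) ≤ c * (√R * g U * √‖S U‖ ^ 3) := by
    refine (neg_le_abs _).trans ((hS.abs_form_self_le U (S U)).trans ?_)
    refine mul_le_mul_of_nonneg_left ?_ hc
    have e1 : √‖S U‖ ^ 3 = √‖S U‖ * ‖S U‖ := by
      rw [pow_succ', Real.sq_sqrt (norm_nonneg _)]
    have e2 : √(‖U‖ * ‖S U‖) ≤ √R * √‖S U‖ := by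
      rw [← Real.sqrt_mul hR0]
      exact Real.sqrt_le_sqrt (mul_le_mul_of_nonneg_right hR (norm_nonneg _))
    rw [e1]
    calc √(‖U‖ * ‖S U‖) * g U * ‖S U‖ ≤ √R * √‖S U‖ * g U * ‖S U‖ := by
          have := hS.nonneg U
          gcongr
      _ = _ := by ring
  have h6 : 2 * (c * (√R * g U * √‖S U‖ ^ 3))
      ≤ μ / 2 * ‖S U‖ ^ 2 + 128 * c ^ 4 * R ^ 2 / μ ^ 3 * (g U ^ 2) ^ 2 := by
    have e0 : 0 ≤ 2 * c * √R * g U := by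
      have := hS.nonneg U
      positivity
    have e1 := mul_pow_three_le (half_pos hμ) e0 (Real.sqrt_nonneg ‖S U‖)
    have e2 : √‖S U‖ ^ 4 = ‖S U‖ ^ 2 := by
      rw [show (4 : ℕ) = 2 * 2 by norm_num, pow_mul, Real.sq_sqrt (norm_nonneg _)]
    have e3 : (2 * c * √R * g U) ^ 4 / (μ / 2) ^ 3
        = 128 * c ^ 4 * R ^ 2 / μ ^ 3 * (g U ^ 2) ^ 2 := by
      have : √R ^ 4 = R ^ 2 := by
        rw [show (4 : ℕ) = 2 * 2 by norm_num, pow_mul, Real.sq_sqrt hR0]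
      rw [mul_pow, mul_pow, mul_pow, this]
      field_simp
      ring
    rw [e2, e3] at e1
    calc 2 * (c * (√R * g U * √‖S U‖ ^ 3)) = 2 * c * √R * g U * √‖S U‖ ^ 3 := by ring
      _ ≤ _ := e1
  have h7 : k * γ * inner ℝ (S V) (S U) = ‖S V‖ ^ 2 - e * inner ℝ (S V) (S V') := by
    rw [← real_inner_smul_right, h.smul_map, inner_sub_right, real_inner_smul_right,
      real_inner_self_eq_norm_sq]
  have h8 : inner ℝ (S V) (S V') ≤ ‖S V‖ * ‖S V'‖ := real_inner_le_norm _ _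
  have h8' := two_mul_le_sq_add ‖S V‖ ‖S V'‖
  have h9 : 2 * (k * inner ℝ (S V) (S U))
      ≥ e / γ * ‖S V‖ ^ 2 - e / γ * ‖S V'‖ ^ 2 + 2 * (1 - e) / γ * ‖S V‖ ^ 2 := by
    have e1 : k * inner ℝ (S V) (S U) = (‖S V‖ ^ 2 - e * inner ℝ (S V) (S V')) / γ := by
      rw [eq_div_iff hγ.ne', ← h7]
      ring
    have e2 : e / γ * ‖S V‖ ^ 2 - e / γ * ‖S V'‖ ^ 2 + 2 * (1 - e) / γ * ‖S V‖ ^ 2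
        = (2 * ‖S V‖ ^ 2 - e * (‖S V‖ ^ 2 + ‖S V'‖ ^ 2)) / γ := by ring
    have e3 : e * (2 * inner ℝ (S V) (S V')) ≤ e * (‖S V‖ ^ 2 + ‖S V'‖ ^ 2) := by
      refine mul_le_mul_of_nonneg_left ?_ he
      linarith
    rw [e1, e2, ge_iff_le, ← mul_div_assoc]
    refine div_le_div_of_nonneg_right ?_ hγ.le
    linarith
  have h10 : k * (2 * (inner ℝ f (S U) - b U U (S U)))
      ≤ k * (μ * ‖S U‖ ^ 2 + (2 * M₀ ^ 2 / μ + 128 * c ^ 4 * R ^ 2 / μ ^ 3 * (g U ^ 2) ^ 2)) :=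
    mul_le_mul_of_nonneg_left (by linarith) hk.le
  linarith

/-- The elementary inequality behind the growth estimate: either `G` is bounded by a multiple of `H`,
or the quadratic terms are absorbed and `P` bounds `G`. -/
theorem le_of_growth {P G H : ℝ} (hμ : 0 < μ) (hc : 0 ≤ c) (hR : 0 ≤ R) (hP : 0 ≤ P)
    (hG : 0 ≤ G) (hH : 0 ≤ H)
    (h : μ * G ^ 2 ≤ μ * (G * H) + P * (G + H)
      + c * (√(R * G) * (H * √(2 * R * (G + H)) + (G + H) * √(R * H)))) :
    G ≤ (2 * (μ + 4 * c * R) / μ) ^ 2 * H + 4 * P / μ := by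
  set n := 2 * (μ + 4 * c * R) / μ with hn
  have hn2 : 1 ≤ n := by
    rw [hn, le_div_iff₀ hμ]
    have : 0 ≤ c * R := by positivity
    linarith
  have hn0 : 0 < n := by linarith
  have hPμ : 0 ≤ 4 * P / μ := by positivity
  rcases le_total G (n ^ 2 * H) with hGH | hGH
  · linarith
  -- when `H` is small relative to `G`, the quadratic terms on the right are absorbed
  have hsq : n * √H ≤ √G := by
    refine Real.le_sqrt_of_sq_le ?_
    rw [mul_pow, Real.sq_sqrt hH]
    exact hGH
  have hHG' : n * H ≤ G := by
    refine le_trans ?_ hGH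
    refine mul_le_mul_of_nonneg_right ?_ hH
    rw [pow_two]
    exact le_mul_of_one_le_left hn0.le hn2
  have hHG : H ≤ G := (le_mul_of_one_le_left hH hn2).trans hHG'
  have hs1 : √(2 * R * (G + H)) ≤ 2 * √(R * G) := by
    refine Real.sqrt_le_iff.2 ⟨by positivity, ?_⟩
    rw [mul_pow, Real.sq_sqrt (by positivity)]
    have := mul_le_mul_of_nonneg_left hHG hR
    linarith
  have hs2 : n * √(R * H) ≤ √(R * G) := by
    rw [Real.sqrt_mul hR, Real.sqrt_mul hR]
    have := mul_le_mul_of_nonneg_left hsq (Real.sqrt_nonneg R)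
    linarith
  have hs3 : √(R * G) * √(R * G) = R * G := Real.mul_self_sqrt (by positivity)
  have key : n * (√(R * G) * (H * √(2 * R * (G + H)) + (G + H) * √(R * H))) ≤ 4 * R * G ^ 2 := by
    calc n * (√(R * G) * (H * √(2 * R * (G + H)) + (G + H) * √(R * H)))
        = √(R * G) * ((n * H) * √(2 * R * (G + H)) + (G + H) * (n * √(R * H))) := by ring
      _ ≤ √(R * G) * (G * (2 * √(R * G)) + (G + G) * √(R * G)) := by gcongr
      _ = 4 * (√(R * G) * √(R * G)) * G := by ring
      _ = _ := by rw [hs3]; ring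
  have key2 : n * (μ * (G * H)) ≤ μ * G ^ 2 := by
    calc n * (μ * (G * H)) = μ * (G * (n * H)) := by ring
      _ ≤ μ * (G * G) := by gcongr
      _ = _ := by ring
  have key3 : n * (μ * G ^ 2) ≤ (μ + 4 * c * R) * G ^ 2 + n * (P * (2 * G)) := by
    have e1 := mul_le_mul_of_nonneg_left h hn0.le
    have e2 := mul_le_mul_of_nonneg_left key hc
    have e3 : n * (P * (G + H)) ≤ n * (P * (2 * G)) := by
      gcongr
      linarith
    linarith
  have hnμ : n * μ = 2 * (μ + 4 * c * R) := by
    rw [hn]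
    field_simp
  have key4 : (n * G) * (μ * G) ≤ (n * G) * (4 * P) := by
    have : (μ + 4 * c * R) * G ^ 2 = n * μ * G ^ 2 / 2 := by
      rw [hnμ]
      ring
    linarith
  have hfin : G ≤ 4 * P / μ := by
    rcases hG.eq_or_lt with h0 | h0
    · rw [← h0]
      exact hPμ
    · rw [le_div_iff₀ hμ, mul_comm]
      exact le_of_mul_le_mul_left key4 (by positivity)
  have : 0 ≤ n ^ 2 * H := by positivity
  linarith

/-- The Dirichlet norm grows at most by a fixed factor in one step, obtained by testing with
`U - U'`. -/
theorem IsStep.growth {Q : ℝ} (hS : IsConvective S g b lam c)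
    (h : IsStep S b μ γ e k M₀ f U' V' U V) (hμ : 0 < μ) (hk : 0 < k) (hc : 0 ≤ c)
    (hlam : 0 ≤ lam) (hR : ‖U‖ ≤ R) (hR' : ‖U'‖ ≤ R) (hQ : g V ≤ Q) :
    g U ≤ (2 * (μ + 4 * c * R) / μ) ^ 2 * g U' + 4 * (Q + M₀ * lam) / μ := by
  have hR0 : 0 ≤ R := (norm_nonneg _).trans hR
  have hM : 0 ≤ M₀ := (norm_nonneg _).trans h.force
  have hQ0 : 0 ≤ Q := (hS.nonneg V).trans hQ
  have hG := hS.nonneg U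
  have hH := hS.nonneg U'
  refine le_of_growth hμ hc hR0 (by positivity) hG hH ?_
  have h1 := h.eqn (U - U')
  have hd : ‖U - U'‖ ≤ lam * (g U + g U') := by
    refine (hS.norm_le _).trans (mul_le_mul_of_nonneg_left (hS.sub_le _ _) hlam)
  have hd' : ‖U - U'‖ ≤ 2 * R := (norm_sub_le _ _).trans (by linarith)
  have h2 : g U ^ 2 - g U * g U' ≤ inner ℝ (S U) (U - U') := by
    rw [inner_sub_right, hS.inner_self]
    have := (le_abs_self _).trans (hS.abs_inner_le U U')
    linarith
  have h3 : -(Q * (g U + g U')) ≤ inner ℝ (S V) (U - U') := by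
    have e1 := (abs_le.1 (hS.abs_inner_le V (U - U'))).1
    have e2 : g V * g (U - U') ≤ Q * (g U + g U') :=
      mul_le_mul hQ (hS.sub_le _ _) (hS.nonneg _) hQ0
    linarith
  have h4 : inner ℝ f (U - U') ≤ M₀ * (lam * (g U + g U')) :=
    (real_inner_le_norm _ _).trans (mul_le_mul h.force hd (norm_nonneg _) hM)
  have h5 : -b U U (U - U') ≤ c * (√(R * g U) * (g U' * √(2 * R * (g U + g U'))
      + (g U + g U') * √(R * g U'))) := by
    have e1 := hS.form_sub U U U' (U - U')
    rw [hS.form_self] at e1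
    rw [sub_eq_zero.1 e1.symm]
    refine (neg_le_abs _).trans ((hS.abs_form_le U U' (U - U')).trans ?_)
    have e2 := hS.sub_le U U'
    have e3 := hS.nonneg (U - U')
    gcongr
  have h6 : 0 ≤ inner ℝ (U - U') (U - U') := real_inner_self_nonneg
  have h7 : k * (μ * inner ℝ (S U) (U - U') + inner ℝ (S V) (U - U'))
      ≤ k * (inner ℝ f (U - U') - b U U (U - U')) := by linarith
  have h8 := le_of_mul_le_mul_left h7 hk
  have h9 := mul_le_mul_of_nonneg_left h2 hμ.le
  linarith

/-- The combination `Z = S V + (γ/μ) U` is damped at a rate that does not degenerate with the mesh: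
the stiff terms `S U` cancel in its equation. -/
theorem IsStep.damping (hS : IsConvective S g b lam c) (h : IsStep S b μ γ e k M₀ f U' V' U V)
    (hμ : 0 < μ) (hγ : 0 < γ) (hk : 0 < k) (hc : 0 ≤ c) (he : 0 ≤ e) (he1 : e ≤ 1)
    (heδ : 1 - e ≤ δ * k) (hR : ‖U‖ ≤ R) (hR' : ‖U'‖ ≤ R) :
    (1 + k * (γ / μ)) * ‖S V + (γ / μ) • U‖ ≤ ‖S V' + (γ / μ) • U'‖
      + k * (γ / μ * (δ * R + γ / μ * R + M₀)
        + γ / μ * c * √R * (√‖S U‖ * √(g U ^ 2))) := by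
  have hR0 : 0 ≤ R := (norm_nonneg _).trans hR
  have hG := hS.nonneg U
  set κ := γ / μ with hκ
  have hκ0 : 0 < κ := by positivity
  have hκμ : κ * μ = γ := by
    rw [hκ]
    field_simp
  set Z := S V + κ • U with hZ
  set Z' := S V' + κ • U' with hZ'
  have h1 := h.eqn Z
  have h2 : (1 + k * κ) * ‖Z‖ ^ 2 = e * inner ℝ Z' Z + (1 - e) * κ * inner ℝ U' Z
      + k * κ ^ 2 * inner ℝ U Z + k * κ * (inner ℝ f Z - b U U Z) := by
    have e1 : k * γ * inner ℝ (S U) Z = inner ℝ (S V) Z - e * inner ℝ (S V') Z := by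
      rw [← real_inner_smul_left, h.smul_map, inner_sub_left, real_inner_smul_left]
    have e2 : ‖Z‖ ^ 2 = inner ℝ (S V) Z + κ * inner ℝ U Z := by
      rw [← real_inner_self_eq_norm_sq]
      nth_rewrite 1 [hZ]
      rw [inner_add_left, real_inner_smul_left]
    have e3 : inner ℝ Z' Z = inner ℝ (S V') Z + κ * inner ℝ U' Z := by
      rw [hZ', inner_add_left, real_inner_smul_left]
    rw [inner_sub_left] at h1
    rw [e2, e3]
    have e4 := congrArg (fun t => κ * t) h1
    rw [← hκμ] at e1
    linarith
  have hb : -b U U Z ≤ c * √R * (√‖S U‖ * √(g U ^ 2)) * ‖Z‖ := by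
    refine (neg_le_abs _).trans ((hS.abs_form_self_le U Z).trans ?_)
    rw [Real.sqrt_sq hG]
    have e2 : √(‖U‖ * ‖S U‖) ≤ √R * √‖S U‖ := by
      rw [← Real.sqrt_mul hR0]
      exact Real.sqrt_le_sqrt (mul_le_mul_of_nonneg_right hR (norm_nonneg _))
    calc c * (√(‖U‖ * ‖S U‖) * g U * ‖Z‖) ≤ c * (√R * √‖S U‖ * g U * ‖Z‖) := by gcongr
      _ = _ := by ring
  have hf : inner ℝ f Z ≤ M₀ * ‖Z‖ :=
    (real_inner_le_norm _ _).trans (mul_le_mul_of_nonneg_right h.force (norm_nonneg _))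
  have hU : inner ℝ U Z ≤ R * ‖Z‖ :=
    (real_inner_le_norm _ _).trans (mul_le_mul_of_nonneg_right hR (norm_nonneg _))
  have hU' : (1 - e) * κ * inner ℝ U' Z ≤ δ * k * κ * (R * ‖Z‖) := by
    have e1 : inner ℝ U' Z ≤ R * ‖Z‖ :=
      (real_inner_le_norm _ _).trans (mul_le_mul_of_nonneg_right hR' (norm_nonneg _))
    calc (1 - e) * κ * inner ℝ U' Z ≤ (1 - e) * κ * (R * ‖Z‖) :=
          mul_le_mul_of_nonneg_left e1 (mul_nonneg (by linarith) hκ0.le)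
      _ ≤ _ := by gcongr
  have hZZ : e * inner ℝ Z' Z ≤ ‖Z'‖ * ‖Z‖ := by
    calc e * inner ℝ Z' Z ≤ e * (‖Z'‖ * ‖Z‖) :=
          mul_le_mul_of_nonneg_left (real_inner_le_norm _ _) he
      _ ≤ _ := mul_le_of_le_one_left (by positivity) he1
  have h3 : k * κ ^ 2 * inner ℝ U Z ≤ k * κ ^ 2 * (R * ‖Z‖) :=
    mul_le_mul_of_nonneg_left hU (by positivity)
  have h4 : k * κ * (inner ℝ f Z - b U U Z)
      ≤ k * κ * (M₀ * ‖Z‖ + c * √R * (√‖S U‖ * √(g U ^ 2)) * ‖Z‖) :=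
    mul_le_mul_of_nonneg_left (by linarith) (by positivity)
  rcases (norm_nonneg Z).eq_or_lt with h0 | h0
  · rw [← h0, mul_zero]
    have hM : 0 ≤ M₀ := (norm_nonneg _).trans h.force
    have hδk : 0 ≤ δ * k := by linarith
    have hδ : 0 ≤ δ := nonneg_of_mul_nonneg_left hδk hk
    positivity
  · refine le_of_mul_le_mul_right ?_ h0
    linarith

end Step

/-! ### Uniform bounds along trajectories -/

/-- A solution `(U, V)` of the backward Euler scheme on the steps `1, …, N`, with vanishing initial
memory. -/
structure IsTrajectory {J : Type} [NormedAddCommGroup J] [InnerProductSpace ℝ J]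
    (S : J →ₗ[ℝ] J) (b : J → J → J → ℝ) (μ γ δ k M₀ : ℝ) (N : ℕ) (f U V : ℕ → J) : Prop where
  memory_zero : V 0 = 0
  step : ∀ n, n < N →
    IsStep S b μ γ (Real.exp (-δ * k)) k M₀ (f n) (U n) (V n) (U (n + 1)) (V (n + 1))

theorem one_sub_exp_neg_le (δ k : ℝ) : 1 - Real.exp (-δ * k) ≤ δ * k := by
  have := Real.add_one_le_exp (-δ * k)
  linarith

theorem mul_exp_neg_le (δ k : ℝ) : δ * k * Real.exp (-δ * k) ≤ 1 - Real.exp (-δ * k) := by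
  have h1 := Real.add_one_le_exp (δ * k)
  have h2 : Real.exp (δ * k) * Real.exp (-δ * k) = 1 := by
    rw [← Real.exp_add, neg_mul, add_neg_cancel, Real.exp_zero]
  have h3 := mul_le_mul_of_nonneg_right h1 (Real.exp_pos (-δ * k)).le
  linarith

theorem exp_neg_mul_le_one {δ k : ℝ} (hδ : 0 < δ) (hk : 0 < k) : Real.exp (-δ * k) ≤ 1 := by
  rw [Real.exp_le_one_iff, neg_mul]
  exact (neg_neg_of_pos (mul_pos hδ hk)).le

/-- The bound for the energy `‖Uⁿ‖² + (e/γ) ‖∇Vⁿ‖²`. -/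
noncomputable def energyBound (μ δ lam M₀ : ℝ) : ℝ :=
  max (M₀ ^ 2) (M₀ ^ 2 * lam ^ 2 / μ / min (μ / lam ^ 2) (2 * δ))

theorem energyBound_nonneg (μ δ lam M₀ : ℝ) : 0 ≤ energyBound μ δ lam M₀ :=
  (sq_nonneg M₀).trans (le_max_left _ _)

namespace IsTrajectory

variable {J : Type} [NormedAddCommGroup J] [InnerProductSpace ℝ J] {S : J →ₗ[ℝ] J} {g : J → ℝ}
  {b : J → J → J → ℝ} {lam c μ γ δ k M₀ : ℝ} {N n : ℕ} {f U V : ℕ → J}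

theorem step_energy_le (hT : IsTrajectory S b μ γ δ k M₀ N f U V) (hS : IsConvective S g b lam c)
    (hμ : 0 < μ) (hγ : 0 < γ) (hδ : 0 < δ) (hk : 0 < k) (hn : n < N) :
    ‖U (n + 1)‖ ^ 2 + Real.exp (-δ * k) / γ * g (V (n + 1)) ^ 2 + k * (μ * g (U (n + 1)) ^ 2)
      ≤ ‖U n‖ ^ 2 + Real.exp (-δ * k) / γ * g (V n) ^ 2 + k * (M₀ ^ 2 * lam ^ 2 / μ) := by
  have h := (hT.step n hn).energy hS hμ hγ (Real.exp_pos _).le hk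
  have h1 : 0 ≤ 2 * (1 - Real.exp (-δ * k)) / γ * g (V (n + 1)) ^ 2 := by
    have := exp_neg_mul_le_one hδ hk
    have h2 : 0 ≤ 1 - Real.exp (-δ * k) := by linarith
    positivity
  linarith

/-- Uniform bound for the energy: the dissipation controls it, by the Poincaré inequality and by
the exponential decay of the memory. -/
theorem energy_le (hT : IsTrajectory S b μ γ δ k M₀ N f U V) (hS : IsConvective S g b lam c)
    (hμ : 0 < μ) (hγ : 0 < γ) (hδ : 0 < δ) (hlam : 0 < lam) (hk : 0 < k) (hU : ‖U 0‖ ≤ M₀)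
    (hn : n ≤ N) :
    ‖U n‖ ^ 2 + Real.exp (-δ * k) / γ * g (V n) ^ 2 ≤ energyBound μ δ lam M₀ := by
  have hg0 : g (0 : J) = 0 := by
    have h := hS.inner_self 0
    rw [inner_zero_right] at h
    exact pow_eq_zero_iff two_ne_zero |>.1 h.symm
  induction n with
  | zero =>
    rw [hT.memory_zero, hg0]
    have : ‖U 0‖ ^ 2 ≤ M₀ ^ 2 := pow_le_pow_left₀ (norm_nonneg _) hU 2
    have := le_max_left (M₀ ^ 2) (M₀ ^ 2 * lam ^ 2 / μ / min (μ / lam ^ 2) (2 * δ))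
    rw [energyBound]
    linarith
  | succ n ih =>
    have h := (hT.step n hn).energy hS hμ hγ (Real.exp_pos _).le hk
    set e := Real.exp (-δ * k) with he
    have he0 : 0 < e := Real.exp_pos _
    set c₀ := min (μ / lam ^ 2) (2 * δ) with hc₀
    have hc₀0 : 0 < c₀ := lt_min (by positivity) (by positivity)
    have h1 : c₀ * ‖U (n + 1)‖ ^ 2 ≤ μ * g (U (n + 1)) ^ 2 := by
      have e1 : ‖U (n + 1)‖ ^ 2 ≤ (lam * g (U (n + 1))) ^ 2 :=
        pow_le_pow_left₀ (norm_nonneg _) (hS.norm_le _) 2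
      calc c₀ * ‖U (n + 1)‖ ^ 2 ≤ μ / lam ^ 2 * (lam * g (U (n + 1))) ^ 2 :=
            mul_le_mul (min_le_left _ _) e1 (sq_nonneg _) (by positivity)
        _ = _ := by field_simp
    have h2 : k * (c₀ * (e / γ * g (V (n + 1)) ^ 2)) ≤ 2 * (1 - e) / γ * g (V (n + 1)) ^ 2 := by
      have e1 : c₀ ≤ 2 * δ := min_le_right _ _
      have e2 : δ * k * e ≤ 1 - e := mul_exp_neg_le δ k
      calc k * (c₀ * (e / γ * g (V (n + 1)) ^ 2))
          ≤ k * (2 * δ * (e / γ * g (V (n + 1)) ^ 2)) := by gcongr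
        _ = 2 * (δ * k * e) / γ * g (V (n + 1)) ^ 2 := by ring
        _ ≤ _ := by gcongr
    have h3 := mul_le_mul_of_nonneg_left h1 hk.le
    refine (le_max_of_add_mul_le hc₀0 hk (x' := ‖U n‖ ^ 2 + e / γ * g (V n) ^ 2)
      (A := M₀ ^ 2 * lam ^ 2 / μ) (by linarith)).trans ?_
    exact max_le (ih (by omega)) (le_max_right _ _)

theorem norm_le (hT : IsTrajectory S b μ γ δ k M₀ N f U V) (hS : IsConvective S g b lam c)
    (hμ : 0 < μ) (hγ : 0 < γ) (hδ : 0 < δ) (hlam : 0 < lam) (hk : 0 < k) (hU : ‖U 0‖ ≤ M₀)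
    (hn : n ≤ N) : ‖U n‖ ≤ √(energyBound μ δ lam M₀) := by
  refine Real.le_sqrt_of_sq_le ?_
  have := hT.energy_le hS hμ hγ hδ hlam hk hU hn
  have h : 0 ≤ Real.exp (-δ * k) / γ * g (V n) ^ 2 := by positivity
  linarith

end IsTrajectory

/-- For time steps `k ≥ 1` a single step dissipates enough energy to bound the Dirichlet norm, and the
higher energy is then damped by the decay of the memory. -/
theorem exists_bound_of_one_le {lam c μ γ δ M₀ G₀ : ℝ} (hlam : 0 < lam) (hc : 0 ≤ c) (hμ : 0 < μ)
    (hγ : 0 < γ) (hδ : 0 < δ) :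
    ∃ K : ℝ, ∀ (J : Type) [NormedAddCommGroup J] [InnerProductSpace ℝ J] (S : J →ₗ[ℝ] J)
      (g : J → ℝ) (b : J → J → J → ℝ), IsConvective S g b lam c →
      ∀ k : ℝ, 1 ≤ k → ∀ (N : ℕ) (f U V : ℕ → J), IsTrajectory S b μ γ δ k M₀ N f U V →
        ‖U 0‖ ≤ M₀ → g (U 0) ≤ G₀ →
        ∀ n ≤ N, g (U n) ^ 2 + Real.exp (-δ * k) / γ * ‖S (V n)‖ ^ 2 ≤ K := by
  set E₀ := energyBound μ δ lam M₀ with hE₀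
  set Y := (E₀ + M₀ ^ 2 * lam ^ 2 / μ) / μ with hY
  set A := 2 * M₀ ^ 2 / μ + 128 * c ^ 4 * √E₀ ^ 2 / μ ^ 3 * Y ^ 2 + 2 * δ * Y with hA
  refine ⟨max (G₀ ^ 2) (A / (2 * δ)), fun J _ _ S g b hS k hk1 N f U V hT hU hG n hn => ?_⟩
  have hk : 0 < k := by linarith
  have hE₀0 : 0 ≤ E₀ := energyBound_nonneg _ _ _ _
  have he0 : 0 < Real.exp (-δ * k) := Real.exp_pos _
  induction n with
  | zero =>
    rw [hT.memory_zero, map_zero, norm_zero]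
    have := pow_le_pow_left₀ (hS.nonneg (U 0)) hG 2
    have := le_max_left (G₀ ^ 2) (A / (2 * δ))
    linarith
  | succ n ih =>
    have hy : g (U (n + 1)) ^ 2 ≤ Y := by
      have h1 := hT.step_energy_le hS hμ hγ hδ hk hn
      have h2 := hT.energy_le hS hμ hγ hδ hlam hk hU (n := n) (by omega)
      rw [← hE₀] at h2
      have h3 : 0 ≤ Real.exp (-δ * k) / γ * g (V (n + 1)) ^ 2 := by positivity
      have h4 : k * (μ * g (U (n + 1)) ^ 2) ≤ k * (E₀ + M₀ ^ 2 * lam ^ 2 / μ) := by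
        have : E₀ ≤ k * E₀ := le_mul_of_one_le_left hE₀0 hk1
        have := sq_nonneg ‖U (n + 1)‖
        linarith
      have h5 := le_of_mul_le_mul_left h4 hk
      rw [hY, le_div_iff₀ hμ]
      linarith
    have h := (hT.step n hn).higher_energy hS hμ hγ he0.le hk hc
      (hT.norm_le hS hμ hγ hδ hlam hk hU hn)
    rw [← hE₀] at h
    set e := Real.exp (-δ * k) with he
    have h2 : k * (2 * δ * (e / γ * ‖S (V (n + 1))‖ ^ 2))
        ≤ 2 * (1 - e) / γ * ‖S (V (n + 1))‖ ^ 2 := by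
      have e2 : δ * k * e ≤ 1 - e := mul_exp_neg_le δ k
      calc k * (2 * δ * (e / γ * ‖S (V (n + 1))‖ ^ 2))
          = 2 * (δ * k * e) / γ * ‖S (V (n + 1))‖ ^ 2 := by ring
        _ ≤ _ := by gcongr
    have h3 : k * (2 * M₀ ^ 2 / μ + 128 * c ^ 4 * √E₀ ^ 2 / μ ^ 3 * (g (U (n + 1)) ^ 2) ^ 2)
        + k * (2 * δ * g (U (n + 1)) ^ 2) ≤ k * A := by
      rw [← mul_add, hA]
      gcongr
    have h4 : 0 ≤ k * (μ * ‖S (U (n + 1))‖ ^ 2) := by positivity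
    refine (le_max_of_add_mul_le (by positivity : 0 < 2 * δ) hk
      (x' := g (U n) ^ 2 + e / γ * ‖S (V n)‖ ^ 2) (A := A) (by linarith)).trans ?_
    exact max_le (ih (by omega)) (le_max_right _ _)

/-- For time steps `k ≤ 1` the estimates of a single step are coupled by the recursive inequalities
of `exists_bound_of_recursion`. -/
theorem exists_bound_of_le_one {lam c μ γ δ M₀ G₀ : ℝ} (hlam : 0 < lam) (hc : 0 ≤ c) (hμ : 0 < μ)
    (hγ : 0 < γ) (hδ : 0 < δ) (hM₀ : 0 < M₀) :
    ∃ K : ℝ, ∀ (J : Type) [NormedAddCommGroup J] [InnerProductSpace ℝ J] (S : J →ₗ[ℝ] J)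
      (g : J → ℝ) (b : J → J → J → ℝ), IsConvective S g b lam c →
      ∀ k : ℝ, 0 < k → k ≤ 1 → ∀ (N : ℕ) (f U V : ℕ → J),
        IsTrajectory S b μ γ δ k M₀ N f U V → ‖U 0‖ ≤ M₀ → g (U 0) ≤ G₀ →
        ∀ n ≤ N, g (U n) ^ 2 + Real.exp (-δ * k) / γ * ‖S (V n)‖ ^ 2 ≤ K := by
  set E₀ := energyBound μ δ lam M₀ with hE₀
  have hE₀0 : 0 ≤ E₀ := energyBound_nonneg _ _ _ _
  set R := √E₀ with hR
  have hR0 : 0 ≤ R := Real.sqrt_nonneg _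
  set κ := γ / μ with hκ
  have hκ0 : 0 < κ := by positivity
  set Q := √(γ * E₀ * Real.exp δ) with hQ
  have hQ0 : 0 ≤ Q := Real.sqrt_nonneg _
  set m := (2 * (μ + 4 * c * R) / μ) ^ 2 with hm
  set q := 4 * (Q + M₀ * lam) / μ with hq
  set Kf := 1 + (1 + κ * R) ^ 2 / γ with hKf
  obtain ⟨K, hK⟩ := exists_bound_of_recursion (μ := μ) (κ := κ) (a := 2 * M₀ ^ 2 / μ)
    (b := 128 * c ^ 4 * R ^ 2 / μ ^ 3) (c₁ := 2 * m ^ 2) (c₂ := 2 * q ^ 2)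
    (a' := κ * (δ * R + κ * R + M₀)) (b' := κ * c * √R) (Kf := Kf)
    (C₀ := M₀ ^ 2 * lam ^ 2 / μ) (R := E₀) (M := max (G₀ ^ 2) (κ * M₀)) hμ hκ0 (by positivity)
    (by positivity) (by positivity) (by positivity) (by positivity) (by positivity) (by positivity)
    hE₀0 (by positivity)
  refine ⟨K, fun J _ _ S g b hS k hk hk1 N f U V hT hU hG => ?_⟩
  have he0 : 0 < Real.exp (-δ * k) := Real.exp_pos _
  have he1 : Real.exp (-δ * k) ≤ 1 := exp_neg_mul_le_one hδ hk
  have hnorm : ∀ n ≤ N, ‖U n‖ ≤ R := fun n hn => hT.norm_le hS hμ hγ hδ hlam hk hU hn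
  have hG2 : g (U 0) ^ 2 ≤ G₀ ^ 2 := pow_le_pow_left₀ (hS.nonneg _) hG 2
  refine hK k hk hk1 N (fun n => g (U n) ^ 2) (fun n => ‖S (U n)‖)
    (fun n => g (U n) ^ 2 + Real.exp (-δ * k) / γ * ‖S (V n)‖ ^ 2)
    (fun n => ‖S (V n) + κ • U n‖) (fun n => ‖U n‖ ^ 2 + Real.exp (-δ * k) / γ * g (V n) ^ 2)
    (fun n => by positivity) (fun n => by positivity) (fun n => by positivity)
    (fun n => by positivity) (fun n => by positivity) (hG2.trans (le_max_left _ _)) ?_ ?_ ?_ ?_ ?_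
    ?_ ?_ ?_ ?_
  · rw [hT.memory_zero, map_zero, norm_zero]
    have := le_max_left (G₀ ^ 2) (κ * M₀)
    linarith
  · rw [hT.memory_zero, map_zero, zero_add, norm_smul, Real.norm_of_nonneg hκ0.le]
    exact (mul_le_mul_of_nonneg_left hU hκ0.le).trans (le_max_right _ _)
  · exact fun n hn => hT.energy_le hS hμ hγ hδ hlam hk hU hn
  · intro n
    have : 0 ≤ Real.exp (-δ * k) / γ * ‖S (V n)‖ ^ 2 := by positivity
    linarith
  · intro n hn
    set ζ := ‖S (V n) + κ • U n‖ with hζ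
    have hζ0 : 0 ≤ ζ := norm_nonneg _
    have h1 : ‖S (V n)‖ ≤ (1 + κ * R) * (1 + ζ) := by
      have e1 : ‖S (V n)‖ ≤ ζ + κ * R := by
        have e2 : S (V n) = S (V n) + κ • U n - κ • U n := (add_sub_cancel_right _ _).symm
        rw [e2]
        refine (norm_sub_le _ _).trans ?_
        rw [norm_smul, Real.norm_of_nonneg hκ0.le]
        exact add_le_add le_rfl (mul_le_mul_of_nonneg_left (hnorm n hn) hκ0.le)
      have e3 : 0 ≤ κ * R * ζ := by positivity
      linarith
    have h2 : Real.exp (-δ * k) / γ * ‖S (V n)‖ ^ 2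
        ≤ 1 / γ * ((1 + κ * R) * (1 + ζ)) ^ 2 := by gcongr
    have h3 : 1 ≤ (1 + ζ) ^ 2 := one_le_pow₀ (by linarith)
    have h4 : Kf * (1 + ζ) ^ 2 = (1 + ζ) ^ 2 + 1 / γ * ((1 + κ * R) * (1 + ζ)) ^ 2 := by
      rw [hKf]
      ring
    rw [h4]
    linarith
  · intro n hn
    have h := (hT.step n hn).higher_energy hS hμ hγ he0.le hk hc (hnorm (n + 1) hn)
    have h1 : 0 ≤ 2 * (1 - Real.exp (-δ * k)) / γ * ‖S (V (n + 1))‖ ^ 2 := by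
      have h2 : 0 ≤ 1 - Real.exp (-δ * k) := by linarith
      positivity
    linarith
  · intro n hn
    have hgV : g (V (n + 1)) ≤ Q := by
      refine Real.le_sqrt_of_sq_le ?_
      have h1 := hT.energy_le hS hμ hγ hδ hlam hk hU (n := n + 1) hn
      have h2 : Real.exp (-δ * k) / γ * g (V (n + 1)) ^ 2 ≤ E₀ := by
        have := sq_nonneg ‖U (n + 1)‖
        linarith
      -- for steps `k ≤ 1` the factor `e` is bounded below
      have h3 : 1 ≤ Real.exp δ * Real.exp (-δ * k) := by
        rw [← Real.exp_add]
        refine Real.one_le_exp ?_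
        have := mul_le_mul_of_nonneg_left hk1 hδ.le
        linarith
      calc g (V (n + 1)) ^ 2 ≤ (Real.exp δ * Real.exp (-δ * k)) * g (V (n + 1)) ^ 2 :=
            le_mul_of_one_le_left (sq_nonneg _) h3
        _ = γ * Real.exp δ * (Real.exp (-δ * k) / γ * g (V (n + 1)) ^ 2) := by
            field_simp
        _ ≤ γ * Real.exp δ * E₀ := by gcongr
        _ = _ := by ring
    have h := (hT.step n hn).growth hS hμ hk hc hlam.le (hnorm (n + 1) hn)
      (hnorm n hn.le) hgV
    have h1 := pow_le_pow_left₀ (hS.nonneg _) h 2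
    have h2 := two_mul_le_sq_add (m * g (U n)) q
    change g (U (n + 1)) ^ 2 ≤ 2 * m ^ 2 * g (U n) ^ 2 + 2 * q ^ 2
    calc g (U (n + 1)) ^ 2 ≤ (m * g (U n) + q) ^ 2 := h1
      _ ≤ _ := by linarith
  · exact fun n hn => (hT.step n hn).damping hS hμ hγ hk hc he0.le he1 (one_sub_exp_neg_le δ k)
      (hnorm (n + 1) hn) (hnorm n hn.le)
  · exact fun n hn => hT.step_energy_le hS hμ hγ hδ hk hn

/-! ### The backward Euler scheme as a trajectory -/

namespace FESpaces

variable {Ω : Opens Plane} (X : FESpaces Ω)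

theorem memory_zero (γ δ k : ℝ) (U : ℕ → X.Jh) : X.memory γ δ k U 0 = 0 := by
  simp [memory]

/-- The exponential kernel turns the memory sum into a one-step recursion. -/
theorem memory_succ (γ δ k : ℝ) (U : ℕ → X.Jh) (n : ℕ) :
    X.memory γ δ k U (n + 1)
      = Real.exp (-δ * k) • X.memory γ δ k U n + (k * γ) • U (n + 1) := by
  simp only [memory]
  rw [Finset.sum_Icc_succ_top (by omega), smul_add, smul_comm (Real.exp (-δ * k)) k]
  refine congrArg₂ (· + ·) (congrArg (k • ·) ?_) ?_
  · rw [Finset.smul_sum]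
    refine Finset.sum_congr rfl fun j _ => ?_
    rw [smul_smul]
    refine congrArg (· • U j) ?_
    rw [mul_left_comm, ← Real.exp_add]
    congr 2
    push_cast
    ring
  · rw [smul_smul]
    simp

/-- The finite element problem has the structure `IsConvective`, with constants independent of `h`. -/
theorem Approximation.isConvective {X : FESpaces Ω} {h C : ℝ} (hX : X.Approximation h C)
    (hh : 0 < h) (hC : 0 < C) (hS : StokesRegularity Ω C)
    (hΩ : Bornology.IsBounded (Ω : Set Plane)) :
    IsConvective X.stokesOp (fun u => gradNorm (u : VL2 Ω))
      (fun u v w => bForm (u : VL2 Ω) (v : VL2 Ω) (w : VL2 Ω)) (poincareConst Ω)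
      (max (8 * sobolevConst) (convectConst C)) where
  nonneg u := gradNorm_nonneg _
  inner_self u := X.inner_stokesOp_self u
  abs_inner_le u v := by
    rw [inner_stokesOp]
    exact abs_aForm_le _ _
  sub_le u v := Oldroyd.gradNorm_sub_le (X.memVH10 u) (X.memVH10 v)
  norm_le u := (X.memVH10 u).norm_le hΩ
  form_self u w := bForm_self _ _
  form_sub u w w' φ := bForm_sub_mid (X.memVH10 u) (X.memVH10 w) (X.memVH10 w') (X.memVH10 φ)
  abs_form_le u w φ := by
    refine (abs_bForm_le (X.memVH10 u) (X.memVH10 w) (X.memVH10 φ)).trans ?_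
    have h1 := gradNorm_nonneg (w : VL2 Ω)
    have h2 := gradNorm_nonneg (φ : VL2 Ω)
    exact mul_le_mul_of_nonneg_right (le_max_left _ _) (by positivity)
  abs_form_self_le u φ := by
    refine (hX.abs_bForm_self_le hh hC hS u φ).trans ?_
    have h1 := gradNorm_nonneg (u : VL2 Ω)
    exact mul_le_mul_of_nonneg_right (le_max_right _ _) (by positivity)

theorem IsBackwardEulerSolution.isTrajectory {X : FESpaces Ω} {μ γ δ k M₀ : ℝ} {N : ℕ}
    {f : ℝ → VL2 Ω} {u₀ : VL2 Ω} {U : ℕ → X.Jh} (hk : 0 < k)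
    (hU : X.IsBackwardEulerSolution μ γ δ k N f u₀ U) (hf : ∀ t, 0 < t → ‖f t‖ ≤ M₀) :
    IsTrajectory X.stokesOp (fun u v w => bForm (u : VL2 Ω) (v : VL2 Ω) (w : VL2 Ω)) μ γ δ k M₀ N
      (fun n => X.Ph (f ((n + 1 : ℕ) * k))) U (X.memory γ δ k U) where
  memory_zero := X.memory_zero γ δ k U
  step n hn := by
    refine ⟨X.memory_succ γ δ k U n, ?_, fun φ => ?_⟩
    · exact (Submodule.norm_orthogonalProjectionOnto_apply_le _ _).trans
        (hf _ (by positivity))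
    · have h := hU.2 (n + 1) (by omega) hn φ
      have h1 : inner ℝ (X.Ph (f ((n + 1 : ℕ) * k))) φ
          = inner ℝ (f ((n + 1 : ℕ) * k)) (φ : VL2 Ω) :=
        Submodule.inner_orthogonalProjectionOnto_eq_of_mem_right φ _
      rw [Nat.add_sub_cancel, real_inner_smul_left] at h
      have h2 : inner ℝ (U (n + 1) - U n) φ
          = inner ℝ ((U (n + 1) : VL2 Ω) - (U n : VL2 Ω)) (φ : VL2 Ω) := rfl
      rw [h1, h2, X.inner_stokesOp, X.inner_stokesOp, ← h]
      field_simp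
      ring

end FESpaces

theorem norm_le_vh1Norm {Ω : Opens Plane} (v : VL2 Ω) : ‖v‖ ≤ vh1Norm v := by
  refine Real.le_sqrt_of_sq_le (le_add_of_nonneg_right ?_)
  positivity

theorem gradNorm_le_vh1Norm {Ω : Opens Plane} (v : VL2 Ω) : gradNorm v ≤ vh1Norm v :=
  Real.sqrt_le_sqrt (le_add_of_nonneg_left (sq_nonneg _))

end Oldroyd

theorem lemma4p3
    (Ω : TopologicalSpace.Opens Oldroyd.Plane)
    (hΩ_conn : IsConnected (Ω : Set Oldroyd.Plane))
    (hΩ_bdd : Bornology.IsBounded (Ω : Set Oldroyd.Plane))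
    (μ γ δ C M₀ : ℝ) (hμ : 0 < μ) (hγ : 0 < γ) (hδ : 0 < δ) (hC : 0 < C) (hM₀ : 0 < M₀)
    (hStokes : Oldroyd.StokesRegularity Ω C) :
    ∃ K : ℝ, ∀ (h : ℝ), 0 < h → h < 1 →
      ∀ X : Oldroyd.FESpaces Ω, X.Approximation h C →
      ∀ (f : ℝ → Oldroyd.VL2 Ω), (∀ t, 0 < t → ‖f t‖ ≤ M₀) →
      ∀ (u₀ : Oldroyd.VL2 Ω), Oldroyd.MemJ1 u₀ → Oldroyd.vh1Norm u₀ ≤ M₀ →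
      ∀ (k : ℝ), 0 < k → ∀ (N : ℕ) (U : ℕ → X.Jh),
        X.IsBackwardEulerSolution μ γ δ k N f u₀ U →
        ∀ n, 1 ≤ n → n ≤ N →
          Oldroyd.gradNorm (U n : Oldroyd.VL2 Ω) ^ 2
            + Real.exp (-δ * k) / γ * ‖X.discreteStokes (X.memory γ δ k U n)‖ ^ 2 ≤ K := by
  have hlam := Oldroyd.poincareConst_pos Ω
  have hc : 0 ≤ max (8 * (Oldroyd.sobolevConst : ℝ)) (Oldroyd.FESpaces.convectConst C) :=
    (Oldroyd.FESpaces.convectConst_nonneg hC).trans (le_max_right _ _)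
  obtain ⟨K₁, hK₁⟩ := Oldroyd.exists_bound_of_le_one (G₀ := (1 + 6 * C ^ 3) * M₀) hlam hc hμ hγ hδ
    hM₀
  obtain ⟨K₂, hK₂⟩ := Oldroyd.exists_bound_of_one_le (M₀ := M₀) (G₀ := (1 + 6 * C ^ 3) * M₀) hlam
    hc hμ hγ hδ
  refine ⟨max K₁ K₂, fun h hh _ X hX f hf u₀ hu₀ hu₀M k hk N U hU n _ hn => ?_⟩
  have hS := hX.isConvective hh hC hStokes hΩ_bdd
  have hT := hU.isTrajectory hk hf
  have hU0 : ‖U 0‖ ≤ M₀ := by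
    rw [hU.1]
    exact (Submodule.norm_orthogonalProjectionOnto_apply_le _ _).trans
      ((Oldroyd.norm_le_vh1Norm u₀).trans hu₀M)
  have hG0 : Oldroyd.gradNorm (U 0 : Oldroyd.VL2 Ω) ≤ (1 + 6 * C ^ 3) * M₀ := by
    rw [hU.1]
    refine (hX.gradNorm_Ph_le hh hC hStokes hΩ_bdd hu₀).trans ?_
    exact mul_le_mul_of_nonneg_left ((Oldroyd.gradNorm_le_vh1Norm u₀).trans hu₀M) (by positivity)
  have hnorm : ‖X.discreteStokes (X.memory γ δ k U n)‖ = ‖X.stokesOp (X.memory γ δ k U n)‖ :=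
    (norm_neg _).symm
  rw [hnorm]
  rcases le_total k 1 with hk1 | hk1
  · exact (hK₁ X.Jh _ (fun u => Oldroyd.gradNorm (u : Oldroyd.VL2 Ω)) _ hS k hk hk1 N _ U _ hT hU0 hG0 n hn).trans (le_max_left _ _)
  · exact (hK₂ X.Jh _ (fun u => Oldroyd.gradNorm (u : Oldroyd.VL2 Ω)) _ hS k hk1 N _ U _ hT hU0 hG0 n hn).trans (le_max_right _ _)
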